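/- A CAT(0) cube complex is a simply connected cube complex in which the link of every vertex is a flag simplicial complex (dimension may be infinite; the complex is nonempty). Let $\operatorname{CCC}$ be the category whose objects are the nonempty CAT(0) cube complexes and whose morphisms are the convex cubical embeddings. For a CAT(0) cube complex $Z$ let $\operatorname{Face}(Z)$ be the poset of its cubes, ordered by inclusion and viewed as a category. A contravariant functor $\Psi:\operatorname{Face}(Z)\to\operatorname{CCC}$ is called *1-determined* if for every cube $\sigma$ of $Z$ and every vertex $v$ of $\sigma$ $$\operatorname{Im}(\Psi(\sigma)\to\Psi(v))=\bigcap_{e}\operatorname{Im}(\Psi(e)\to\Psi(v)),$$ where $e$ runs over the edges of $\sigma$ that contain $v$ (for $\sigma=v$ the empty intersection is $\Psi(v)$). A cubical map $q:Y\to Z$ between CAT(0) cube complexes is a *restriction quotient* if there are a set $\mathcal K$ of walls of the vertex set $Y^{(0)}$, each induced by a hyperplane of $Y$, and an isomorphism $\phi$ from $Z$ to the cube complex $Y(\mathcal K)$ dual to the wallspace $(Y^{(0)},\mathcal K)$, such that for every vertex $y$ of $Y$ the vertex $\phi(q(y))$ of $Y(\mathcal K)$ is the orientation of $\mathcal K$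 that chooses, for each wall in $\mathcal K$, the halfspace containing $y$. The *fiber functor* $\Psi_q$ of a restriction quotient $q:Y\to Z$ sends a cube $\sigma$ of $Z$ to the fiber $q^{-1}(x)$ over an interior point $x$ of $\sigma$, with its induced cube complex structure: its cubes are the sets $\eta\cap q^{-1}(x)$ with $\eta$ a cube of $Y$ and $q(\eta)=\sigma$, and its vertices correspond to the cubes of $Y$ that $q$ maps isomorphically onto $\sigma$. It sends an inclusion $\sigma_1\subseteq\sigma_2$ to the map of fibers given on vertices by $\eta\mapsto\eta\cap q^{-1}(\sigma_1)$. **Theorem.** Let $Z$ be a CAT(0) cube complex. 1. For every 1-determined contravariant functor $\Psi:\operatorname{Face}(Z)\to\operatorname{CCC}$ there are a CAT(0) cube complex $Y$ and a restriction quotient $q:Y\to Z$ whose fiber functor $\Psi_q$ is a functor to $\operatorname{CCC}$ that is naturally isomorphic to $\Psi$. 2. Conversely, for every CAT(0) cube complex $Y$ and every restriction quotient $q:Y\to Z$, the fibers above are nonempty CAT(0) cube complexes and the maps between them are convex cubical embeddings, so that $\Psi_q$ is a contravariant functor $\operatorname{Face}(Z)\to\operatorname{CCC}$; and this functor is 1-determined.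 -/

import Mathlib

open CategoryTheory

universe u

/-- A set of vertices together with a family of distinguished vertex sets (the cubes). No axioms are
imposed here; the axioms of a cube complex are `CubeData.IsCubeComplex`. -/
structure CubeData : Type (u + 1) where
  /-- the vertices -/
  V : Type u
  /-- the vertex sets of the cubes -/
  cubes : Set (Set V)

/-- The vertex set of a face of the cube `{0,1}ⁿ`: the coordinates `i` with `p i = some b` are
fixed to be `b`, the others are free. -/
def subcube {n : ℕ} (p : Fin n → Option Bool) : Set (Fin n → Bool) :=
  {x | ∀ i, ∀ b, p i = some b → x i = b}

namespace CubeData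

/-- `e` identifies the vertices of the standard `n`-cube with `C`, in such a way that the cubes
of `K` contained in `C` are exactly the faces of the standard cube. -/
structure IsChart (K : CubeData.{u}) {n : ℕ} (e : (Fin n → Bool) → K.V) (C : Set K.V) : Prop where
  injective : Function.Injective e
  range_eq : Set.range e = C
  mem_cubes_iff : ∀ S, S ⊆ C → (S ∈ K.cubes ↔ ∃ p : Fin n → Option Bool, S = e '' subcube p)

/-- Cube complexes (finite cubes, arbitrary dimension): unit cubes glued along isometric faces, such
that each cube embeds and two cubes meet in the empty set or in a common face. A cube is recorded by
its vertex set. -/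
structure IsCubeComplex (K : CubeData.{u}) : Prop where
  singleton_mem : ∀ v : K.V, {v} ∈ K.cubes
  exists_chart : ∀ C ∈ K.cubes, ∃ (n : ℕ) (e : (Fin n → Bool) → K.V), K.IsChart e C
  inter_mem : ∀ C ∈ K.cubes, ∀ D ∈ K.cubes, (C ∩ D).Nonempty → C ∩ D ∈ K.cubes

/-- The 1-skeleton. -/
def graph (K : CubeData.{u}) : SimpleGraph K.V where
  Adj x y := x ≠ y ∧ {x, y} ∈ K.cubes
  symm := ⟨fun x y h => ⟨h.1.symm, by rw [Set.pair_comm]; exact h.2⟩⟩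
  loopless := ⟨fun _ h => h.1 rfl⟩

/-- `a, b, c, d` are, in cyclic order, the vertices of a 2-cube. -/
structure IsSquare (K : CubeData.{u}) (a b c d : K.V) : Prop where
  mem : {a, b, c, d} ∈ K.cubes
  ab : K.graph.Adj a b
  bc : K.graph.Adj b c
  ad : K.graph.Adj a d
  dc : K.graph.Adj d c
  ac_ne : a ≠ c
  bd_ne : b ≠ d

/-- Homotopy of edge paths relative to their endpoints: the equivalence relation generated by
deleting backtracks and by pushing a path across a 2-cube. -/
inductive Homotopic (K : CubeData.{u}) :
    ∀ {x y : K.V}, K.graph.Walk x y → K.graph.Walk x y → Prop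
  | refl {x y : K.V} (p : K.graph.Walk x y) : Homotopic K p p
  | symm {x y : K.V} {p q : K.graph.Walk x y} : Homotopic K p q → Homotopic K q p
  | trans {x y : K.V} {p q r : K.graph.Walk x y} :
      Homotopic K p q → Homotopic K q r → Homotopic K p r
  | backtrack {x y a b : K.V} (p : K.graph.Walk x a) (h : K.graph.Adj a b)
      (q : K.graph.Walk a y) :
      Homotopic K (p.append (.cons h (.cons h.symm q))) (p.append q)
  | square {x y a b c d : K.V} (p : K.graph.Walk x a) (s : K.IsSquare a b c d)
      (q : K.graph.Walk c y) :
      Homotopic K (p.append (.cons s.ab (.cons s.bc q))) (p.append (.cons s.ad (.cons s.dc q)))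

/-- Nonempty, connected, and with trivial (edge path) fundamental group. -/
structure IsSimplyConnected (K : CubeData.{u}) : Prop where
  connected : K.graph.Connected
  null_homotopic : ∀ (x : K.V) (p : K.graph.Walk x x), K.Homotopic p .nil

/-- The simplices of the link of the vertex `v` (including the empty one): each cube at `v` gives
the set of its edges at `v`, and such an edge is recorded by its other endpoint. -/
def link (K : CubeData.{u}) (v : K.V) : Set (Set K.V) :=
  {A | ∃ C ∈ K.cubes, v ∈ C ∧ A = {w | w ∈ C ∧ K.graph.Adj v w}}

/-- CAT(0) cube complexes: simply connected cube complexes in which the link of every vertex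
is a flag complex (a finite set of pairwise adjacent vertices of the link spans a simplex). -/
structure IsCAT0 (K : CubeData.{u}) : Prop where
  isCubeComplex : K.IsCubeComplex
  isSimplyConnected : K.IsSimplyConnected
  flag : ∀ (v : K.V) (A : Set K.V), A.Finite →
    (∀ a ∈ A, ∀ b ∈ A, {a, b} ∈ K.link v) → A ∈ K.link v

/-- An isomorphism of cube complexes. -/
structure CubeIso (K L : CubeData.{u}) where
  toEquiv : K.V ≃ L.V
  mem_cubes_iff : ∀ S : Set K.V, toEquiv '' S ∈ L.cubes ↔ S ∈ K.cubes

/-- Convex cubical embeddings: isomorphisms onto a convex subcomplex. Here a convex subcomplex of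
a CAT(0) cube complex is a subcomplex containing every cube all of whose vertices it contains, and
every vertex on a combinatorial geodesic between two of its vertices. -/
structure IsConvexEmbedding (K L : CubeData.{u}) (f : K.V → L.V) : Prop where
  injective : Function.Injective f
  mem_cubes_iff : ∀ S : Set K.V, f '' S ∈ L.cubes ↔ S ∈ K.cubes
  convex : ∀ (x y : K.V) (z : L.V),
    L.graph.dist (f x) z + L.graph.dist z (f y) = L.graph.dist (f x) (f y) → z ∈ Set.range f

theorem IsConvexEmbedding.adj_iff {K L : CubeData.{u}} {f : K.V → L.V}
    (hf : IsConvexEmbedding K L f) (x y : K.V) :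
    L.graph.Adj (f x) (f y) ↔ K.graph.Adj x y := by
  change (f x ≠ f y ∧ _) ↔ (x ≠ y ∧ _)
  rw [← Set.image_pair, hf.mem_cubes_iff, hf.injective.ne_iff]

theorem IsConvexEmbedding.dist_eq {K L : CubeData.{u}} {f : K.V → L.V}
    (hf : IsConvexEmbedding K L f) (hK : K.graph.Connected) (hL : L.graph.Connected) (x y : K.V) :
    L.graph.dist (f x) (f y) = K.graph.dist x y := by
  apply le_antisymm
  · obtain ⟨p, hp⟩ := hK.exists_walk_length_eq_dist x y
    let F : K.graph →g L.graph := ⟨f, fun {a b} h => (hf.adj_iff a b).2 h⟩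
    have h := SimpleGraph.dist_le (p.map F)
    rw [SimpleGraph.Walk.length_map, hp] at h
    exact h
  · suffices h : ∀ (n : ℕ) (x : K.V), L.graph.dist (f x) (f y) = n → K.graph.dist x y ≤ n from
      h _ x rfl
    intro n
    induction n with
    | zero =>
      intro x h
      have := hf.injective (hL.dist_eq_zero_iff.1 h)
      simp [this]
    | succ n ih =>
      intro x h
      obtain ⟨p, hp⟩ := hL.exists_walk_length_eq_dist (f x) (f y)
      rw [h] at hp
      generalize hy : f y = y' at *
      cases p with
      | nil => simp at hp
      | @cons _ z _ hadj p =>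
        subst hy
        have h1 : L.graph.dist (f x) z ≤ 1 := by
          simpa using SimpleGraph.dist_le hadj.toWalk
        have h2 : L.graph.dist z (f y) ≤ n := by
          have := SimpleGraph.dist_le p
          simp at hp
          omega
        have h3 := hL.dist_triangle (u := f x) (v := z) (w := f y)
        obtain ⟨x', rfl⟩ := hf.convex x y z (by omega)
        have h4 := ih x' (by omega)
        have h5 : K.graph.dist x x' ≤ 1 := by
          simpa using SimpleGraph.dist_le ((hf.adj_iff x x').1 hadj).toWalk
        have h6 := hK.dist_triangle (u := x) (v := x') (w := y)
        omega

theorem IsConvexEmbedding.id (K : CubeData.{u}) : IsConvexEmbedding K K (fun x => x) :=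
  ⟨fun _ _ h => h, fun S => by simp, fun _ _ z _ => ⟨z, rfl⟩⟩

theorem IsConvexEmbedding.comp {K L M : CubeData.{u}} {g : L.V → M.V} {f : K.V → L.V}
    (hg : IsConvexEmbedding L M g) (hf : IsConvexEmbedding K L f)
    (hL : L.graph.Connected) (hM : M.graph.Connected) :
    IsConvexEmbedding K M (fun x => g (f x)) := by
  refine ⟨hg.injective.comp hf.injective, fun S => ?_, fun x y z h => ?_⟩
  · rw [← hf.mem_cubes_iff, ← hg.mem_cubes_iff, Set.image_image]
  · obtain ⟨w, rfl⟩ := hg.convex _ _ _ h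
    rw [hg.dist_eq hL hM, hg.dist_eq hL hM, hg.dist_eq hL hM] at h
    obtain ⟨v, rfl⟩ := hf.convex _ _ _ h
    exact ⟨v, rfl⟩

/-- The face poset: all (nonempty) cubes, ordered by inclusion. As a preorder it is a category. -/
abbrev Face (K : CubeData.{u}) : Type u := {C : Set K.V // C ∈ K.cubes}

/-- Two edges are opposite sides of a 2-cube. -/
def Opposite (K : CubeData.{u}) (e e' : Sym2 K.V) : Prop :=
  ∃ a b c d, K.IsSquare a b c d ∧ e = s(a, b) ∧ e' = s(d, c)

/-- The edges parallel to `e`, that is, the edges dual to the same hyperplane. -/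
def parallelClass (K : CubeData.{u}) (e : Sym2 K.V) : Set (Sym2 K.V) :=
  {e' | Relation.EqvGen K.Opposite e e'}

/-- The walls in the 0-skeleton corresponding to the hyperplanes. A wall is recorded by its set of
halfspaces. The halfspaces of the hyperplane dual to `e` are the vertex sets of the connected
components of the complement of this hyperplane, and vertices are in the same component if and
only if they are joined by an edge path that does not cross the hyperplane. -/
def walls (K : CubeData.{u}) : Set (Set (Set K.V)) :=
  {W | ∃ e ∈ K.graph.edgeSet, W = {U | ∃ c :
    (K.graph.deleteEdges (K.parallelClass e)).ConnectedComponent, U = c.supp}}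

end CubeData

/-- An orientation of a collection `𝒲` of walls of `X`: a choice of a halfspace for each wall. -/
def IsOrientation {X : Type u} (𝒲 : Set (Set (Set X))) (s : 𝒲 → Set X) : Prop :=
  ∀ W : 𝒲, s W ∈ W.1

/-- The 0-cubes of the wallspace `(X, 𝒲)`. -/
structure IsZeroCube {X : Type u} (𝒲 : Set (Set (Set X))) (s : 𝒲 → Set X) : Prop where
  isOrientation : IsOrientation 𝒲 s
  inter_nonempty : ∀ W W' : 𝒲, (s W ∩ s W').Nonempty
  finite : ∀ x : X, {W : 𝒲 | x ∉ s W}.Finite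

/-- The cube complex dual to the wallspace `(X, 𝒲)`. Its vertices are the 0-cubes. Its cubes are
given by a 0-cube and a finite set `F` of walls such that the walls in `F` can be re-oriented
arbitrarily; so an edge joins two 0-cubes that differ on exactly one wall, and a cube is present
as soon as its 1-skeleton is. -/
def dualComplex {X : Type u} (𝒲 : Set (Set (Set X))) : CubeData.{u} where
  V := {s : 𝒲 → Set X // IsZeroCube 𝒲 s}
  cubes := {S | ∃ (s : {s : 𝒲 → Set X // IsZeroCube 𝒲 s}) (F : Set 𝒲), F.Finite ∧
    (∀ t : 𝒲 → Set X, IsOrientation 𝒲 t → (∀ W, W ∉ F → t W = s.1 W) → IsZeroCube 𝒲 t) ∧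
    S = {t | ∀ W, W ∉ F → t.1 W = s.1 W}}

/-- The objects of the category of nonempty CAT(0) cube complexes (nonemptiness is part of simple
connectedness). -/
structure CCC : Type (u + 1) where
  toCubeData : CubeData.{u}
  isCAT0 : toCubeData.IsCAT0

namespace CCC

/-- The morphisms of the category of nonempty CAT(0) cube complexes: convex cubical embeddings. -/
@[ext]
structure Hom (X Y : CCC.{u}) : Type u where
  toFun : X.toCubeData.V → Y.toCubeData.V
  isConvexEmbedding : CubeData.IsConvexEmbedding X.toCubeData Y.toCubeData toFun

instance : Category.{u} CCC.{u} where
  Hom := Hom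
  id X := ⟨fun x => x, CubeData.IsConvexEmbedding.id _⟩
  comp {_ Y Z} f g := ⟨fun x => g.toFun (f.toFun x),
    g.isConvexEmbedding.comp f.isConvexEmbedding Y.isCAT0.isSimplyConnected.connected
      Z.isCAT0.isSimplyConnected.connected⟩

/-- The face poset of a CAT(0) cube complex. -/
abbrev Face (Z : CCC.{u}) : Type u := Z.toCubeData.Face

/-- A vertex, as a face. -/
def vertexFace (Z : CCC.{u}) (v : Z.toCubeData.V) : Z.Face :=
  ⟨{v}, Z.isCAT0.isCubeComplex.singleton_mem v⟩

theorem vertexFace_le {Z : CCC.{u}} {v : Z.toCubeData.V} {C : Z.Face} (h : v ∈ C.1) :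
    Z.vertexFace v ≤ C :=
  Set.singleton_subset_iff.2 h

/-- The vertex set of the image of `Ψ(C) → Ψ(v)`, for a vertex `v` of the cube `C`. -/
def imageAt {Z : CCC.{u}} (Ψ : Z.Faceᵒᵖ ⥤ CCC.{u}) {v : Z.toCubeData.V} {C : Z.Face}
    (h : v ∈ C.1) : Set (Ψ.obj (.op (Z.vertexFace v))).toCubeData.V :=
  Set.range (Hom.toFun (Ψ.map (homOfLE (vertexFace_le h)).op))

/-- A contravariant functor on the face poset is 1-determined if, for every cube `C` and every
vertex `v` of `C`, the image of `Ψ(C) → Ψ(v)` is the intersection of the images of `Ψ(e) → Ψ(v)`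
over the edges `e` of `C` containing `v`. (These images are convex subcomplexes, so they are
determined by their vertex sets.) -/
def OneDetermined {Z : CCC.{u}} (Ψ : Z.Faceᵒᵖ ⥤ CCC.{u}) : Prop :=
  ∀ (C : Z.Face) (v : Z.toCubeData.V) (hv : v ∈ C.1),
    imageAt Ψ hv = ⋂ (e : Z.Face) (_ : e.1.ncard = 2) (_ : e ≤ C) (hve : v ∈ e.1), imageAt Ψ hve

end CCC

/-- Cubical maps. Such a map is determined by its effect on vertices. On each cube it is, in suitable
coordinates, a coordinate projection of the standard `n`-cube to a standard `m`-cube, followed by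
an isomorphism onto a cube of the target. -/
structure CubicalMap (Y Z : CCC.{u}) where
  toFun : Y.toCubeData.V → Z.toCubeData.V
  cubical : ∀ C ∈ Y.toCubeData.cubes, ∃ (n m : ℕ) (e : (Fin n → Bool) → Y.toCubeData.V)
    (e' : (Fin m → Bool) → Z.toCubeData.V) (i : Fin m → Fin n), Function.Injective i ∧
    Y.toCubeData.IsChart e C ∧ Z.toCubeData.IsChart e' (toFun '' C) ∧
    ∀ x, toFun (e x) = e' (fun j => x (i j))

namespace CubicalMap

variable {Y Z : CCC.{u}}

/-- `q : Y → Z` is a restriction quotient: for some set `𝒦` of walls of `Y` there is an isomorphism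
`φ` of `Z` with the complex dual to the wallspace `(Y⁰, 𝒦)` such that `φ ∘ q` sends each vertex `y` to
the restriction to `𝒦` of the 0-cube defined by `y`, that is, to the 0-cube that chooses
for each wall in `𝒦` the halfspace containing `y`. -/
def IsRestrictionQuotient (q : CubicalMap Y Z) : Prop :=
  ∃ 𝒦 : Set (Set (Set Y.toCubeData.V)), 𝒦 ⊆ Y.toCubeData.walls ∧
    ∃ φ : CubeData.CubeIso Z.toCubeData (dualComplex 𝒦),
      ∀ (y : Y.toCubeData.V) (W : 𝒦), y ∈ (φ.toEquiv (q.toFun y)).1 W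

/-- The fiber `q⁻¹(y)` over an interior point `y` of the cube `C` of `Z`, with its induced structure of
a cube complex. Each cube `D` of `Y` with `q(D) = C` meets `q⁻¹(y)` in a cube of
dimension `dim D - dim C`, and all cubes of `q⁻¹(y)` arise in this way. So the vertices correspond to
the cubes of `Y` that `q` maps isomorphically onto `C`, and the vertices of the cube given
by `D` are those that correspond to faces of `D`. -/
def fiber (q : CubicalMap Y Z) (C : Z.Face) : CubeData.{u} where
  V := {D : Y.Face // Set.BijOn q.toFun D.1 C.1}
  cubes := {S | ∃ D : Y.Face, q.toFun '' D.1 = C.1 ∧ S = {E | E.1 ≤ D}}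

theorem inter_preimage_mem (q : CubicalMap Y Z) {C C' : Z.Face} (h : C ≤ C')
    {D : Set Y.toCubeData.V} (hD : D ∈ Y.toCubeData.cubes) (hDC : q.toFun '' D = C'.1) :
    D ∩ q.toFun ⁻¹' C.1 ∈ Y.toCubeData.cubes := by
  classical
  obtain ⟨n, m, e, e', i, hi, he, he', hq⟩ := q.cubical D hD
  rw [hDC] at he'
  obtain ⟨p, hp⟩ := (he'.mem_cubes_iff C.1 h).1 C.2
  refine (he.mem_cubes_iff _ Set.inter_subset_left).2
    ⟨fun k => if hk : ∃ j, i j = k then p hk.choose else none, ?_⟩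
  have key : ∀ x : Fin n → Bool, q.toFun (e x) ∈ C.1 ↔
      x ∈ subcube (fun k => if hk : ∃ j, i j = k then p hk.choose else none) := by
    intro x
    rw [hq, hp, he'.injective.mem_set_image]
    constructor
    · intro hx k b hb
      by_cases hk : ∃ j, i j = k
      · simp only [dif_pos hk] at hb
        have := hx _ _ hb
        simpa [hk.choose_spec] using this
      · simp [dif_neg hk] at hb
    · intro hx j b hb
      have hk : ∃ j', i j' = i j := ⟨j, rfl⟩
      refine hx (i j) b ?_
      simp only [dif_pos hk]
      rw [hi hk.choose_spec, hb]
  ext y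
  constructor
  · rintro ⟨hy, hyC⟩
    rw [← he.range_eq] at hy
    obtain ⟨x, rfl⟩ := hy
    exact ⟨x, (key x).1 hyC, rfl⟩
  · rintro ⟨x, hx, rfl⟩
    exact ⟨he.range_eq ▸ Set.mem_range_self x, (key x).2 hx⟩

/-- For cubes `C ⊆ C'` of `Z`, the canonical map from the fiber over `C'` to the fiber over `C`: a cube
mapped isomorphically onto `C'` is sent to its face that lies over `C`. -/
def fiberMap (q : CubicalMap Y Z) {C C' : Z.Face} (h : C ≤ C') (D : (q.fiber C').V) :
    (q.fiber C).V :=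
  ⟨⟨D.1.1 ∩ q.toFun ⁻¹' C.1, q.inter_preimage_mem h D.1.2 D.2.image_eq⟩,
    fun _ hx => hx.2, D.2.injOn.mono Set.inter_subset_left, fun z hz => by
      obtain ⟨x, hx, rfl⟩ := D.2.surjOn (h hz)
      exact ⟨x, ⟨hx, hz⟩, rfl⟩⟩

/-- The fibers are nonempty CAT(0) cube complexes, and the canonical maps between them are convex
cubical embeddings. -/
structure FibersInCCC (q : CubicalMap Y Z) : Prop where
  isCAT0 : ∀ C : Z.Face, (q.fiber C).IsCAT0
  isConvexEmbedding : ∀ {C C' : Z.Face} (h : C ≤ C'),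
    CubeData.IsConvexEmbedding (q.fiber C') (q.fiber C) (q.fiberMap h)

/-- The fiber functor. -/
def fiberFunctor (q : CubicalMap Y Z) (hq : q.FibersInCCC) : Z.Faceᵒᵖ ⥤ CCC.{u} where
  obj C := ⟨q.fiber C.unop, hq.isCAT0 C.unop⟩
  map f := ⟨q.fiberMap (leOfHom f.unop), hq.isConvexEmbedding (leOfHom f.unop)⟩
  map_id C := by
    refine CCC.Hom.ext (funext fun D => Subtype.ext (Subtype.ext ?_))
    exact Set.inter_eq_left.2 fun x hx => D.2.mapsTo hx
  map_comp {C C' C''} f g := by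
    refine CCC.Hom.ext (funext fun D => Subtype.ext (Subtype.ext ?_))
    change _ = (D.1.1 ∩ q.toFun ⁻¹' C'.unop.1) ∩ q.toFun ⁻¹' C''.unop.1
    rw [Set.inter_assoc, ← Set.preimage_inter, Set.inter_eq_right.2 (leOfHom g.unop)]
    rfl

end CubicalMap

/-! Everything is reduced to halfspaces. A cubical map is a restriction quotient exactly when it is
surjective on vertices and preimages of halfspaces are halfspaces
(`IsRestrictionQuotient.pullsBackWalls`, `PullsBackWalls.isRestrictionQuotient`). In one direction
this uses the Helly property and the fact that distance in a dual complex counts separating walls;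
in the other, 𝒦 is the set of all pulled back walls.

The geometry behind this has to be extracted from simple connectedness and flag links. Flagness
gives the cube condition, which makes pushing paths across squares confluent. Classes of reduced
paths then form a local system, and a global section of it shows that any two geodesics with the
same ends differ by pushes. Hence the 1-skeleton is bipartite and satisfies the quadrangle condition
(`IsCAT0.isModular`). From there follow medians, convexity of halfspaces, the description of walls
as complementary pairs (`walls_eq`) and the Helly property. Conversely, these metric conditions
imply that every group valued cocycle has a potential, hence simple connectedness; therefore convex
subcomplexes are again CAT(0) (`IsConvexEmbedding.isCAT0`).

Part 2: for a vertex v of a cube C, a cube mapped isomorphically onto C is determined by its vertex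
over v. This identifies the fiber over C with the set `crossing C v` of vertices over v at which
every edge of C at v lifts. That set is convex and nonempty, and flagness fills in its cubes, so the
fiber is CAT(0) and the fiber maps are convex embeddings. Its definition is a condition on one edge
at a time, which is 1-determination.

Part 1: the total space is glued from the products C × Ψ(C). A cocycle on it is first trivialized
along the fibers, then descends to Z, where it has a potential; so the total space is simply
connected. 1-determination is what makes its links flag (`OneDetermined.total_flag`): vertical and
horizontal edges that pairwise span squares come from a single Ψ(C). Edges over parallel edges of Z
have the same wall, so the projection pulls halfspaces back to halfspaces
(`OneDetermined.half_subset`). The cubes mapped isomorphically onto C are the products of C with one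
vertex of Ψ(C), so the fiber functor is Ψ. -/

/-- Change the `i`-th coordinate of a vertex of the standard cube. -/
def flipAt {n : ℕ} (i : Fin n) (x : Fin n → Bool) : Fin n → Bool :=
  Function.update x i (!x i)

/-! ### Induction over the vertices of the standard cube. -/

section FlipAt

variable {n : ℕ}

@[simp] theorem flipAt_same (i : Fin n) (x : Fin n → Bool) : flipAt i x i = !x i := by
  simp [flipAt]

theorem flipAt_of_ne {i j : Fin n} (h : j ≠ i) (x : Fin n → Bool) : flipAt i x j = x j := by
  simp [flipAt, h]

@[simp] theorem flipAt_flipAt (i : Fin n) (x : Fin n → Bool) : flipAt i (flipAt i x) = x := by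
  simp [flipAt]

theorem flipAt_ne (i : Fin n) (x : Fin n → Bool) : flipAt i x ≠ x := by
  intro h
  have := congrFun h i
  simp at this

theorem flipAt_comm (i j : Fin n) (x : Fin n → Bool) :
    flipAt i (flipAt j x) = flipAt j (flipAt i x) := by
  by_cases h : i = j
  · rw [h]
  · rw [flipAt, flipAt_of_ne h, flipAt, flipAt, flipAt, Function.update_comm h,
      Function.update_of_ne (Ne.symm h)]

theorem flipAt_left_injective (x : Fin n → Bool) : Function.Injective (flipAt · x) := by
  intro i j h
  by_contra hij
  have := congrFun h i
  simp [flipAt_of_ne hij] at this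

theorem flipAt_flipAt_ne {i j : Fin n} (h : i ≠ j) (x : Fin n → Bool) :
    flipAt i (flipAt j x) ≠ x := by
  intro he
  have := congrFun he i
  simp [flipAt_of_ne h] at this

theorem bool_cube_step (P : (Fin n → Bool) → Prop) (x₀ : Fin n → Bool) (h0 : P x₀)
    (h : ∀ x i, P x → P (flipAt i x)) (x : Fin n → Bool) : P x := by
  suffices H : ∀ (k : ℕ) (x : Fin n → Bool), (Finset.univ.filter fun i => x i ≠ x₀ i).card = k →
      P x from H _ x rfl
  intro k
  induction k with
  | zero =>
    intro x hx
    have : x = x₀ := by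
      funext i
      simpa using Finset.filter_eq_empty_iff.1 (Finset.card_eq_zero.1 hx) (Finset.mem_univ i)
    rwa [this]
  | succ k ih =>
    intro x hx
    obtain ⟨i, hi⟩ := Finset.card_pos.1 (by omega : 0 < (Finset.univ.filter fun i => x i ≠ x₀ i).card)
    have hi' : x i ≠ x₀ i := by simpa using hi
    rw [← flipAt_flipAt i x]
    apply h
    apply ih
    have : (Finset.univ.filter fun j => flipAt i x j ≠ x₀ j) =
        (Finset.univ.filter fun j => x j ≠ x₀ j).erase i := by
      ext j
      by_cases hj : j = i
      · subst hj
        have : (!x j) = x₀ j := by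
          revert hi'
          cases x j <;> cases x₀ j <;> simp
        simp [this]
      · simp [flipAt_of_ne hj, hj]
    rw [this, Finset.card_erase_of_mem hi]
    omega

/-- The invariant that moves from a vertex to its neighbours is that `P` holds at the vertex and at
all its neighbours: two flips in different directions complete a square. -/
theorem bool_cube_induction (P : (Fin n → Bool) → Prop) (x₀ : Fin n → Bool) (h0 : P x₀)
    (h1 : ∀ i, P (flipAt i x₀))
    (h : ∀ x i j, i ≠ j → P x → P (flipAt i x) → P (flipAt j x) → P (flipAt i (flipAt j x)))
    (x : Fin n → Bool) : P x := by
  have key : ∀ x, P x ∧ ∀ i, P (flipAt i x) := by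
    refine bool_cube_step _ x₀ ⟨h0, h1⟩ fun x i hx => ⟨hx.2 i, fun j => ?_⟩
    by_cases hij : j = i
    · subst hij
      simpa using hx.1
    · exact h x j i hij hx.1 (hx.2 j) (hx.2 i)
  exact (key x).1

end FlipAt

/-! ### Charts, squares and the flag condition. -/

namespace CubeData

variable {K : CubeData.{u}}

section Chart

variable {n : ℕ} {e : (Fin n → Bool) → K.V} {C : Set K.V}

theorem IsChart.mem (he : K.IsChart e C) (x : Fin n → Bool) : e x ∈ C :=
  he.range_eq ▸ Set.mem_range_self x

theorem IsChart.exists_eq (he : K.IsChart e C) {v : K.V} (hv : v ∈ C) : ∃ x, e x = v := by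
  rwa [← he.range_eq] at hv

theorem IsChart.mem_cubes (he : K.IsChart e C) : C ∈ K.cubes :=
  (he.mem_cubes_iff C le_rfl).2 ⟨fun _ => none, by
    rw [← he.range_eq, ← Set.image_univ]
    congr 1
    ext x
    simp [subcube]⟩

theorem IsChart.adj_iff (he : K.IsChart e C) {x y : Fin n → Bool} :
    K.graph.Adj (e x) (e y) ↔ ∃ i, y = flipAt i x := by
  constructor
  · rintro ⟨hne, hmem⟩
    have hxy : x ≠ y := fun h => hne (by rw [h])
    obtain ⟨p, hp⟩ := (he.mem_cubes_iff _ (by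
      rintro v (rfl | rfl)
      exacts [he.mem x, he.mem y])).1 hmem
    have hx : x ∈ subcube p := by
      have : e x ∈ e '' subcube p := hp ▸ Set.mem_insert _ _
      rwa [he.injective.mem_set_image] at this
    have hy : y ∈ subcube p := by
      have : e y ∈ e '' subcube p := hp ▸ Set.mem_insert_of_mem _ rfl
      rwa [he.injective.mem_set_image] at this
    obtain ⟨i, hi⟩ := Function.ne_iff.1 hxy
    have hpi : ∀ b, p i ≠ some b := fun b hb => hi ((hx i b hb).trans (hy i b hb).symm)
    have hf : flipAt i x ∈ subcube p := by
      intro j b hb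
      have hj : j ≠ i := by
        rintro rfl
        exact hpi b hb
      rw [flipAt_of_ne hj]
      exact hx j b hb
    have : e (flipAt i x) ∈ ({e x, e y} : Set K.V) := by
      rw [hp]
      exact ⟨_, hf, rfl⟩
    rcases this with h | h
    · exact absurd (he.injective h) (flipAt_ne i x)
    · exact ⟨i, (he.injective h).symm⟩
  · rintro ⟨i, rfl⟩
    refine ⟨fun h => flipAt_ne i x (he.injective h).symm, ?_⟩
    refine (he.mem_cubes_iff _ ?_).2 ⟨fun k => if k = i then none else some (x k), ?_⟩
    · rintro v (rfl | rfl)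
      exacts [he.mem _, he.mem _]
    · rw [← Set.image_pair]
      congr 1
      ext y
      constructor
      · rintro (rfl | rfl) k b hb
        · by_cases hk : k = i <;> simp_all
        · by_cases hk : k = i
          · simp [hk] at hb
          · rw [flipAt_of_ne hk]
            simpa [hk] using hb
      · intro hy
        have hy' : ∀ k, k ≠ i → y k = x k := fun k hk => hy k (x k) (by simp [hk])
        by_cases hi : y i = x i
        · left
          funext k
          by_cases hk : k = i
          · rw [hk, hi]
          · exact hy' k hk
        · right
          funext k
          by_cases hk : k = i
          · subst hk
            rw [flipAt_same]
            revert hi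
            cases x k <;> cases y k <;> simp
          · rw [flipAt_of_ne hk, hy' k hk]

theorem IsChart.adj_flipAt (he : K.IsChart e C) (x : Fin n → Bool) (i : Fin n) :
    K.graph.Adj (e x) (e (flipAt i x)) :=
  he.adj_iff.2 ⟨i, rfl⟩

theorem IsChart.isSquare (he : K.IsChart e C) (x : Fin n → Bool) {i j : Fin n} (h : i ≠ j) :
    K.IsSquare (e x) (e (flipAt i x)) (e (flipAt i (flipAt j x))) (e (flipAt j x)) where
  mem := by
    refine (he.mem_cubes_iff _ ?_).2 ⟨fun k => if k = i ∨ k = j then none else some (x k), ?_⟩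
    · rintro v (rfl | rfl | rfl | rfl) <;> exact he.mem _
    · have : ({e x, e (flipAt i x), e (flipAt i (flipAt j x)), e (flipAt j x)} : Set K.V) =
          e '' {x, flipAt i x, flipAt i (flipAt j x), flipAt j x} := by
        simp [Set.image_insert_eq]
      rw [this]
      congr 1
      ext y
      constructor
      · rintro (rfl | rfl | rfl | rfl) k b hb <;> by_cases hk : k = i <;> by_cases hk' : k = j <;>
          simp_all [flipAt_of_ne]
      · intro hy
        have hy' : ∀ k, k ≠ i → k ≠ j → y k = x k := fun k hk hk' => hy k (x k) (by simp [hk, hk'])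
        have aux : ∀ z : Fin n → Bool, y i = z i → y j = z j →
            (∀ k, k ≠ i → k ≠ j → z k = x k) → y = z := by
          intro z h1 h2 h3
          funext k
          by_cases hk : k = i
          · rw [hk, h1]
          · by_cases hk' : k = j
            · rw [hk', h2]
            · rw [hy' k hk hk', h3 k hk hk']
        have hb : ∀ a b : Bool, a = b ∨ a = !b := by decide
        rcases hb (y i) (x i) with h1 | h1 <;> rcases hb (y j) (x j) with h2 | h2
        · exact .inl (aux _ h1 h2 fun _ _ _ => rfl)
        · exact .inr (.inr (.inr (aux _ (by rw [flipAt_of_ne h, h1]) (by simpa using h2)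
            fun k _ hk => flipAt_of_ne hk _)))
        · exact .inr (.inl (aux _ (by simpa using h1) (by rw [flipAt_of_ne h.symm, h2])
            fun k hk _ => flipAt_of_ne hk _))
        · refine .inr (.inr (.inl (aux _ ?_ ?_ ?_)))
          · rw [flipAt_same, flipAt_of_ne h, h1]
          · rw [flipAt_of_ne h.symm, flipAt_same, h2]
          · intro k hk hk'
            rw [flipAt_of_ne hk, flipAt_of_ne hk']
  ab := he.adj_flipAt _ _
  bc := by
    rw [flipAt_comm]
    exact he.adj_flipAt _ _
  ad := he.adj_flipAt _ _
  dc := he.adj_flipAt _ _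
  ac_ne := fun hh => flipAt_flipAt_ne h x (he.injective hh).symm
  bd_ne := fun hh => h (flipAt_left_injective x (he.injective hh))

theorem IsChart.ncard (he : K.IsChart e C) : C.ncard = 2 ^ n := by
  rw [← he.range_eq, ← Set.image_univ, Set.ncard_image_of_injective _ he.injective, Set.ncard_univ]
  simp

theorem IsChart.finite (he : K.IsChart e C) : C.Finite := by
  rw [← he.range_eq]
  exact Set.finite_range e

/-- A face containing a vertex and all its neighbours is everything. -/
theorem IsChart.eq_of_neighbors (he : K.IsChart e C) {S : Set K.V} (hS : S ∈ K.cubes) (hSC : S ⊆ C)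
    {x : Fin n → Bool} (hx : e x ∈ S) (h : ∀ i, e (flipAt i x) ∈ S) : S = C := by
  obtain ⟨p, rfl⟩ := (he.mem_cubes_iff S hSC).1 hS
  rw [he.injective.mem_set_image] at hx
  have hp : ∀ i b, p i ≠ some b := by
    intro i b hb
    have h1 := h i
    rw [he.injective.mem_set_image] at h1
    have h2 := h1 i b hb
    rw [flipAt_same, hx i b hb] at h2
    cases b <;> simp at h2
  rw [← he.range_eq, ← Set.image_univ]
  congr 1
  ext y
  simp [subcube, hp]

end Chart

/-- The neighbours of `v` in `C`. -/
def nbrs (K : CubeData.{u}) (C : Set K.V) (v : K.V) : Set K.V := {w | w ∈ C ∧ K.graph.Adj v w}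

theorem IsChart.nbrs_eq {n : ℕ} {e : (Fin n → Bool) → K.V} {C : Set K.V} (he : K.IsChart e C)
    (x : Fin n → Bool) : K.nbrs C (e x) = Set.range fun i => e (flipAt i x) := by
  ext w
  constructor
  · rintro ⟨hw, hadj⟩
    obtain ⟨y, rfl⟩ := he.exists_eq hw
    obtain ⟨i, rfl⟩ := he.adj_iff.1 hadj
    exact ⟨i, rfl⟩
  · rintro ⟨i, rfl⟩
    exact ⟨he.mem _, he.adj_flipAt _ _⟩

namespace IsCubeComplex

theorem nonempty (hK : K.IsCubeComplex) {C : Set K.V} (hC : C ∈ K.cubes) : C.Nonempty := by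
  obtain ⟨n, e, he⟩ := hK.exists_chart C hC
  exact ⟨_, he.mem fun _ => false⟩

theorem finite (hK : K.IsCubeComplex) {C : Set K.V} (hC : C ∈ K.cubes) : C.Finite := by
  obtain ⟨n, e, he⟩ := hK.exists_chart C hC
  exact he.finite

theorem exists_chart_at (hK : K.IsCubeComplex) {C : Set K.V} (hC : C ∈ K.cubes) {v : K.V}
    (hv : v ∈ C) :
    ∃ (n : ℕ) (e : (Fin n → Bool) → K.V) (x : Fin n → Bool), K.IsChart e C ∧ e x = v := by
  obtain ⟨n, e, he⟩ := hK.exists_chart C hC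
  obtain ⟨x, hx⟩ := he.exists_eq hv
  exact ⟨n, e, x, he, hx⟩

/-- The intersection `C ∩ D` is a face of `C` that contains `v` with all its neighbours, so it is
`C`. Cubes at a vertex are thereby compared through their edges at this vertex. -/
theorem subset_of_nbrs_subset (hK : K.IsCubeComplex) {C D : Set K.V} (hC : C ∈ K.cubes)
    (hD : D ∈ K.cubes) {v : K.V}
    (hvC : v ∈ C) (hvD : v ∈ D) (h : K.nbrs C v ⊆ D) : C ⊆ D := by
  obtain ⟨n, e, x, he, rfl⟩ := hK.exists_chart_at hC hvC
  have := he.eq_of_neighbors (hK.inter_mem C hC D hD ⟨_, hvC, hvD⟩) Set.inter_subset_left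
    (x := x) ⟨hvC, hvD⟩ fun i => ⟨he.mem _, h ⟨he.mem _, he.adj_flipAt _ _⟩⟩
  exact Set.inter_eq_left.1 this

theorem eq_of_nbrs_eq (hK : K.IsCubeComplex) {C D : Set K.V} (hC : C ∈ K.cubes) (hD : D ∈ K.cubes)
    {v : K.V}
    (hvC : v ∈ C) (hvD : v ∈ D) (h : K.nbrs C v = K.nbrs D v) : C = D :=
  (hK.subset_of_nbrs_subset hC hD hvC hvD fun _ hw => (h ▸ hw : _ ∈ K.nbrs D v).1).antisymm
    (hK.subset_of_nbrs_subset hD hC hvD hvC fun _ hw => (h.symm ▸ hw : _ ∈ K.nbrs C v).1)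

theorem ncard_eq_two_pow (hK : K.IsCubeComplex) {C : Set K.V} (hC : C ∈ K.cubes) :
    ∃ n, C.ncard = 2 ^ n := by
  obtain ⟨n, e, he⟩ := hK.exists_chart C hC
  exact ⟨n, he.ncard⟩

end IsCubeComplex

namespace IsSquare

variable {a b c d : K.V}

theorem symm (s : K.IsSquare a b c d) : K.IsSquare a d c b where
  mem := by
    have : ({a, d, c, b} : Set K.V) = {a, b, c, d} := by
      ext; simp only [Set.mem_insert_iff, Set.mem_singleton_iff]; tauto
    rw [this]; exact s.mem
  ab := s.ad
  bc := s.dc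
  ad := s.ab
  dc := s.bc
  ac_ne := s.ac_ne
  bd_ne := s.bd_ne.symm

theorem rotate (s : K.IsSquare a b c d) : K.IsSquare b c d a where
  mem := by
    have : ({b, c, d, a} : Set K.V) = {a, b, c, d} := by
      ext; simp only [Set.mem_insert_iff, Set.mem_singleton_iff]; tauto
    rw [this]; exact s.mem
  ab := s.bc
  bc := s.dc.symm
  ad := s.ab.symm
  dc := s.ad
  ac_ne := s.bd_ne
  bd_ne := s.ac_ne.symm

theorem ncard (s : K.IsSquare a b c d) : ({a, b, c, d} : Set K.V).ncard = 4 := by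
  have h1 := s.ab.ne
  have h2 := s.bc.ne
  have h3 := s.ad.ne
  have h4 := s.dc.ne
  have h5 := s.ac_ne
  have h6 := s.bd_ne
  rw [Set.ncard_insert_of_notMem, Set.ncard_insert_of_notMem, Set.ncard_pair h4.symm]
  · simp [h2, h6]
  · simp [h1, h5, h3]

/-- Two different squares on the path `a, b, c` would meet in three vertices, but the number of
vertices of a cube is a power of two. -/
theorem unique (hK : K.IsCubeComplex) {d' : K.V} (s : K.IsSquare a b c d)
    (s' : K.IsSquare a b c d') :
    d = d' := by
  by_contra hne
  have h := hK.inter_mem _ s.mem _ s'.mem ⟨a, by simp, by simp⟩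
  have : ({a, b, c, d} ∩ {a, b, c, d'} : Set K.V) = {a, b, c} := by
    ext v
    simp only [Set.mem_inter_iff, Set.mem_insert_iff, Set.mem_singleton_iff]
    constructor
    · rintro ⟨h1 | h1 | h1 | h1, h2 | h2 | h2 | h2⟩ <;> simp_all
    · tauto
  rw [this] at h
  obtain ⟨n, hn⟩ := hK.ncard_eq_two_pow h
  rw [Set.ncard_insert_of_notMem (by simp [s.ab.ne, s.ac_ne]), Set.ncard_pair s.bc.ne] at hn
  rcases n with _ | _ | n
  · simp at hn
  · simp at hn
  · rw [pow_succ] at hn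
    omega

/-- The vertex opposite to `a` is determined by the two neighbours of `a`. -/
theorem unique' (hK : K.IsCubeComplex) {c' : K.V} (s : K.IsSquare a b c d)
    (s' : K.IsSquare a b c' d) : c = c' :=
  s.rotate.rotate.rotate.unique hK s'.rotate.rotate.rotate

theorem exists_chart (hK : K.IsCubeComplex) (s : K.IsSquare a b c d) :
    ∃ e : (Fin 2 → Bool) → K.V, K.IsChart e {a, b, c, d} := by
  obtain ⟨n, e, he⟩ := hK.exists_chart _ s.mem
  have h := he.ncard
  rw [s.ncard] at h
  have : n = 2 := Nat.pow_right_injective le_rfl (by simpa using h.symm)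
  subst this
  exact ⟨e, he⟩

theorem nbrs_eq (hK : K.IsCubeComplex) (s : K.IsSquare a b c d) :
    K.nbrs {a, b, c, d} a = {b, d} := by
  obtain ⟨e, he⟩ := s.exists_chart hK
  obtain ⟨x, hx⟩ := he.exists_eq (v := a) (by simp)
  have hN := he.nbrs_eq x
  rw [hx] at hN
  symm
  apply Set.eq_of_subset_of_ncard_le
  · rintro v (rfl | rfl)
    · exact ⟨by simp, s.ab⟩
    · exact ⟨by simp, s.ad⟩
  · rw [hN, Set.ncard_pair s.bd_ne, ← Set.image_univ]
    refine (Set.ncard_image_le (Set.toFinite _)).trans ?_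
    simp [Set.ncard_univ]
  · rw [hN]
    exact Set.finite_range _

theorem mem_link (hK : K.IsCubeComplex) (s : K.IsSquare a b c d) : {b, d} ∈ K.link a :=
  ⟨_, s.mem, by simp, (s.nbrs_eq hK).symm⟩

end IsSquare

theorem nbrs_pair {v w : K.V} (h : K.graph.Adj v w) : K.nbrs {v, w} v = {w} := by
  ext u
  constructor
  · rintro ⟨rfl | rfl, h'⟩
    · exact absurd rfl h'.ne
    · rfl
  · rintro rfl
    exact ⟨by simp, h⟩

theorem singleton_mem_link {v w : K.V} (h : K.graph.Adj v w) : {w} ∈ K.link v :=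
  ⟨_, h.2, by simp, (nbrs_pair h).symm⟩

/-- Flagness with adjacency in the link expressed by squares; the diagonal pairs that the flag
condition also mentions are supplied by the edges. -/
theorem IsCAT0.exists_cube (hK : K.IsCAT0) {v : K.V} {A : Set K.V} (hA : A.Finite)
    (hadj : ∀ a ∈ A, K.graph.Adj v a)
    (hsq : ∀ a ∈ A, ∀ b ∈ A, a ≠ b → ∃ t, K.IsSquare v a t b) :
    ∃ D ∈ K.cubes, v ∈ D ∧ K.nbrs D v = A := by
  obtain ⟨D, hD, hv, h⟩ := hK.flag v A hA fun a ha b hb => by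
    by_cases hab : a = b
    · subst hab
      rw [Set.pair_eq_singleton]
      exact singleton_mem_link (hadj a ha)
    · obtain ⟨t, s⟩ := hsq a ha b hb hab
      exact s.mem_link hK.isCubeComplex
  exact ⟨D, hD, hv, h.symm⟩

theorem IsCubeComplex.exists_isSquare (hK : K.IsCubeComplex) {C : Set K.V} (hC : C ∈ K.cubes)
    {v a b : K.V} (hv : v ∈ C) (ha : a ∈ K.nbrs C v) (hb : b ∈ K.nbrs C v) (hab : a ≠ b) :
    ∃ t ∈ C, K.IsSquare v a t b := by
  obtain ⟨n, e, x, he, rfl⟩ := hK.exists_chart_at hC hv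
  rw [he.nbrs_eq] at ha hb
  obtain ⟨i, rfl⟩ := ha
  obtain ⟨j, rfl⟩ := hb
  have hij : i ≠ j := by
    rintro rfl
    exact hab rfl
  exact ⟨_, he.mem _, he.isSquare x hij⟩

theorem IsCubeComplex.isSquare_closed (hK : K.IsCubeComplex) {C : Set K.V} (hC : C ∈ K.cubes)
    {a b c d : K.V} (s : K.IsSquare a b c d) (ha : a ∈ C) (hb : b ∈ C) (hd : d ∈ C) : c ∈ C := by
  obtain ⟨t, ht, s'⟩ := hK.exists_isSquare hC ha ⟨hb, s.ab⟩ ⟨hd, s.ad⟩ s.bd_ne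
  rwa [s.unique' hK s']

theorem IsCubeComplex.cube_induction (hK : K.IsCubeComplex) {C : Set K.V} (hC : C ∈ K.cubes)
    {v : K.V} (hv : v ∈ C) (P : K.V → Prop) (h0 : P v) (h1 : ∀ w ∈ K.nbrs C v, P w)
    (h2 : ∀ a b c d, K.IsSquare a b c d → P a → P b → P d → P c) : ∀ w ∈ C, P w := by
  intro w hw
  obtain ⟨n, e, x, he, rfl⟩ := hK.exists_chart_at hC hv
  obtain ⟨y, rfl⟩ := he.exists_eq hw
  refine bool_cube_induction (fun y => P (e y)) x h0 (fun i => h1 _ ?_) ?_ y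
  · rw [he.nbrs_eq]
    exact ⟨i, rfl⟩
  · intro z i j hij p1 p2 p3
    exact h2 _ _ _ _ (he.isSquare z hij) p1 p2 p3

/-- The cube condition: three squares that pairwise share an edge at `v` are faces of a 3-cube. -/
theorem IsCAT0.exists_three_cube (hK : K.IsCAT0) {v a b c x y z : K.V} (s₁ : K.IsSquare v a x b)
    (s₂ : K.IsSquare v b y c) (s₃ : K.IsSquare v a z c) :
    ∃ t, K.IsSquare a x t z ∧ K.IsSquare b x t y ∧ K.IsSquare c y t z := by
  have hc := hK.isCubeComplex
  have hA : ({a, b, c} : Set K.V).Finite := Set.toFinite _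
  obtain ⟨D, hD, hv, hN⟩ := hK.exists_cube (v := v) hA
    (by rintro w (rfl | rfl | rfl); exacts [s₁.ab, s₁.ad, s₂.ad])
    (by
      rintro p (rfl | rfl | rfl) q (rfl | rfl | rfl) hpq <;>
        first
          | exact absurd rfl hpq
          | exact ⟨_, s₁⟩
          | exact ⟨_, s₂⟩
          | exact ⟨_, s₃⟩
          | exact ⟨_, s₁.symm⟩
          | exact ⟨_, s₂.symm⟩
          | exact ⟨_, s₃.symm⟩)
  obtain ⟨n, e, o, he, rfl⟩ := hc.exists_chart_at hD hv
  rw [he.nbrs_eq] at hN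
  obtain ⟨i, hi⟩ : a ∈ Set.range _ := hN ▸ (by simp : a ∈ ({a, b, c} : Set K.V))
  obtain ⟨j, hj⟩ : b ∈ Set.range _ := hN ▸ (by simp : b ∈ ({a, b, c} : Set K.V))
  obtain ⟨k, hk⟩ : c ∈ Set.range _ := hN ▸ (by simp : c ∈ ({a, b, c} : Set K.V))
  simp only at hi hj hk
  subst hi hj hk
  have hij : i ≠ j := by rintro rfl; exact s₁.bd_ne rfl
  have hjk : j ≠ k := by rintro rfl; exact s₂.bd_ne rfl
  have hik : i ≠ k := by rintro rfl; exact s₃.bd_ne rfl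
  -- A square is determined by its two edges at a vertex, so the given squares are faces of the cube
  -- `D`.
  obtain rfl := s₁.unique' hc (he.isSquare o hij)
  obtain rfl := s₂.unique' hc (he.isSquare o hjk)
  obtain rfl := s₃.unique' hc (he.isSquare o hik)
  refine ⟨e (flipAt i (flipAt j (flipAt k o))), ?_, ?_, ?_⟩
  · have := he.isSquare (flipAt i o) hjk
    rw [flipAt_comm j i, flipAt_comm k i, flipAt_comm j i] at this
    exact this
  · have := he.isSquare (flipAt j o) hik
    rw [flipAt_comm k j] at this
    exact this
  · have := (he.isSquare (flipAt k o) hij).symm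
    exact this

end CubeData

/-! ### Local systems, cocycles and simple connectedness. -/

namespace CubeData

variable {K : CubeData.{u}}

/-- A local system of sets on a cube complex. -/
structure LocalSystem (K : CubeData.{u}) (F : K.V → Type*) where
  τ : ∀ {a b : K.V}, K.graph.Adj a b → F a → F b
  inv : ∀ {a b : K.V} (h : K.graph.Adj a b) (f : F a), τ h.symm (τ h f) = f
  square : ∀ {a b c d : K.V} (s : K.IsSquare a b c d) (f : F a),
    τ s.bc (τ s.ab f) = τ s.dc (τ s.ad f)

namespace LocalSystem

variable {F : K.V → Type*} (T : K.LocalSystem F)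

/-- Parallel transport along a walk. -/
def transport : ∀ {x y : K.V}, K.graph.Walk x y → F x → F y
  | _, _, .nil, f => f
  | _, _, .cons h p, f => transport p (T.τ h f)

theorem transport_append {x y z : K.V} (p : K.graph.Walk x y) (q : K.graph.Walk y z) (f : F x) :
    T.transport (p.append q) f = T.transport q (T.transport p f) := by
  induction p with
  | nil => rfl
  | cons h p ih => exact ih q _

theorem transport_reverse {x y : K.V} (p : K.graph.Walk x y) (f : F x) :
    T.transport p.reverse (T.transport p f) = f := by
  induction p with
  | nil => rfl
  | cons h p ih =>
    rw [SimpleGraph.Walk.reverse_cons, transport_append]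
    change T.τ h.symm (T.transport p.reverse (T.transport p (T.τ h f))) = f
    rw [ih, T.inv]

theorem transport_eq_of_homotopic {x y : K.V} {p q : K.graph.Walk x y} (h : K.Homotopic p q)
    (f : F x) : T.transport p f = T.transport q f := by
  induction h with
  | refl p => rfl
  | symm _ ih => exact ih.symm
  | trans _ _ ih1 ih2 => exact ih1.trans ih2
  | backtrack p h q =>
    rw [transport_append, transport_append]
    simp only [transport]
    rw [T.inv]
  | square p s q =>
    rw [transport_append, transport_append]
    simp only [transport]
    rw [T.square s]

theorem transport_eq (hK : K.IsSimplyConnected) {x y : K.V} (p q : K.graph.Walk x y) (f : F x) :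
    T.transport p f = T.transport q f := by
  have h := T.transport_eq_of_homotopic (hK.null_homotopic x (p.append q.reverse)) f
  rw [transport_append] at h
  have h2 := T.transport_reverse q.reverse (T.transport p f)
  rw [SimpleGraph.Walk.reverse_reverse, h] at h2
  exact h2.symm

/-- On a simply connected complex every element of a fibre extends to a global section. -/
theorem exists_section (hK : K.IsSimplyConnected) (x : K.V) (f : F x) :
    ∃ s : ∀ y, F y, s x = f ∧ ∀ {a b : K.V} (h : K.graph.Adj a b), T.τ h (s a) = s b := by
  choose p _ using fun y => hK.connected.exists_walk_length_eq_dist x y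
  refine ⟨fun y => T.transport (p y) f, T.transport_eq hK (p x) .nil f, fun {a b} h => ?_⟩
  have := T.transport_eq hK ((p a).append (.cons h .nil)) (p b) f
  rwa [transport_append] at this

end LocalSystem

/-- A group valued 1-cocycle on a cube complex. -/
structure IsCocycle (K : CubeData.{u}) {G : Type*} [Group G] (g : K.V → K.V → G) : Prop where
  inv : ∀ {a b : K.V}, K.graph.Adj a b → g b a * g a b = 1
  square : ∀ {a b c d : K.V}, K.IsSquare a b c d → g b c * g a b = g d c * g a d

/-- `c` is a potential of the cocycle `g`. -/
def IsPotential (K : CubeData.{u}) {G : Type*} [Group G] (g : K.V → K.V → G) (c : K.V → G) : Prop :=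
  ∀ {a b : K.V}, K.graph.Adj a b → g a b = c b * (c a)⁻¹

/-- Left multiplication by `g` makes `G` a local system, and a global section of it is a potential.
-/
theorem IsSimplyConnected.exists_potential (hK : K.IsSimplyConnected) {G : Type*} [Group G]
    {g : K.V → K.V → G} (hg : K.IsCocycle g) : ∃ c, K.IsPotential g c := by
  let T : K.LocalSystem (fun _ => G) :=
    { τ := fun {a b} _ f => g a b * f
      inv := fun h f => by rw [← mul_assoc, hg.inv h, one_mul]
      square := fun s f => by rw [← mul_assoc, hg.square s, mul_assoc] }
  obtain ⟨x⟩ := hK.connected.nonempty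
  obtain ⟨s, -, hs⟩ := T.exists_section hK x 1
  exact ⟨s, fun h => eq_mul_inv_of_mul_eq (hs h)⟩

theorem Homotopic.append_right {x y z : K.V} {p q : K.graph.Walk x y} (h : K.Homotopic p q)
    (r : K.graph.Walk y z) : K.Homotopic (p.append r) (q.append r) := by
  induction h with
  | refl p => exact .refl _
  | symm _ ih => exact ih.symm
  | trans _ _ ih1 ih2 => exact ih1.trans ih2
  | backtrack p h q =>
    simp only [← SimpleGraph.Walk.append_assoc, SimpleGraph.Walk.cons_append]
    exact .backtrack p h _
  | square p s q =>
    simp only [← SimpleGraph.Walk.append_assoc, SimpleGraph.Walk.cons_append]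
    exact .square p s _

/-- Homotopy of walks as a setoid. -/
def homotopySetoid (K : CubeData.{u}) (x y : K.V) : Setoid (K.graph.Walk x y) where
  r := K.Homotopic
  iseqv := ⟨.refl, .symm, .trans⟩

/-- Homotopy classes of walks. -/
abbrev HomotopyClass (K : CubeData.{u}) (x y : K.V) : Type u := Quotient (K.homotopySetoid x y)

/-- Append an edge to a homotopy class of walks. -/
def HomotopyClass.step {x a b : K.V} (h : K.graph.Adj a b) (p : K.HomotopyClass x a) :
    K.HomotopyClass x b :=
  Quotient.map (sa := K.homotopySetoid x a) (sb := K.homotopySetoid x b)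
    (fun p => p.append (.cons h .nil)) (fun _ _ hpq => Homotopic.append_right hpq _) p

theorem HomotopyClass.step_step {x a b : K.V} (h : K.graph.Adj a b) (p : K.HomotopyClass x a) :
    (p.step h).step h.symm = p := by
  induction p using Quotient.inductionOn with | _ p =>
  refine Quotient.sound (s := K.homotopySetoid x a) ?_
  change K.Homotopic ((p.append _).append _) p
  rw [← SimpleGraph.Walk.append_assoc, SimpleGraph.Walk.cons_append, SimpleGraph.Walk.nil_append]
  have := Homotopic.backtrack p h .nil
  rwa [SimpleGraph.Walk.append_nil] at this

theorem HomotopyClass.step_square {x a b c d : K.V} (s : K.IsSquare a b c d)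
    (p : K.HomotopyClass x a) : (p.step s.ab).step s.bc = (p.step s.ad).step s.dc := by
  induction p using Quotient.inductionOn with | _ p =>
  refine Quotient.sound (s := K.homotopySetoid x c) ?_
  change K.Homotopic _ _
  simp only [← SimpleGraph.Walk.append_assoc, SimpleGraph.Walk.cons_append,
    SimpleGraph.Walk.nil_append]
  exact .square p s .nil

/-- Appending an edge is a bijection on homotopy classes. -/
def HomotopyClass.stepEquiv (x : K.V) {a b : K.V} (h : K.graph.Adj a b) :
    K.HomotopyClass x a ≃ K.HomotopyClass x b where
  toFun := step h
  invFun := step h.symm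
  left_inv := step_step h
  right_inv := step_step h.symm

/-- A connected complex on which all group valued cocycles have a potential is simply connected. -/
theorem isSimplyConnected_of_potential (hc : K.graph.Connected)
    (h : ∀ (G : Type u) [Group G] (g : K.V → K.V → G), K.IsCocycle g → ∃ c, K.IsPotential g c) :
    K.IsSimplyConnected := by
  classical
  have hθ : ∀ x v w, K.graph.Walk v w →
      Nonempty (K.HomotopyClass x v ≃ K.HomotopyClass x w) := by
    intro x v w p
    induction p with
    | nil => exact ⟨Equiv.refl _⟩
    | cons hadj p ih =>
      obtain ⟨θ⟩ := ih
      exact ⟨(HomotopyClass.stepEquiv _ hadj).trans θ⟩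
  refine ⟨hc, fun x p => ?_⟩
  have hθ' : ∀ v, Nonempty (K.HomotopyClass x v ≃ K.HomotopyClass x x) := by
    intro v
    obtain ⟨q⟩ := hc.preconnected v x
    exact hθ x v x q
  have θ := fun v => Classical.choice (hθ' v)
  -- The universal cover is encoded as a cocycle: after arbitrary identifications of the fibers with
  -- the fiber over `x`, appending an edge becomes a permutation of one fixed set.
  let g : K.V → K.V → Equiv.Perm (K.HomotopyClass x x) := fun a b =>
    if hab : K.graph.Adj a b then (θ a).symm.trans ((HomotopyClass.stepEquiv x hab).trans (θ b))
    else 1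
  have hg : ∀ {a b : K.V} (hab : K.graph.Adj a b) (f), g a b f = θ b (((θ a).symm f).step hab) := by
    intro a b hab f
    simp only [g, dif_pos hab]
    rfl
  obtain ⟨c, hpot⟩ := h _ g
    ⟨fun {a b} hab => by
      ext1 f
      rw [Equiv.Perm.mul_apply, hg hab, hg hab.symm, Equiv.symm_apply_apply,
        HomotopyClass.step_step, Equiv.apply_symm_apply, Equiv.Perm.one_apply],
    fun {a b c d} s => by
      ext1 f
      rw [Equiv.Perm.mul_apply, Equiv.Perm.mul_apply, hg s.ab, hg s.bc, hg s.ad, hg s.dc,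
        Equiv.symm_apply_apply, Equiv.symm_apply_apply, HomotopyClass.step_square s]⟩
  -- The potential gives a section through the class of the constant path. Appending walks stays on
  -- this section, so every loop at `x` has the class of the constant path.
  let S : ∀ v, K.HomotopyClass x v := fun v =>
    (θ v).symm (c v ((c x)⁻¹ (θ x (Quotient.mk (K.homotopySetoid x x) .nil))))
  have hS : ∀ {a b : K.V} (hab : K.graph.Adj a b), (S a).step hab = S b := by
    intro a b hab
    have h1 := hg hab (θ a (S a))
    rw [hpot hab, Equiv.symm_apply_apply] at h1
    rw [← (θ b).symm_apply_apply ((S a).step hab), ← h1]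
    simp [S]
  have key : ∀ {a b : K.V} (p : K.graph.Walk a b) (q : K.graph.Walk x a),
      Quotient.mk (K.homotopySetoid x a) q = S a →
      Quotient.mk (K.homotopySetoid x b) (q.append p) = S b := by
    intro a b p
    induction p with
    | nil =>
      intro q hq
      rwa [SimpleGraph.Walk.append_nil]
    | cons hadj p ih =>
      intro q hq
      have := ih (q.append (.cons hadj .nil)) (by rw [← hS hadj, ← hq]; rfl)
      rwa [← SimpleGraph.Walk.append_assoc, SimpleGraph.Walk.cons_append,
        SimpleGraph.Walk.nil_append] at this
  have h0 : Quotient.mk (K.homotopySetoid x x) .nil = S x := by simp [S]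
  exact Quotient.exact (s := K.homotopySetoid x x) ((key p .nil h0).trans h0.symm)

end CubeData

/-! ### Reduced edge paths and the quadrangle condition. -/

namespace CubeData

variable {K : CubeData.{u}}

/-- Edge paths starting at `x`, extended at their end. -/
inductive EdgePath (K : CubeData.{u}) (x : K.V) : K.V → Type u
  | nil : EdgePath K x x
  | snoc {z y : K.V} (p : EdgePath K x z) (h : K.graph.Adj z y) : EdgePath K x y

namespace EdgePath

variable {x : K.V}

/-- The length of an edge path. -/
def length : ∀ {y : K.V}, K.EdgePath x y → ℕ
  | _, .nil => 0
  | _, .snoc p _ => p.length + 1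

/-- The equivalence relation generated by pushing a path across squares. -/
inductive Push : ∀ {y : K.V}, K.EdgePath x y → K.EdgePath x y → Prop
  | refl {y : K.V} (p : K.EdgePath x y) : Push p p
  | symm {y : K.V} {p q : K.EdgePath x y} : Push p q → Push q p
  | trans {y : K.V} {p q r : K.EdgePath x y} : Push p q → Push q r → Push p r
  | snoc {z y : K.V} {p q : K.EdgePath x z} (h : K.graph.Adj z y) :
      Push p q → Push (p.snoc h) (q.snoc h)
  | square {a b c d : K.V} (p : K.EdgePath x a) (s : K.IsSquare a b c d) :
      Push ((p.snoc s.ab).snoc s.bc) ((p.snoc s.ad).snoc s.dc)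

theorem Push.length_eq {y : K.V} {p q : K.EdgePath x y} (h : Push p q) : p.length = q.length := by
  induction h with
  | refl => rfl
  | symm _ ih => exact ih.symm
  | trans _ _ ih1 ih2 => exact ih1.trans ih2
  | snoc _ _ ih => simp [length, ih]
  | square => rfl

/-- The form that `Push` takes when one looks at the last edges. -/
inductive LastEdge : ∀ {y : K.V}, K.EdgePath x y → K.EdgePath x y → Prop
  | nil : LastEdge .nil .nil
  | same {z y : K.V} {q q' : K.EdgePath x z} (h : K.graph.Adj z y) (hq : Push q q') :
      LastEdge (q.snoc h) (q'.snoc h)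
  | square {w z y z' : K.V} (s : K.IsSquare w z y z') {q : K.EdgePath x z} {q' : K.EdgePath x z'}
      (r : K.EdgePath x w) (hq : Push q (r.snoc s.ab)) (hq' : Push q' (r.snoc s.ad)) :
      LastEdge (q.snoc s.bc) (q'.snoc s.dc)

theorem LastEdge.refl {y : K.V} (p : K.EdgePath x y) : LastEdge p p := by
  cases p with
  | nil => exact .nil
  | snoc p h => exact .same h (.refl p)

theorem LastEdge.symm {y : K.V} {p q : K.EdgePath x y} (h : LastEdge p q) : LastEdge q p := by
  cases h with
  | nil => exact .nil
  | same h hq => exact .same h hq.symm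
  | square s r hq hq' => exact .square s.symm r hq' hq

/-- Only a square followed by a square needs an argument. The shorter paths to the last but one
vertex `z'` of the middle path are equivalent, so by induction their last edges agree or span a
square. If they agree, the two given squares share three vertices and coincide; otherwise three
squares meet at `z'` and the cube condition applies. -/
theorem LastEdge.trans (hK : K.IsCubeComplex)
    (h3 : ∀ {v a b c x y z : K.V}, K.IsSquare v a x b → K.IsSquare v b y c → K.IsSquare v a z c →
      ∃ t, K.IsSquare a x t z ∧ K.IsSquare b x t y ∧ K.IsSquare c y t z)
    {n : ℕ} (ih : ∀ {y : K.V} {p q : K.EdgePath x y}, p.length ≤ n → Push p q → LastEdge p q)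
    {y : K.V} {p q r : K.EdgePath x y} (hn : q.length ≤ n + 1) (h1 : LastEdge p q)
    (h2 : LastEdge q r) : LastEdge p r := by
  cases h1 with
  | nil => exact h2
  | same h hq =>
    cases h2 with
    | same _ hq' => exact .same h (hq.trans hq')
    | square s r hr hr' => exact .square s r (hq.trans hr) hr'
  | @square w z y z' s p q t hp hq =>
    cases h2 with
    | same _ hq' => exact .square s t hp (hq'.symm.trans hq)
    | @square w' _ _ z'' s' _ q' t' hq1 hq2 =>
      have hL : LastEdge (t.snoc s.ad) (t'.snoc s'.ab) := by
        refine ih ?_ (hq.symm.trans hq1)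
        rw [← hq.length_eq]
        simp only [length] at hn
        omega
      generalize s.ad = h1, s'.ab = h2 at hL
      cases hL with
      | same _ ht =>
        obtain rfl := s.symm.unique hK s'
        exact .same _ (hp.trans ((ht.snoc _).trans hq2.symm))
      | square s'' m hm hm' =>
        -- The corner `u` of the 3-cube opposite to `z'` is the bottom of a square joining the last
        -- edges of the outer paths; both paths are pushed through `u` along faces of this cube.
        obtain ⟨u, s1, s2, s3⟩ := h3 s.rotate.rotate.rotate s'.rotate s''.rotate.rotate.symm
        refine .square s2.rotate.rotate.symm (m.snoc s1.rotate.rotate.rotate.ad) ?_ ?_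
        · exact hp.trans ((hm.snoc s.ab).trans (.square m s1.rotate.rotate.rotate))
        · exact hq2.trans ((hm'.snoc s'.ad).trans (.square m s3.rotate.rotate.rotate))

/-- Cancellation for `Push`: the last edges of equivalent paths agree or span a square. -/
theorem Push.lastEdge (hK : K.IsCAT0) {y : K.V} {p q : K.EdgePath x y} (h : Push p q) :
    LastEdge p q := by
  suffices H : ∀ (n : ℕ) {y : K.V} {p q : K.EdgePath x y}, p.length ≤ n → Push p q →
      LastEdge p q from H _ le_rfl h
  have h3 := @IsCAT0.exists_three_cube _ hK
  intro n
  induction n with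
  | zero =>
    intro y p q hp hpq
    have hl := hpq.length_eq
    cases p with
    | nil =>
      generalize hq : q.length = m at hl
      cases q with
      | nil => exact .nil
      | snoc q h =>
        simp only [length] at hq hl
        omega
    | snoc p h => simp [length] at hp
  | succ n ih =>
    intro y p q hp hpq
    induction hpq with
    | refl p => exact .refl p
    | symm hpq ih' => exact (ih' (by rw [hpq.length_eq]; exact hp)).symm
    | trans h1 h2 ih1 ih2 =>
      have := h1.length_eq ▸ hp
      exact LastEdge.trans hK.isCubeComplex h3 ih this (ih1 hp) (ih2 this)
    | snoc h hpq _ => exact .same h hpq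
    | square p s => exact .square s p (.refl _) (.refl _)

/-- `CanShorten p z`: the path `p` is equivalent to a path whose last edge comes from `z`. -/
def CanShorten {y : K.V} (p : K.EdgePath x y) (z : K.V) : Prop :=
  ∃ (h : K.graph.Adj z y) (q : K.EdgePath x z), Push p (q.snoc h)

theorem CanShorten.congr {y z : K.V} {p p' : K.EdgePath x y} (h : CanShorten p z)
    (hp : Push p p') : CanShorten p' z := by
  obtain ⟨h, q, hq⟩ := h
  exact ⟨h, q, hp.symm.trans hq⟩

/-- Paths that are not equivalent to a path with a backtrack. -/
def Reduced : ∀ {y : K.V}, K.EdgePath x y → Prop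
  | _, .nil => True
  | y, .snoc p _ => p.Reduced ∧ ¬ p.CanShorten y

/-- Pushing also changes the initial segments, on which reducedness is defined. By `Push.lastEdge`
only an exchange of the last two edges across a square matters, and a backtrack on one side of the
square is pushed across it to a backtrack on the other side. -/
theorem Reduced.congr (hK : K.IsCAT0) {y : K.V} {p p' : K.EdgePath x y} (hp : p.Reduced)
    (h : Push p p') : p'.Reduced := by
  suffices H : ∀ (n : ℕ) {y : K.V} {p p' : K.EdgePath x y}, p.length ≤ n → p.Reduced → Push p p' →
      p'.Reduced from H _ le_rfl hp h
  clear hp h p p' y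
  intro n
  induction n with
  | zero =>
    intro y p p' hn hp h
    cases h.lastEdge hK with
    | nil => exact hp
    | same h hq => simp [length] at hn
    | square s r hq hq' => simp [length] at hn
  | succ n ih =>
    intro y p p' hn hp h
    cases h.lastEdge hK with
    | nil => exact hp
    | same h hq =>
      simp only [length] at hn
      exact ⟨ih (by omega) hp.1 hq, fun hc => hp.2 (hc.congr hq.symm)⟩
    | @square w z _ z' s q q' r hq hq' =>
      simp only [length] at hn
      have hr := ih (by omega) hp.1 hq
      have hr' : (r.snoc s.ad).Reduced := by
        refine ⟨hr.1, fun hc => hp.2 ?_⟩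
        obtain ⟨h1, t, ht⟩ := hc
        refine ⟨s.bc.symm, t.snoc s.dc, hq.trans ((ht.snoc s.ab).trans ?_)⟩
        exact .square t s.rotate.rotate.rotate
      have hn' : (r.snoc s.ad).length ≤ n := by
        have := hq.length_eq
        simp only [length] at this ⊢
        omega
      refine ⟨ih hn' hr' hq'.symm, fun hc => hr.2 ?_⟩
      obtain ⟨h1, t, ht⟩ := hc.congr hq'
      have hl := ht.lastEdge hK
      generalize s.ad = h2 at hl
      cases hl with
      | same _ _ => exact absurd rfl s.ac_ne
      | square s' m hm hm' =>
        obtain rfl := s'.rotate.rotate.unique' hK.isCubeComplex s.rotate.rotate.rotate.symm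
        exact ⟨_, m, hm⟩

/-- Classes of reduced paths. -/
def ReducedClass (x y : K.V) : Type u :=
  {S : Set (K.EdgePath x y) // ∃ p : K.EdgePath x y, p.Reduced ∧ S = {q | Push p q}}

/-- The class of a reduced path. -/
def Reduced.cls {y : K.V} {p : K.EdgePath x y} (hp : p.Reduced) : ReducedClass x y :=
  ⟨{q | Push p q}, p, hp, rfl⟩

theorem Reduced.cls_eq_iff {y : K.V} {p q : K.EdgePath x y} (hp : p.Reduced) (hq : q.Reduced) :
    hp.cls = hq.cls ↔ Push p q := by
  constructor
  · intro h
    have h' : {q | Push p q} = {r | Push q r} := congrArg Subtype.val h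
    have : q ∈ {q | Push p q} := h' ▸ Push.refl q
    exact this
  · intro h
    refine Subtype.ext (Set.ext fun r => ?_)
    exact ⟨fun hr => h.symm.trans hr, fun hr => h.trans hr⟩

theorem ReducedClass.exists_rep {y : K.V} (f : ReducedClass x y) :
    ∃ (p : K.EdgePath x y) (hp : p.Reduced), f = hp.cls := by
  obtain ⟨S, p, hp, rfl⟩ := f
  exact ⟨p, hp, rfl⟩

/-- If the path can be pushed so that it arrives at `a` from `b`, that last edge is deleted;
otherwise the edge to `b` is appended. Deletion is well defined by cancellation: two last edges
coming from the same vertex cannot span a square. -/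
theorem ReducedClass.exists_step (hK : K.IsCAT0) {a b : K.V} (h : K.graph.Adj a b)
    (f : ReducedClass x a) : ∃ f' : ReducedClass x b,
      (∀ (p : K.EdgePath x b) (hp : p.Reduced) (hp' : (p.snoc h.symm).Reduced),
        f = hp'.cls → f' = hp.cls) ∧
      (∀ (p : K.EdgePath x a) (hp : p.Reduced) (hp' : (p.snoc h).Reduced),
        f = hp.cls → f' = hp'.cls) := by
  obtain ⟨p, hp, rfl⟩ := f.exists_rep
  by_cases hs : p.CanShorten b
  · obtain ⟨h', q, hq⟩ := hs
    have hq1 := hp.congr hK hq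
    refine ⟨hq1.1.cls, fun r hr hr' he => ?_, fun r hr hr' he => ?_⟩
    · rw [Reduced.cls_eq_iff] at he ⊢
      have := (hq.symm.trans he).lastEdge hK
      generalize h.symm = h1 at this
      cases this with
      | same _ hqr => exact hqr
      | square s m _ _ => exact absurd rfl s.bd_ne
    · rw [Reduced.cls_eq_iff] at he
      exact absurd ⟨h', q, he.symm.trans hq⟩ hr'.2
  · have hp' : (p.snoc h).Reduced := ⟨hp, hs⟩
    refine ⟨hp'.cls, fun r hr hr' he => ?_, fun r hr hr' he => ?_⟩
    · rw [Reduced.cls_eq_iff] at he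
      exact absurd ⟨h.symm, r, he⟩ hs
    · rw [Reduced.cls_eq_iff] at he ⊢
      exact he.snoc h

/-- The local system of classes of reduced paths. -/
noncomputable def reducedSystem (hK : K.IsCAT0) (x : K.V) : K.LocalSystem (ReducedClass x) :=
  let τ : ∀ {a b : K.V}, K.graph.Adj a b → ReducedClass x a → ReducedClass x b :=
    fun h f => (ReducedClass.exists_step hK h f).choose
  have τ_shorten : ∀ {a b : K.V} (h : K.graph.Adj a b) {p : K.EdgePath x b}
      (hp' : (p.snoc h.symm).Reduced), τ h hp'.cls = hp'.1.cls := fun h _ hp' =>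
    (ReducedClass.exists_step hK h hp'.cls).choose_spec.1 _ hp'.1 hp' rfl
  have τ_snoc : ∀ {a b : K.V} (h : K.graph.Adj a b) {p : K.EdgePath x a}
      (hp' : (p.snoc h).Reduced), τ h hp'.1.cls = hp'.cls := fun h _ hp' =>
    (ReducedClass.exists_step hK h hp'.1.cls).choose_spec.2 _ hp'.1 hp' rfl
  -- The path arrives from `b` but cannot be made to arrive from `d`: one route around the square
  -- deletes and then appends, the other appends and then deletes, and they agree by a push across
  -- the square.
  have case1 : ∀ {a b c d : K.V} (s : K.IsSquare a b c d) {p : K.EdgePath x b}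
      (hp : (p.snoc s.ab.symm).Reduced), ¬ (p.snoc s.ab.symm).CanShorten d →
      τ s.bc (τ s.ab hp.cls) = τ s.dc (τ s.ad hp.cls) := by
    intro a b c d s p hp hd
    have h1 : (p.snoc s.bc).Reduced := by
      refine ⟨hp.1, fun ⟨h, t, ht⟩ => hd ⟨s.ad.symm, t.snoc s.dc.symm, ?_⟩⟩
      exact (ht.snoc _).trans (.square t s.rotate.rotate.symm)
    have h2 : ((p.snoc s.ab.symm).snoc s.ad).Reduced := ⟨hp, hd⟩
    have h3 : Push ((p.snoc s.ab.symm).snoc s.ad) ((p.snoc s.bc).snoc s.dc.symm) :=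
      .square p s.rotate.symm
    have h4 := h2.congr hK h3
    rw [τ_shorten s.ab hp, τ_snoc s.bc h1, τ_snoc s.ad h2, (h2.cls_eq_iff h4).2 h3,
      τ_shorten s.dc h4]
  { τ := τ
    inv := fun {a b} h f => by
      obtain ⟨p, hp, rfl⟩ := f.exists_rep
      by_cases hs : p.CanShorten b
      · obtain ⟨h', q, hq⟩ := hs
        have hq1 := hp.congr hK hq
        rw [(hp.cls_eq_iff hq1).2 hq, τ_shorten h hq1]
        exact τ_snoc h.symm hq1
      · have hp' : (p.snoc h).Reduced := ⟨hp, hs⟩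
        rw [τ_snoc h hp']
        exact τ_shorten h.symm hp'
    square := fun {a b c d} s f => by
      -- The cases are whether the path can arrive from `b` and whether it can arrive from `d`. If
      -- both, cancellation yields a square whose fourth corner must be `c`, and both routes delete
      -- two edges; if neither, both routes append two edges.
      obtain ⟨p, hp, rfl⟩ := f.exists_rep
      by_cases hb : p.CanShorten b
      · obtain ⟨h', q, hq⟩ := hb
        have hq1 := hp.congr hK hq
        by_cases hd : p.CanShorten d
        · obtain ⟨h'', q', hq'⟩ := hd
          have hq1' := hp.congr hK hq'
          have hl := (hq.symm.trans hq').lastEdge hK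
          have aux : ∀ {b d : K.V} (s : K.IsSquare a b c d) {q : K.EdgePath x b}
              {r : K.EdgePath x c} (hq1 : (q.snoc s.ab.symm).Reduced) (hr : r.Reduced),
              Push p (q.snoc s.ab.symm) → Push q (r.snoc s.bc.symm) →
              τ s.bc (τ s.ab hp.cls) = hr.cls := by
            intro b d s q r hq1 hr h1 h2
            have h3 := hq1.1.congr hK h2
            rw [(hp.cls_eq_iff hq1).2 h1, τ_shorten s.ab hq1, (hq1.1.cls_eq_iff h3).2 h2,
              τ_shorten s.bc h3]
          cases hl with
          | same _ _ => exact absurd rfl s.bd_ne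
          | square s' r hm hm' =>
            obtain rfl := s'.rotate.rotate.unique' hK.isCubeComplex s.symm
            have hr := (hq1.1.congr hK hm).1
            rw [aux s hq1 hr hq hm, aux s.symm hq1' hr hq' hm']
        · rw [(hp.cls_eq_iff hq1).2 hq]
          exact case1 s hq1 fun hc => hd (hc.congr hq.symm)
      · by_cases hd : p.CanShorten d
        · obtain ⟨h'', q', hq'⟩ := hd
          have hq1' := hp.congr hK hq'
          rw [(hp.cls_eq_iff hq1').2 hq']
          exact (case1 s.symm hq1' fun hc => hb (hc.congr hq'.symm)).symm
        · have h1 : (p.snoc s.ab).Reduced := ⟨hp, hb⟩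
          have h2 : (p.snoc s.ad).Reduced := ⟨hp, hd⟩
          have aux : ∀ {b d : K.V} (s : K.IsSquare a b c d), ¬ p.CanShorten d →
              ¬ (p.snoc s.ab).CanShorten c := by
            rintro b d s hd ⟨h, t, ht⟩
            have hl := ht.lastEdge hK
            generalize s.ab = h1 at hl
            cases hl with
            | same _ _ => exact s.ac_ne rfl
            | square s' m hm hm' =>
              obtain rfl := s'.rotate.rotate.unique' hK.isCubeComplex s.rotate
              exact hd ⟨_, m, hm⟩
          have h3 : ((p.snoc s.ab).snoc s.bc).Reduced := ⟨h1, aux s hd⟩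
          have h4 : ((p.snoc s.ad).snoc s.dc).Reduced := ⟨h2, aux s.symm hb⟩
          rw [τ_snoc s.ab h1, τ_snoc s.ad h2, τ_snoc s.bc h3, τ_snoc s.dc h4, h3.cls_eq_iff h4]
          exact .square p s }

/-- On a CAT(0) cube complex a reduced path is determined by its endpoints up to `Push`. -/
theorem Reduced.push (hK : K.IsCAT0) {y : K.V} {p q : K.EdgePath x y} (hp : p.Reduced)
    (hq : q.Reduced) : Push p q := by
  -- The only use of simple connectedness here: at the end of any reduced path, the section through
  -- the empty path takes the class of that path.
  obtain ⟨s, hs, hs'⟩ := (reducedSystem hK x).exists_section hK.isSimplyConnected x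
    (Reduced.cls (p := .nil) trivial)
  have key : ∀ {y : K.V} {p : K.EdgePath x y} (hp : p.Reduced), s y = hp.cls := by
    intro y p hp
    induction p with
    | nil => exact hs
    | snoc p h ih =>
      rw [← hs' h, ih hp.1]
      exact (ReducedClass.exists_step hK h hp.1.cls).choose_spec.2 _ hp.1 hp rfl
  exact (hp.cls_eq_iff hq).1 ((key hp).symm.trans (key hq))

/-- The walk along an edge path. -/
def toWalk : ∀ {y : K.V}, K.EdgePath x y → K.graph.Walk x y
  | _, .nil => .nil
  | _, .snoc p h => p.toWalk.concat h

theorem length_toWalk {y : K.V} (p : K.EdgePath x y) : p.toWalk.length = p.length := by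
  induction p with
  | nil => rfl
  | snoc p h ih => simp [toWalk, length, ih]

theorem dist_le {y : K.V} (p : K.EdgePath x y) : K.graph.dist x y ≤ p.length :=
  p.length_toWalk ▸ SimpleGraph.dist_le _

theorem exists_length_eq_dist (hc : K.graph.Connected) (x y : K.V) :
    ∃ p : K.EdgePath x y, p.length = K.graph.dist x y := by
  have key : ∀ {a b : K.V} (w : K.graph.Walk a b) (q : K.EdgePath x a),
      ∃ p : K.EdgePath x b, p.length = q.length + w.length := by
    intro a b w
    induction w with
    | nil => exact fun q => ⟨q, rfl⟩
    | cons h w ih =>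
      intro q
      obtain ⟨p, hp⟩ := ih (q.snoc h)
      exact ⟨p, by rw [hp, SimpleGraph.Walk.length_cons, length]; omega⟩
  obtain ⟨w, hw⟩ := hc.exists_walk_length_eq_dist x y
  obtain ⟨p, hp⟩ := key w .nil
  exact ⟨p, by rw [hp, hw]; simp [length]⟩

/-- Pushes preserve length, so removing a backtrack would give a path shorter than the distance. -/
theorem reduced_of_length_le {y : K.V} (p : K.EdgePath x y) (hp : p.length ≤ K.graph.dist x y) :
    p.Reduced := by
  induction p with
  | nil => trivial
  | @snoc z y p h ih =>
    simp only [length] at hp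
    have h1 : K.graph.dist x y ≤ K.graph.dist x z + 1 := by
      by_cases hz : K.graph.Reachable x z
      · obtain ⟨w, hw⟩ := hz.exists_walk_length_eq_dist
        have := SimpleGraph.dist_le (w.concat h)
        simpa [hw] using this
      · exact absurd ⟨p.toWalk⟩ hz
    refine ⟨ih (by omega), fun ⟨h', q, hq⟩ => ?_⟩
    have h2 := hq.length_eq
    simp only [length] at h2
    have := q.dist_le
    omega

end EdgePath
/-- The metric properties of the 1-skeleton of a CAT(0) cube complex from which everything else is
derived: it is connected and bipartite and satisfies the quadrangle condition. -/
structure IsModular (K : CubeData.{u}) : Prop where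
  connected : K.graph.Connected
  dist_ne : ∀ (x : K.V) {a b : K.V}, K.graph.Adj a b → K.graph.dist x a ≠ K.graph.dist x b
  quadrangle : ∀ (x : K.V) {y z z' : K.V}, K.graph.Adj z y → K.graph.Adj z' y → z ≠ z' →
    K.graph.dist x y = K.graph.dist x z + 1 → K.graph.dist x y = K.graph.dist x z' + 1 →
    ∃ w, K.IsSquare w z y z' ∧ K.graph.dist x z = K.graph.dist x w + 1

theorem dist_adj_le (hc : K.graph.Connected) (x : K.V) {a b : K.V} (h : K.graph.Adj a b) :
    K.graph.dist x b ≤ K.graph.dist x a + 1 := by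
  have h1 := hc.dist_triangle (u := x) (v := a) (w := b)
  have h2 : K.graph.dist a b = 1 := SimpleGraph.dist_eq_one_iff_adj.2 h
  omega

/-- Swapping two colours along every edge is a local system, because squares have even length. A
section is a 2-colouring of the graph, which fixes the parity of walk lengths. -/
theorem IsSimplyConnected.dist_ne (hK : K.IsSimplyConnected) (x : K.V) {a b : K.V}
    (h : K.graph.Adj a b) : K.graph.dist x a ≠ K.graph.dist x b := by
  let T : K.LocalSystem (fun _ => Bool) :=
    { τ := fun _ f => !f
      inv := fun _ f => by simp
      square := fun _ f => rfl }
  obtain ⟨s, -, hs⟩ := T.exists_section hK x true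
  have hs' : ∀ {a b : K.V}, K.graph.Adj a b → s b = !s a := fun h => (hs h).symm
  have key : ∀ {a b : K.V} (p : K.graph.Walk a b), s b = (s a ^^ decide (p.length % 2 = 1)) := by
    intro a b p
    induction p with
    | nil => simp
    | cons h p ih =>
      rw [ih, hs' h, SimpleGraph.Walk.length_cons]
      rcases Nat.mod_two_eq_zero_or_one p.length with h2 | h2
      · rw [show (p.length + 1) % 2 = 1 by omega, h2]
        simp
      · rw [show (p.length + 1) % 2 = 0 by omega, h2]
        simp
  intro he
  obtain ⟨p, hp⟩ := hK.connected.exists_walk_length_eq_dist x a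
  obtain ⟨q, hq⟩ := hK.connected.exists_walk_length_eq_dist x b
  have h1 := key p
  have h2 := key q
  rw [hq, ← he, ← hp, ← h1, hs' h] at h2
  cases h3 : s a <;> simp [h3] at h2

/-- For the quadrangle condition, geodesics to `z` and `z'` prolonged to `y` are both reduced, hence
equivalent, and their different last edges must span a square. -/
theorem IsCAT0.isModular (hK : K.IsCAT0) : K.IsModular where
  connected := hK.isSimplyConnected.connected
  dist_ne := hK.isSimplyConnected.dist_ne
  quadrangle := by
    intro x y z z' hz hz' hne h1 h2
    have hc := hK.isSimplyConnected.connected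
    obtain ⟨p, hp⟩ := EdgePath.exists_length_eq_dist hc x z
    obtain ⟨p', hp'⟩ := EdgePath.exists_length_eq_dist hc x z'
    have hr : (p.snoc hz).Reduced := EdgePath.reduced_of_length_le _ (by
      simp only [EdgePath.length]; omega)
    have hr' : (p'.snoc hz').Reduced := EdgePath.reduced_of_length_le _ (by
      simp only [EdgePath.length]; omega)
    cases (hr.push hK hr').lastEdge hK with
    | same _ _ => exact absurd rfl hne
    | @square w _ _ _ s _ _ r hq _ =>
      refine ⟨w, s, ?_⟩
      have h3 := hq.length_eq
      simp only [EdgePath.length] at h3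
      have h4 := r.dist_le
      have h5 := dist_adj_le hc x s.ab
      omega

end CubeData

/-! ### Medians, halfspaces, walls and the Helly property. -/

namespace CubeData

variable {K : CubeData.{u}}

theorem exists_closer (hc : K.graph.Connected) {x y : K.V} (h : x ≠ y) :
    ∃ z, K.graph.Adj z y ∧ K.graph.dist x y = K.graph.dist x z + 1 := by
  obtain ⟨p, hp⟩ := hc.exists_walk_length_eq_dist y x
  cases p with
  | nil => exact absurd rfl h
  | @cons _ z _ hadj p =>
    refine ⟨z, hadj.symm, ?_⟩
    have h1 := SimpleGraph.dist_le p
    have h2 := dist_adj_le hc x hadj.symm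
    rw [SimpleGraph.Walk.length_cons, SimpleGraph.dist_comm] at hp
    rw [SimpleGraph.dist_comm] at h1
    omega

/-- Combinatorially convex sets of vertices. -/
def Convex (K : CubeData.{u}) (S : Set K.V) : Prop :=
  ∀ x ∈ S, ∀ y ∈ S, ∀ z, K.graph.dist x z + K.graph.dist z y = K.graph.dist x y → z ∈ S

/-- The halfspace of the vertices that are closer to `a` than to `b`. -/
def half (K : CubeData.{u}) (a b : K.V) : Set K.V := {x | K.graph.dist x a < K.graph.dist x b}

/-- The wall of the edge from `a` to `b`. -/
def wall (K : CubeData.{u}) (a b : K.V) : Set (Set K.V) := {K.half a b, K.half b a}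

theorem wall_comm (a b : K.V) : K.wall a b = K.wall b a := Set.pair_comm _ _

theorem exists_boundary_edge (hc : K.graph.Connected) {S : Set K.V} {x z : K.V} (hx : x ∈ S)
    (hz : z ∉ S) : ∃ u u', K.graph.Adj u u' ∧ u ∈ S ∧ u' ∉ S ∧
      K.graph.dist x u' = K.graph.dist x u + 1 ∧
      K.graph.dist x u' + K.graph.dist u' z = K.graph.dist x z := by
  induction hn : K.graph.dist x z generalizing z with
  | zero =>
    rw [hc.dist_eq_zero_iff] at hn
    exact absurd (hn ▸ hx) hz
  | succ n ih =>
    have hne : x ≠ z := by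
      rintro rfl
      simp at hn
    obtain ⟨z', hadj, hd⟩ := exists_closer hc hne
    by_cases hz' : z' ∈ S
    · exact ⟨z', z, hadj, hz', hz, hd, by simp [hn]⟩
    · obtain ⟨u, u', h1, h2, h3, h4, h5⟩ := ih hz' (by omega)
      refine ⟨u, u', h1, h2, h3, h4, ?_⟩
      have := dist_adj_le hc u' hadj
      have := hc.dist_triangle (u := x) (v := u') (w := z)
      omega

theorem mem_half {a b x : K.V} : x ∈ K.half a b ↔ K.graph.dist x a < K.graph.dist x b := Iff.rfl

theorem left_mem_half {a b : K.V} (h : K.graph.Adj a b) : a ∈ K.half a b := by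
  rw [mem_half, SimpleGraph.dist_self, SimpleGraph.dist_eq_one_iff_adj.2 h]
  exact one_pos

namespace IsModular

theorem dist_adj (hK : K.IsModular) (x : K.V) {a b : K.V} (h : K.graph.Adj a b) :
    K.graph.dist x b = K.graph.dist x a + 1 ∨ K.graph.dist x a = K.graph.dist x b + 1 := by
  have h1 := hK.dist_ne x h
  have h2 := dist_adj_le hK.connected x h
  have h3 := dist_adj_le hK.connected x h.symm
  omega

theorem mem_half_iff (hK : K.IsModular) {a b x : K.V} (h : K.graph.Adj a b) :
    x ∈ K.half a b ↔ K.graph.dist x b = K.graph.dist x a + 1 := by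
  rw [mem_half]
  have := hK.dist_adj x h
  omega

theorem notMem_half_iff (hK : K.IsModular) {a b x : K.V} (h : K.graph.Adj a b) :
    x ∉ K.half a b ↔ x ∈ K.half b a := by
  rw [mem_half, mem_half]
  have := hK.dist_adj x h
  omega

theorem half_compl (hK : K.IsModular) {a b : K.V} (h : K.graph.Adj a b) :
    (K.half a b)ᶜ = K.half b a :=
  Set.ext fun _ => hK.notMem_half_iff h

theorem dist_eq_two (hK : K.IsModular) {a b c : K.V} (hab : K.graph.Adj a b)
    (hbc : K.graph.Adj b c) (hac : a ≠ c) : K.graph.dist a c = 2 := by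
  have h1 := hK.dist_adj a hbc
  have h2 : K.graph.dist a b = 1 := SimpleGraph.dist_eq_one_iff_adj.2 hab
  have h3 : K.graph.dist a c ≠ 0 := fun h => hac (hK.connected.dist_eq_zero_iff.1 h)
  omega

/-- Every 4-cycle bounds a square: the quadrangle condition seen from `w` gives a square whose
bottom vertex is at distance 0 from `w`. -/
theorem isSquare_of_adj (hK : K.IsModular) {w z y z' : K.V} (h1 : K.graph.Adj w z)
    (h2 : K.graph.Adj z y) (h3 : K.graph.Adj w z') (h4 : K.graph.Adj z' y) (hwy : w ≠ y)
    (hz : z ≠ z') : K.IsSquare w z y z' := by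
  have d1 : K.graph.dist w z = 1 := SimpleGraph.dist_eq_one_iff_adj.2 h1
  have d2 : K.graph.dist w z' = 1 := SimpleGraph.dist_eq_one_iff_adj.2 h3
  have d3 := hK.dist_eq_two h1 h2 hwy
  obtain ⟨w', s, h⟩ := hK.quadrangle w h2 h4 hz (by omega) (by omega)
  have : K.graph.dist w w' = 0 := by omega
  rw [hK.connected.dist_eq_zero_iff] at this
  rwa [this]

/-- A median of three vertices. -/
theorem exists_median (hK : K.IsModular) (x y z : K.V) : ∃ m,
    K.graph.dist y m + K.graph.dist m z = K.graph.dist y z ∧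
    K.graph.dist x m + K.graph.dist m y = K.graph.dist x y ∧
    K.graph.dist x m + K.graph.dist m z = K.graph.dist x z := by
  have hc := hK.connected
  induction hn : K.graph.dist z y generalizing y with
  | zero =>
    rw [hc.dist_eq_zero_iff] at hn
    subst hn
    exact ⟨z, by simp⟩
  | succ n ih =>
    by_cases h : ∃ t, K.graph.Adj t y ∧ K.graph.dist z t = n ∧
        K.graph.dist x y = K.graph.dist x t + 1
    · obtain ⟨t, ht, h1, h2⟩ := h
      obtain ⟨m, m1, m2, m3⟩ := ih t h1
      refine ⟨m, ?_, ?_, m3⟩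
      · have a1 := dist_adj_le hc m ht
        have a2 := hc.dist_triangle (u := y) (v := m) (w := z)
        rw [SimpleGraph.dist_comm (u := t)] at m1
        rw [SimpleGraph.dist_comm (u := y) (v := m), SimpleGraph.dist_comm (u := y) (v := z)] at *
        rw [SimpleGraph.dist_comm (u := t) (v := z)] at m1
        omega
      · have a1 := dist_adj_le hc m ht
        have a2 := hc.dist_triangle (u := x) (v := m) (w := y)
        omega
    · push Not at h
      have hzy : z ≠ y := by
        rintro rfl
        simp at hn
      obtain ⟨t, ht, h1⟩ := exists_closer hc hzy
      obtain ⟨m, m1, m2, m3⟩ := ih t (by omega)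
      have h2 := h t ht (by omega)
      have h3 := hK.dist_adj x ht
      -- No neighbour of `y` is closer to both `x` and `z`, and then `y` itself is the median. It
      -- suffices that the median for a neighbour `t` closer to `z` is `t`.
      refine ⟨y, by simp, by simp, ?_⟩
      suffices hm : m = t by
        subst hm
        rw [SimpleGraph.dist_comm (u := y)]
        rw [SimpleGraph.dist_comm (u := m)] at m3
        omega
      by_contra hmt
      obtain ⟨s, hs, hs'⟩ := exists_closer hc hmt
      have b1 := hc.dist_triangle (u := x) (v := m) (w := s)
      have b2 := hc.dist_triangle (u := z) (v := m) (w := s)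
      have b3 := dist_adj_le hc x hs
      have b4 := dist_adj_le hc z hs
      rw [SimpleGraph.dist_comm (u := t) (v := m), SimpleGraph.dist_comm (u := m) (v := z),
        SimpleGraph.dist_comm (u := t)] at m1
      have hsy : s ≠ y := by
        rintro rfl
        omega
      -- Both `s` and `y` are neighbours of `t` closer to `x`. The vertex `w` below them is a
      -- neighbour of `y` closer to both `x` and `z`, which was excluded.
      obtain ⟨w, sq, hw⟩ := hK.quadrangle x hs ht.symm hsy (by omega) (by omega)
      have b5 := dist_adj_le hc z sq.ab.symm
      have b6 := dist_adj_le hc z sq.ad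
      exact h w sq.ad (by omega) (by omega)

end IsModular

namespace IsCAT0

/-- Otherwise `a` and `c` are equally far from `x`, and `b` and `d` one step farther. The quadrangle
condition at `b` then gives a square on `a, b, c` whose fourth vertex is closer to `x` than `a`; by
uniqueness of squares it is `d`, a contradiction. -/
theorem half_subset_of_isSquare (hK : K.IsCAT0) {a b c d : K.V} (s : K.IsSquare a b c d) :
    K.half a b ⊆ K.half d c := by
  have hm := hK.isModular
  intro x hx
  by_contra hx'
  rw [hm.notMem_half_iff s.dc, hm.mem_half_iff s.dc.symm] at hx'
  rw [hm.mem_half_iff s.ab] at hx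
  have h1 := hm.dist_adj x s.ad
  have h2 := hm.dist_adj x s.bc
  obtain ⟨w, s', hw⟩ := hm.quadrangle x s.ab s.bc.symm s.ac_ne (by omega) (by omega)
  obtain rfl := s'.rotate.unique hK.isCubeComplex s
  omega

theorem half_eq_of_isSquare (hK : K.IsCAT0) {a b c d : K.V} (s : K.IsSquare a b c d) :
    K.half a b = K.half d c :=
  (hK.half_subset_of_isSquare s).antisymm
    (hK.half_subset_of_isSquare s.rotate.rotate.rotate.symm)

/-- Induction on the distance from `a` to `x`: the quadrangle condition seen from `b` pushes the
edge from `x` to `y` across a square towards the edge from `a` to `b`. -/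
theorem parallel_of_cross (hK : K.IsCAT0) {a b x y : K.V} (hab : K.graph.Adj a b)
    (hxy : K.graph.Adj x y) (hx : x ∈ K.half a b) (hy : y ∉ K.half a b) :
    Relation.EqvGen K.Opposite s(a, b) s(x, y) := by
  have hm := hK.isModular
  rw [hm.notMem_half_iff hab, hm.mem_half_iff hab.symm, SimpleGraph.dist_comm,
    SimpleGraph.dist_comm (v := b)] at hy
  rw [hm.mem_half_iff hab, SimpleGraph.dist_comm, SimpleGraph.dist_comm (v := a)] at hx
  have h1 := hm.dist_adj a hxy
  have h2 := hm.dist_adj b hxy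
  induction hn : K.graph.dist a x generalizing x y with
  | zero =>
    have h3 : K.graph.dist b y = 0 := by omega
    rw [hm.connected.dist_eq_zero_iff] at hn h3
    subst hn h3
    exact .refl _
  | succ n ih =>
    have hne : a ≠ x := by
      rintro rfl
      simp at hn
    obtain ⟨x', hx', hd⟩ := exists_closer hm.connected hne
    have h3 := hm.dist_adj b hx'
    have e1 : K.graph.dist b x' ≤ K.graph.dist a x' + 1 := by
      have := dist_adj_le hm.connected x' hab
      rwa [SimpleGraph.dist_comm, SimpleGraph.dist_comm (u := x')] at this
    have hyx : y ≠ x' := by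
      rintro rfl
      omega
    obtain ⟨w, s, hw⟩ := hm.quadrangle b hxy.symm hx' hyx (by omega) (by omega)
    have e2 : K.graph.dist a w ≤ K.graph.dist b w + 1 := by
      have := dist_adj_le hm.connected w hab.symm
      rwa [SimpleGraph.dist_comm, SimpleGraph.dist_comm (u := w)] at this
    have h4 := hm.dist_adj a s.ab
    have h5 := hm.dist_adj a s.ad
    have h6 := hm.dist_adj b s.ad
    exact (ih s.ad.symm (by omega) (by omega) (by omega) (by omega) (by omega)).trans _ _ _
      (.rel _ _ ⟨_, _, _, _, s.rotate.rotate.rotate, rfl, rfl⟩)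

theorem wall_eq_of_parallel (hK : K.IsCAT0) {e e' : Sym2 K.V}
    (h : Relation.EqvGen K.Opposite e e') {a b x y : K.V} (he : e = s(a, b)) (he' : e' = s(x, y)) :
    K.wall a b = K.wall x y := by
  have aux : ∀ {a b c d : K.V}, s(a, b) = s(c, d) → K.wall a b = K.wall c d := by
    intro a b c d h
    rcases Sym2.eq_iff.1 h with ⟨rfl, rfl⟩ | ⟨rfl, rfl⟩
    · rfl
    · exact wall_comm _ _
  induction h generalizing a b x y with
  | rel e e' h =>
    obtain ⟨p, q, r, t, s, rfl, rfl⟩ := h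
    rw [← aux he, ← aux he', wall, wall, hK.half_eq_of_isSquare s,
      hK.half_eq_of_isSquare s.rotate.symm]
  | refl e => exact aux (he.symm.trans he')
  | symm _ _ _ ih => exact (ih he' he).symm
  | trans e e'' e' _ _ ih1 ih2 =>
    induction e'' using Sym2.ind with | _ p q =>
    exact (ih1 he rfl).trans (ih2 rfl he')

theorem half_eq_of_cross (hK : K.IsCAT0) {a b x y : K.V} (hab : K.graph.Adj a b)
    (hxy : K.graph.Adj x y) (hx : x ∈ K.half a b) (hy : y ∉ K.half a b) :
    K.half x y = K.half a b := by
  have h := hK.wall_eq_of_parallel (hK.parallel_of_cross hab hxy hx hy) rfl rfl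
  have h1 : K.half a b ∈ K.wall x y := h ▸ Set.mem_insert _ _
  rcases h1 with h1 | h1
  · exact h1.symm
  · rw [h1, ← hK.isModular.notMem_half_iff hxy] at hx
    exact absurd (left_mem_half hxy) hx

/-- A geodesic that left the halfspace would do so along an edge defining the same halfspace. Then
`y` is closer to the inner end of this edge, although the geodesic to `y` continues from the outer
end. -/
theorem half_convex (hK : K.IsCAT0) {a b : K.V} (hab : K.graph.Adj a b) :
    K.Convex (K.half a b) := by
  have hm := hK.isModular
  intro x hx y hy z hz
  by_contra hz'
  obtain ⟨u, u', h1, h2, h3, h4, h5⟩ := exists_boundary_edge hm.connected hx hz'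
  rw [← hK.half_eq_of_cross hab h1 h2 h3, hm.mem_half_iff h1, SimpleGraph.dist_comm,
    SimpleGraph.dist_comm (u := y)] at hy
  have := hm.connected.dist_triangle (u := x) (v := u) (w := y)
  have := hm.connected.dist_triangle (u := u') (v := z) (w := y)
  omega

/-- The wall is also that of the edge from `y` to `y₁`, so `y₂` is closer to `y₁` than to its own
neighbour `y`. -/
theorem eq_of_cross (hK : K.IsCAT0) {a b y y₁ y₂ : K.V} (hab : K.graph.Adj a b)
    (h1 : K.graph.Adj y y₁) (h2 : K.graph.Adj y y₂) (hy : y ∈ K.half a b) (hy1 : y₁ ∉ K.half a b)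
    (hy2 : y₂ ∉ K.half a b) : y₁ = y₂ := by
  have hm := hK.isModular
  rw [← hK.half_eq_of_cross hab h1 hy hy1, hm.notMem_half_iff h1, mem_half,
    SimpleGraph.dist_eq_one_iff_adj.2 h2.symm, Nat.lt_one_iff, hm.connected.dist_eq_zero_iff] at hy2
  exact hy2.symm

/-- The edge crossing the wall at `y₁` is carried step by step towards `z`: seen from the far end
`w₂` of the crossing edge at `y₂`, the next vertex `t` and the far end `w₁` are both closer than
`y₁`, so they span a square with `y₁`. -/
theorem boundary_convex (hK : K.IsCAT0) {a b : K.V} (hab : K.graph.Adj a b) :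
    K.Convex {y | y ∈ K.half a b ∧ ∃ w, K.graph.Adj y w ∧ w ∉ K.half a b} := by
  have hm := hK.isModular
  have hc := hm.connected
  rintro y₁ ⟨hy₁, hw₁⟩ y₂ ⟨hy₂, w₂, hw₂, hw₂'⟩ z hz
  refine ⟨hK.half_convex hab _ hy₁ _ hy₂ _ hz, ?_⟩
  obtain ⟨n, hn⟩ : ∃ n, K.graph.dist z y₁ = n := ⟨_, rfl⟩
  induction n generalizing y₁ with
  | zero =>
    rw [hc.dist_eq_zero_iff] at hn
    exact hn ▸ hw₁
  | succ n ih =>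
    obtain ⟨w₁, hw₁, hw₁'⟩ := hw₁
    have hne : z ≠ y₁ := by
      rintro rfl
      simp at hn
    obtain ⟨t, ht, hd⟩ := exists_closer hc hne
    have c1 := hc.dist_triangle (u := t) (v := z) (w := y₂)
    have c2 := dist_adj_le hc y₂ ht
    have c3 := hc.dist_triangle (u := y₁) (v := t) (w := y₂)
    have c4 : K.graph.dist y₁ t = 1 := SimpleGraph.dist_eq_one_iff_adj.2 ht.symm
    have e1 := SimpleGraph.dist_comm (G := K.graph) (u := t) (v := z)
    have e2 := SimpleGraph.dist_comm (G := K.graph) (u := y₁) (v := z)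
    have e3 := SimpleGraph.dist_comm (G := K.graph) (u := t) (v := y₂)
    have e4 := SimpleGraph.dist_comm (G := K.graph) (u := y₁) (v := y₂)
    have htH : t ∈ K.half a b := hK.half_convex hab _ hy₁ _ hy₂ _ (by omega)
    have q2 := hK.half_eq_of_cross hab hw₂ hy₂ hw₂'
    have q1 := hK.half_eq_of_cross hab hw₁ hy₁ hw₁'
    have f1 := (hm.mem_half_iff hw₂).1 (q2.symm ▸ hy₁ : y₁ ∈ K.half y₂ w₂)
    have f2 := (hm.mem_half_iff hw₂).1 (q2.symm ▸ htH : t ∈ K.half y₂ w₂)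
    have f3 := (hm.mem_half_iff hw₂.symm).1 ((hm.notMem_half_iff hw₂).1 (q2.symm ▸ hw₁'))
    have f4 := (hm.mem_half_iff hw₁).1 (q1.symm ▸ hy₂ : y₂ ∈ K.half y₁ w₁)
    rw [SimpleGraph.dist_comm] at f1 f2
    rw [SimpleGraph.dist_comm, SimpleGraph.dist_comm (u := w₁)] at f3
    have htw : t ≠ w₁ := by
      rintro rfl
      exact hw₁' htH
    obtain ⟨w, s, hw⟩ := hm.quadrangle w₂ ht hw₁.symm htw (by omega) (by omega)
    refine ih _ htH ⟨w, s.ab.symm, ?_⟩ (by omega) (by omega)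
    rw [← q1, hK.half_eq_of_isSquare s.rotate.rotate, hm.notMem_half_iff s.ab.symm]
    exact left_mem_half s.ab

/-- Every edge between the two halfspaces is parallel to the given edge and so is deleted. Inside a
halfspace, a geodesic to the end of a dual edge uses no deleted edge, because a deleted edge has its
ends on different sides. -/
theorem walls_eq (hK : K.IsCAT0) : K.walls = {W | ∃ a b, K.graph.Adj a b ∧ W = K.wall a b} := by
  have hm := hK.isModular
  have hc := hm.connected
  have key : ∀ {a b : K.V}, K.graph.Adj a b →
      {U | ∃ c : (K.graph.deleteEdges (K.parallelClass s(a, b))).ConnectedComponent, U = c.supp} =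
        K.wall a b := by
    intro a b hab
    have stay : ∀ {u v : K.V}, (K.graph.deleteEdges (K.parallelClass s(a, b))).Adj u v →
        (u ∈ K.half a b ↔ v ∈ K.half a b) := by
      intro u v h
      rw [SimpleGraph.deleteEdges_adj] at h
      by_contra hne
      by_cases hu : u ∈ K.half a b
      · exact h.2 (hK.parallel_of_cross hab h.1 hu fun hv => hne ⟨fun _ => hv, fun _ => hu⟩)
      · have hv : v ∈ K.half a b := by tauto
        have := hK.parallel_of_cross hab h.1.symm hv hu
        rw [Sym2.eq_swap (a := v)] at this
        exact h.2 this
    have stay' : ∀ {u v : K.V}, (K.graph.deleteEdges (K.parallelClass s(a, b))).Reachable u v →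
        (u ∈ K.half a b ↔ v ∈ K.half a b) := by
      rintro u v ⟨p⟩
      induction p with
      | nil => rfl
      | cons h p ih => exact (stay h).trans ih
    have conn : ∀ {x y : K.V}, K.graph.Adj x y → K.wall x y = K.wall a b →
        ∀ z ∈ K.half x y, (K.graph.deleteEdges (K.parallelClass s(a, b))).Reachable z x := by
      intro x y hxy hW z hz
      induction hn : K.graph.dist x z generalizing z with
      | zero =>
        rw [hc.dist_eq_zero_iff] at hn
        rw [hn]
      | succ n ih =>
        have hne : x ≠ z := by
          rintro rfl
          simp at hn
        obtain ⟨z', hz', hd⟩ := exists_closer hc hne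
        have hzz : z' ∈ K.half x y := by
          rw [hm.mem_half_iff hxy, SimpleGraph.dist_comm, SimpleGraph.dist_comm (v := x)] at hz
          rw [mem_half, SimpleGraph.dist_comm, SimpleGraph.dist_comm (v := y)]
          have := dist_adj_le hc y hz'
          omega
        refine SimpleGraph.Reachable.trans (SimpleGraph.Adj.reachable ?_) (ih z' hzz (by omega))
        rw [SimpleGraph.deleteEdges_adj]
        refine ⟨hz'.symm, fun hp => ?_⟩
        have h1 := (hK.wall_eq_of_parallel hp rfl rfl).symm.trans hW.symm
        have h2 : K.half z z' ∈ K.wall x y := h1 ▸ Set.mem_insert _ _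
        have h3 : z' ∉ K.half z z' := by
          rw [hm.notMem_half_iff hz'.symm]
          exact left_mem_half hz'
        rcases h2 with h2 | h2
        · exact h3 (h2 ▸ hzz)
        · have : z ∈ K.half y x := h2 ▸ left_mem_half hz'.symm
          rw [← hm.notMem_half_iff hxy] at this
          exact this hz
    have comp : ∀ {x y : K.V}, K.graph.Adj x y → K.wall x y = K.wall a b →
        ((K.graph.deleteEdges (K.parallelClass s(a, b))).connectedComponentMk x).supp =
          K.half x y := by
      intro x y hxy hW
      ext z
      rw [SimpleGraph.ConnectedComponent.mem_supp_iff, SimpleGraph.ConnectedComponent.eq]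
      refine ⟨fun hz => ?_, conn hxy hW z⟩
      have h1 : K.half x y ∈ K.wall a b := hW ▸ Set.mem_insert _ _
      have h2 := stay' hz
      have h3 := left_mem_half hxy
      rcases h1 with h1 | h1
      · rw [h1] at h3 ⊢
        exact h2.2 h3
      · rw [h1, ← hm.notMem_half_iff hab] at h3 ⊢
        exact fun h => h3 (h2.1 h)
    ext U
    constructor
    · rintro ⟨c, rfl⟩
      induction c using SimpleGraph.ConnectedComponent.ind with | _ x =>
      by_cases hx : x ∈ K.half a b
      · left
        rw [← comp hab rfl, SimpleGraph.ConnectedComponent.eq.2 (conn hab rfl x hx)]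
      · right
        rw [hm.notMem_half_iff hab] at hx
        change _ = _
        rw [← comp hab.symm (wall_comm _ _),
          SimpleGraph.ConnectedComponent.eq.2 (conn hab.symm (wall_comm _ _) x hx)]
    · rintro (rfl | rfl)
      · exact ⟨_, (comp hab rfl).symm⟩
      · exact ⟨_, (comp hab.symm (wall_comm _ _)).symm⟩
  ext W
  constructor
  · rintro ⟨e, he, rfl⟩
    induction e using Sym2.ind with | _ a b =>
    exact ⟨a, b, he, key he⟩
  · rintro ⟨a, b, hab, rfl⟩
    exact ⟨s(a, b), hab, (key hab).symm⟩

/-- The Helly property of convex sets. -/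
theorem helly (hK : K.IsModular) {ι : Type*} (h : ι → Set K.V) (hconv : ∀ i, K.Convex (h i))
    (hne : ∀ i j, (h i ∩ h j).Nonempty) (x : K.V) (hx : {i | x ∉ h i}.Finite) :
    ∃ y, ∀ i, y ∈ h i := by
  obtain ⟨n, hn⟩ : ∃ n, {i | x ∉ h i}.ncard = n := ⟨_, rfl⟩
  induction n using Nat.strong_induction_on generalizing x with | _ n ih =>
  by_cases h0 : ∃ i, x ∉ h i
  · obtain ⟨i, hi⟩ := h0
    obtain ⟨z, hz⟩ := hne i i
    obtain ⟨y, hy, hmin⟩ : ∃ y ∈ h i, ∀ z ∈ h i, K.graph.dist x y ≤ K.graph.dist x z := by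
      have hex : ∃ k, ∃ y ∈ h i, K.graph.dist x y = k := ⟨_, z, hz.1, rfl⟩
      classical
      obtain ⟨y, hy, hk⟩ := Nat.find_spec hex
      exact ⟨y, hy, fun z hz => hk ▸ Nat.find_min' hex ⟨z, hz, rfl⟩⟩
    -- Moving from `x` to a nearest point `y` of `h i` leaves no `h j` that contains `x`: the median
    -- of `x`, `y` and a common point of `h i` and `h j` lies in both sets and between `x` and `y`,
    -- so it is `y`.
    have hsub : {j | y ∉ h j} ⊂ {j | x ∉ h j} := by
      refine ⟨fun j hj hxj => hj ?_, fun hh => hh hi hy⟩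
      obtain ⟨p, hpi, hpj⟩ := hne i j
      obtain ⟨m, m1, m2, m3⟩ := hK.exists_median x y p
      have hmi := hconv i _ hy _ hpi _ m1
      have hmj := hconv j _ hxj _ hpj _ m3
      have := hmin m hmi
      have hmy : K.graph.dist m y = 0 := by omega
      rw [hK.connected.dist_eq_zero_iff] at hmy
      exact hmy ▸ hmj
    exact ih _ (hn ▸ Set.ncard_lt_ncard hsub hx) y (hx.subset hsub.1) rfl
  · push Not at h0
    exact ⟨x, h0⟩

theorem subset_of_convex (hK : K.IsCAT0) {S : Set K.V} (hS : K.Convex S) {C : Set K.V}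
    (hC : C ∈ K.cubes) {v : K.V} (hv : v ∈ C) (hvS : v ∈ S) (hN : K.nbrs C v ⊆ S) : C ⊆ S := by
  refine hK.isCubeComplex.cube_induction hC hv (· ∈ S) hvS hN ?_
  intro a b c d s _ hb hd
  refine hS b hb d hd c ?_
  rw [SimpleGraph.dist_eq_one_iff_adj.2 s.bc, SimpleGraph.dist_eq_one_iff_adj.2 s.dc.symm,
    hK.isModular.dist_eq_two s.bc s.dc.symm s.bd_ne]

/-- The image of an embedded standard cube graph is a cube. -/
theorem range_mem_cubes (hK : K.IsCAT0) {n : ℕ} {e : (Fin n → Bool) → K.V}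
    (he : Function.Injective e) (hadj : ∀ x i, K.graph.Adj (e x) (e (flipAt i x))) :
    Set.range e ∈ K.cubes := by
  have sq : ∀ (x : Fin n → Bool) {i j : Fin n}, i ≠ j →
      K.IsSquare (e x) (e (flipAt i x)) (e (flipAt i (flipAt j x))) (e (flipAt j x)) := by
    intro x i j hij
    refine hK.isModular.isSquare_of_adj (hadj _ _) ?_ (hadj _ _) (hadj _ _)
      (fun h => flipAt_flipAt_ne hij x (he h).symm) fun h => hij (flipAt_left_injective x (he h))
    rw [flipAt_comm]
    exact hadj _ _
  let o : Fin n → Bool := fun _ => false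
  have hinj : Function.Injective fun i => e (flipAt i o) :=
    fun i j h => flipAt_left_injective o (he h)
  obtain ⟨D, hD, hv, hN⟩ := hK.exists_cube (v := e o) (A := Set.range fun i => e (flipAt i o))
    (Set.finite_range _) (by rintro _ ⟨i, rfl⟩; exact hadj _ _) (by
      rintro _ ⟨i, rfl⟩ _ ⟨j, rfl⟩ hne
      have hij : i ≠ j := by
        rintro rfl
        exact hne rfl
      exact ⟨_, sq o hij⟩)
  have hsub : Set.range e ⊆ D := by
    rintro _ ⟨x, rfl⟩
    refine bool_cube_induction (fun x => e x ∈ D) o hv (fun i => ?_) ?_ x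
    · exact (hN ▸ Set.mem_range_self i : e (flipAt i o) ∈ K.nbrs D (e o)).1
    · intro y i j hij h1 h2 h3
      exact hK.isCubeComplex.isSquare_closed hD (sq y hij) h1 h2 h3
  obtain ⟨m, e', x', he', hx'⟩ := hK.isCubeComplex.exists_chart_at hD hv
  -- The cube `D` has exactly `n` edges at the corner `e o`, hence dimension `n`; being contained in
  -- `D`, the range fills it by counting vertices.
  have hmn : m = n := by
    have h1 : (K.nbrs D (e o)).ncard = n := by
      rw [hN, ← Set.image_univ, Set.ncard_image_of_injective _ hinj]
      simp [Set.ncard_univ]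
    have h2 : (K.nbrs D (e o)).ncard = m := by
      rw [← hx', he'.nbrs_eq, ← Set.image_univ, Set.ncard_image_of_injective _
        fun i j h => flipAt_left_injective x' (he'.injective h)]
      simp [Set.ncard_univ]
    omega
  subst hmn
  have : Set.range e = D := by
    refine Set.eq_of_subset_of_ncard_le hsub ?_ he'.finite
    rw [he'.ncard, ← Set.image_univ, Set.ncard_image_of_injective _ he, Set.ncard_univ]
    simp
  exact this ▸ hD

end IsCAT0

/-- In a chart, the halfspaces of an edge are given by the corresponding coordinate. -/
theorem IsCAT0.half_chart (hK : K.IsCAT0) {n : ℕ} {e : (Fin n → Bool) → K.V} {C : Set K.V}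
    (he : K.IsChart e C) (x₀ x : Fin n → Bool) (i : Fin n) :
    (x i = x₀ i → K.half (e x) (e (flipAt i x)) = K.half (e x₀) (e (flipAt i x₀))) ∧
    (x i ≠ x₀ i → K.half (e (flipAt i x)) (e x) = K.half (e x₀) (e (flipAt i x₀))) := by
  refine bool_cube_step (fun x =>
    (x i = x₀ i → K.half (e x) (e (flipAt i x)) = K.half (e x₀) (e (flipAt i x₀))) ∧
    (x i ≠ x₀ i → K.half (e (flipAt i x)) (e x) = K.half (e x₀) (e (flipAt i x₀)))) x₀
    ⟨fun _ => rfl, fun h => absurd rfl h⟩ ?_ x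
  intro x j hx
  by_cases hj : i = j
  · subst hj
    rw [flipAt_flipAt, flipAt_same]
    constructor
    · intro h
      refine hx.2 fun h' => ?_
      rw [h'] at h
      cases h2 : x₀ i <;> simp [h2] at h
    · intro h
      refine hx.1 ?_
      revert h
      cases x i <;> cases x₀ i <;> simp
  · rw [flipAt_of_ne hj]
    have s := he.isSquare x hj
    rw [← hK.half_eq_of_isSquare s, ← hK.half_eq_of_isSquare s.rotate.symm]
    exact hx

theorem IsCAT0.mem_half_chart (hK : K.IsCAT0) {n : ℕ} {e : (Fin n → Bool) → K.V} {C : Set K.V}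
    (he : K.IsChart e C) (x₀ x : Fin n → Bool) (i : Fin n) :
    e x ∈ K.half (e x₀) (e (flipAt i x₀)) ↔ x i = x₀ i := by
  constructor
  · intro h
    by_contra hne
    rw [← (hK.half_chart he x₀ x i).2 hne,
      ← hK.isModular.notMem_half_iff (he.adj_flipAt _ _)] at h
    exact h (left_mem_half (he.adj_flipAt _ _))
  · intro h
    rw [← (hK.half_chart he x₀ x i).1 h]
    exact left_mem_half (he.adj_flipAt _ _)

end CubeData

/-! ### Simple connectedness from the metric conditions; convex subcomplexes. -/

namespace CubeData

variable {K L M : CubeData.{u}}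

/-- The cocycle is integrated along a spanning tree of geodesics to `x`. For an edge outside the
tree, the quadrangle condition gives a square whose lower edges are closer to `x`, and the cocycle
identity on this square finishes the induction. -/
theorem IsModular.exists_potential (hK : K.IsModular) {G : Type*} [Group G] {g : K.V → K.V → G}
    (hg : K.IsCocycle g) : ∃ c, K.IsPotential g c := by
  obtain ⟨x⟩ := hK.connected.nonempty
  have hpar : ∀ v, ∃ w, v ≠ x → K.graph.Adj w v ∧ K.graph.dist x v = K.graph.dist x w + 1 := by
    intro v
    by_cases h : v = x
    · exact ⟨v, fun h' => absurd h h'⟩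
    · obtain ⟨w, hw⟩ := exists_closer hK.connected (Ne.symm h)
      exact ⟨w, fun _ => hw⟩
  choose par hpar using hpar
  -- The recursion depth is an explicit argument; it is set to the distance to `x`, which drops by
  -- one at each parent.
  let c' : ℕ → K.V → G := fun n => Nat.rec (fun _ => 1) (fun _ r v => g (par v) v * r (par v)) n
  let c : K.V → G := fun v => c' (K.graph.dist x v) v
  have hc : ∀ v, v ≠ x → c v = g (par v) v * c (par v) := by
    intro v hv
    simp only [c]
    rw [(hpar v hv).2]
  have key : ∀ (n : ℕ) (a b : K.V), K.graph.Adj a b → K.graph.dist x b = K.graph.dist x a + 1 →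
      K.graph.dist x b = n → g a b = c b * (c a)⁻¹ := by
    intro n
    induction n using Nat.strong_induction_on with | _ n ih =>
    intro a b hab hd hn
    have hb : b ≠ x := by
      rintro rfl
      simp at hd
    obtain ⟨hp, hpd⟩ := hpar b hb
    by_cases hpa : par b = a
    · have := hc b hb
      rw [hpa] at this
      rw [this]
      group
    · obtain ⟨w, s, hw⟩ := hK.quadrangle x hab hp (Ne.symm hpa) hd hpd
      have h1 := ih (K.graph.dist x a) (by omega) w a s.ab (by omega) rfl
      have h2 := ih (K.graph.dist x (par b)) (by omega) w (par b) s.ad (by omega) rfl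
      have h3 := hg.square s
      rw [h1, h2, ← eq_mul_inv_iff_mul_eq] at h3
      rw [h3, hc b hb]
      group
  refine ⟨c, fun {a b} hab => ?_⟩
  rcases hK.dist_adj x hab with h | h
  · exact key _ a b hab h rfl
  · have h1 := key _ b a hab.symm h rfl
    have h2 := hg.inv hab.symm
    rw [h1] at h2
    rw [eq_inv_of_mul_eq_one_left h2]
    group

theorem IsModular.isSimplyConnected (hK : K.IsModular) : K.IsSimplyConnected :=
  isSimplyConnected_of_potential hK.connected fun _ _ _ hg => hK.exists_potential hg

/-- Injective maps that preserve cubes preserve squares. -/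
theorem IsSquare.map {f : K.V → L.V} (hf : Function.Injective f)
    (hf' : ∀ S ∈ K.cubes, f '' S ∈ L.cubes) {a b c d : K.V} (s : K.IsSquare a b c d) :
    L.IsSquare (f a) (f b) (f c) (f d) := by
  have hadj : ∀ {a b : K.V}, K.graph.Adj a b → L.graph.Adj (f a) (f b) := fun h =>
    ⟨hf.ne h.1, by rw [← Set.image_pair]; exact hf' _ h.2⟩
  refine ⟨?_, hadj s.ab, hadj s.bc, hadj s.ad, hadj s.dc, hf.ne s.ac_ne, hf.ne s.bd_ne⟩
  have := hf' _ s.mem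
  rwa [Set.image_insert_eq, Set.image_insert_eq, Set.image_pair] at this

namespace IsConvexEmbedding

variable {f : K.V → L.V}

theorem convex_range (hf : IsConvexEmbedding K L f) : L.Convex (Set.range f) := by
  rintro _ ⟨x, rfl⟩ _ ⟨y, rfl⟩ z hz
  exact hf.convex x y z hz

theorem isSquare_iff (hf : IsConvexEmbedding K L f) {a b c d : K.V} :
    L.IsSquare (f a) (f b) (f c) (f d) ↔ K.IsSquare a b c d := by
  constructor
  · intro s
    refine ⟨?_, (hf.adj_iff _ _).1 s.ab, (hf.adj_iff _ _).1 s.bc, (hf.adj_iff _ _).1 s.ad,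
      (hf.adj_iff _ _).1 s.dc, fun h => s.ac_ne (h ▸ rfl), fun h => s.bd_ne (h ▸ rfl)⟩
    rw [← hf.mem_cubes_iff, Set.image_insert_eq, Set.image_insert_eq, Set.image_pair]
    exact s.mem
  · exact fun s => s.map hf.injective fun S hS => (hf.mem_cubes_iff S).2 hS

theorem nbrs_image (hf : IsConvexEmbedding K L f) (C : Set K.V) (v : K.V) :
    L.nbrs (f '' C) (f v) = f '' K.nbrs C v := by
  ext w
  constructor
  · rintro ⟨⟨x, hx, rfl⟩, h⟩
    exact ⟨x, ⟨hx, (hf.adj_iff _ _).1 h⟩, rfl⟩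
  · rintro ⟨x, ⟨hx, h⟩, rfl⟩
    exact ⟨⟨x, hx, rfl⟩, (hf.adj_iff _ _).2 h⟩

/-- A cube of `L` whose edges at `f v` stay in the convex range lies in the range, so links of `K`
are full subcomplexes of links of `L`. -/
theorem image_mem_link_iff (hf : IsConvexEmbedding K L f) (hL : L.IsCAT0) {v : K.V}
    {A : Set K.V} : f '' A ∈ L.link (f v) ↔ A ∈ K.link v := by
  constructor
  · rintro ⟨D, hD, hv, h⟩
    have hsub : D ⊆ Set.range f := by
      refine hL.subset_of_convex hf.convex_range hD hv ⟨v, rfl⟩ ?_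
      change f '' A = L.nbrs D (f v) at h
      rw [← h]
      exact Set.image_subset_range _ _
    obtain ⟨C, rfl⟩ := Set.subset_range_iff_exists_image_eq.1 hsub
    refine ⟨C, (hf.mem_cubes_iff C).1 hD, by rwa [hf.injective.mem_set_image] at hv, ?_⟩
    have h' : f '' A = f '' K.nbrs C v := h.trans (hf.nbrs_image C v)
    exact hf.injective.image_injective h'
  · rintro ⟨C, hC, hv, rfl⟩
    exact ⟨f '' C, (hf.mem_cubes_iff C).2 hC, ⟨v, hv, rfl⟩, (hf.nbrs_image C v).symm⟩

theorem connected (hf : IsConvexEmbedding K L f) (hL : L.graph.Connected) [Nonempty K.V] :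
    K.graph.Connected := by
  refine ⟨fun x y => ?_⟩
  induction hn : L.graph.dist (f x) (f y) generalizing y with
  | zero =>
    rw [hL.dist_eq_zero_iff] at hn
    rw [hf.injective hn]
  | succ n ih =>
    have hne : f x ≠ f y := by
      intro h
      simp [h] at hn
    obtain ⟨z, hz, hd⟩ := exists_closer hL hne
    have h1 : L.graph.dist z (f y) = 1 := SimpleGraph.dist_eq_one_iff_adj.2 hz
    obtain ⟨z, rfl⟩ := hf.convex x y z (by omega)
    exact (ih z (by omega)).trans ((hf.adj_iff _ _).1 hz).reachable

/-- Convex subcomplexes of CAT(0) cube complexes are CAT(0). -/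
theorem isCAT0 (hf : IsConvexEmbedding K L f) (hL : L.IsCAT0) [Nonempty K.V] : K.IsCAT0 := by
  have hm := hL.isModular
  have hc := hf.connected hm.connected
  have hd := hf.dist_eq hc hm.connected
  -- Simple connectedness is not inherited by subcomplexes in general, but the metric conditions
  -- pass to convex ones and imply it.
  have hmod : K.IsModular := by
    refine ⟨hc, fun x a b h => ?_, fun x y z z' h1 h2 h3 h4 h5 => ?_⟩
    · rw [← hd, ← hd]
      exact hm.dist_ne _ ((hf.adj_iff _ _).2 h)
    · rw [← hd, ← hd] at h4 h5
      obtain ⟨w, s, hw⟩ := hm.quadrangle (f x) ((hf.adj_iff _ _).2 h1) ((hf.adj_iff _ _).2 h2)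
        (hf.injective.ne h3) h4 h5
      have h6 : L.graph.dist w (f z) = 1 := SimpleGraph.dist_eq_one_iff_adj.2 s.ab
      obtain ⟨w, rfl⟩ := hf.convex x z w (by omega)
      refine ⟨w, hf.isSquare_iff.1 s, ?_⟩
      rwa [hd, hd] at hw
  refine ⟨⟨fun v => ?_, fun C hC => ?_, fun C hC D hD hne => ?_⟩, hmod.isSimplyConnected,
    fun v A hA h => ?_⟩
  · rw [← hf.mem_cubes_iff, Set.image_singleton]
    exact hL.isCubeComplex.singleton_mem _
  · obtain ⟨n, e, he⟩ := hL.isCubeComplex.exists_chart _ ((hf.mem_cubes_iff C).2 hC)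
    choose e' he'C he' using he.mem
    obtain rfl : e = f ∘ e' := funext fun x => (he' x).symm
    refine ⟨n, e', he.injective.of_comp, ?_, fun S hS => ?_⟩
    · apply hf.injective.image_injective
      rw [← he.range_eq, Set.range_comp]
    · rw [← hf.mem_cubes_iff, he.mem_cubes_iff _ (Set.image_mono hS)]
      simp only [Set.image_comp, hf.injective.image_injective.eq_iff]
  · rw [← hf.mem_cubes_iff, Set.image_inter hf.injective]
    refine hL.isCubeComplex.inter_mem _ ((hf.mem_cubes_iff _).2 hC) _ ((hf.mem_cubes_iff _).2 hD) ?_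
    rw [← Set.image_inter hf.injective]
    exact hne.image f
  · rw [← hf.image_mem_link_iff hL]
    refine hL.flag _ _ (hA.image f) ?_
    rintro _ ⟨a, ha, rfl⟩ _ ⟨b, hb, rfl⟩
    rw [← Set.image_pair, hf.image_mem_link_iff hL]
    exact h a ha b hb

theorem of_comp {g : L.V → M.V} {h : K.V → L.V} (hg : IsConvexEmbedding L M g)
    (hgh : IsConvexEmbedding K M fun x => g (h x)) (hL : L.graph.Connected)
    (hM : M.graph.Connected) : IsConvexEmbedding K L h := by
  refine ⟨fun x y hxy => hgh.injective (congrArg g hxy), fun S => ?_, fun x y z hz => ?_⟩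
  · rw [← hgh.mem_cubes_iff, ← hg.mem_cubes_iff, Set.image_image]
  · rw [← hg.dist_eq hL hM, ← hg.dist_eq hL hM, ← hg.dist_eq hL hM] at hz
    obtain ⟨w, hw⟩ := hgh.convex x y (g z) hz
    exact ⟨w, hg.injective hw⟩

end IsConvexEmbedding

end CubeData

/-! ### The cube complex dual to a wallspace. -/

/-- Every wall consists of a set and its complement. -/
def IsHalving {X : Type u} (𝒲 : Set (Set (Set X))) : Prop :=
  ∀ W ∈ 𝒲, ∃ H : Set X, W = {H, Hᶜ}

namespace IsHalving

variable {X : Type u} {𝒲 : Set (Set (Set X))}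

theorem eq_pair (h𝒲 : IsHalving 𝒲) {W : Set (Set X)} (hW : W ∈ 𝒲) {A : Set X} (hA : A ∈ W) :
    W = {A, Aᶜ} := by
  obtain ⟨H, rfl⟩ := h𝒲 W hW
  rcases hA with rfl | hA
  · rfl
  · rw [Set.mem_singleton_iff] at hA
    subst hA
    rw [compl_compl, Set.pair_comm]

theorem eq_compl (h𝒲 : IsHalving 𝒲) {W : Set (Set X)} (hW : W ∈ 𝒲) {A B : Set X} (hA : A ∈ W)
    (hB : B ∈ W) (hne : A ≠ B) : B = Aᶜ := by
  rw [h𝒲.eq_pair hW hA] at hB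
  rcases hB with rfl | hB
  · exact absurd rfl hne
  · exact hB

theorem compl_mem (h𝒲 : IsHalving 𝒲) {W : Set (Set X)} (hW : W ∈ 𝒲) {A : Set X} (hA : A ∈ W) :
    Aᶜ ∈ W := by
  rw [h𝒲.eq_pair hW hA]
  exact .inr rfl

theorem eq_of_mem (h𝒲 : IsHalving 𝒲) {W : Set (Set X)} (hW : W ∈ 𝒲) {A B : Set X} (hA : A ∈ W)
    (hB : B ∈ W) {x : X} (hxA : x ∈ A) (hxB : x ∈ B) : A = B := by
  by_contra hne
  rw [h𝒲.eq_compl hW hA hB hne] at hxB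
  exact hxB hxA

theorem wall_eq (h𝒲 : IsHalving 𝒲) {W W' : 𝒲} {A : Set X} (hA : A ∈ W.1) (hA' : A ∈ W'.1) :
    W = W' :=
  Subtype.ext ((h𝒲.eq_pair W.2 hA).trans (h𝒲.eq_pair W'.2 hA').symm)

/-- The walls on which two 0-cubes differ. -/
def diff (s t : (dualComplex 𝒲).V) : Set 𝒲 := {W | s.1 W ≠ t.1 W}

theorem diff_finite (h𝒲 : IsHalving 𝒲) [hX : Nonempty X] (s t : (dualComplex 𝒲).V) :
    (diff s t).Finite := by
  obtain ⟨x⟩ := hX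
  refine ((s.2.finite x).union (t.2.finite x)).subset fun W hW => ?_
  by_contra hx
  simp only [Set.mem_union, Set.mem_ofPred_eq, not_or, not_not] at hx
  exact hW (h𝒲.eq_of_mem W.2 (s.2.isOrientation W) (t.2.isOrientation W) hx.1 hx.2)

/-- If the 1-cube is given by a set `F` of free walls, then changing `s` to agree with `t` on just
one wall already yields an element of the pair, which must be `t`. -/
theorem adj_iff (h𝒲 : IsHalving 𝒲) (s t : (dualComplex 𝒲).V) :
    (dualComplex 𝒲).graph.Adj s t ↔ s ≠ t ∧ ∃ W, ∀ W', W' ≠ W → s.1 W' = t.1 W' := by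
  classical
  refine and_congr_right fun hne => ⟨?_, ?_⟩
  · rintro ⟨r, F, hF, hor, hst⟩
    obtain ⟨W, hW⟩ : ∃ W, s.1 W ≠ t.1 W := by
      by_contra! h
      exact hne (Subtype.ext (funext h))
    have hs : s ∈ {t : (dualComplex 𝒲).V | ∀ W, W ∉ F → t.1 W = r.1 W} := hst ▸ .inl rfl
    have ht : t ∈ {t : (dualComplex 𝒲).V | ∀ W, W ∉ F → t.1 W = r.1 W} := hst ▸ .inr rfl
    have hWF : W ∈ F := by
      by_contra h
      exact hW ((hs W h).trans (ht W h).symm)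
    have hup : ∀ W', W' ∉ F → Function.update s.1 W (t.1 W) W' = r.1 W' := by
      intro W' hW'
      rw [Function.update_of_ne (fun h : W' = W => hW' (h ▸ hWF))]
      exact hs W' hW'
    have hz := hor _ (fun W' => by
      by_cases h : W' = W
      · subst h
        rw [Function.update_self]
        exact t.2.isOrientation _
      · rw [Function.update_of_ne h]
        exact s.2.isOrientation _) hup
    have hmem : (⟨_, hz⟩ : (dualComplex 𝒲).V) ∈ ({s, t} : Set (dualComplex 𝒲).V) := by
      rw [hst]
      exact hup
    rcases hmem with h | h
    · have := congrFun (congrArg Subtype.val h) W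
      simp only [Function.update_self] at this
      exact absurd this.symm hW
    · refine ⟨W, fun W' hW' => ?_⟩
      have := congrFun (congrArg Subtype.val h) W'
      simp only [Function.update_of_ne hW'] at this
      exact this
  · rintro ⟨W, hW⟩
    have hW0 : s.1 W ≠ t.1 W := by
      intro h
      refine hne (Subtype.ext (funext fun W' => ?_))
      by_cases h' : W' = W
      · rw [h', h]
      · exact hW W' h'
    have key : ∀ r : 𝒲 → Set X, IsOrientation 𝒲 r → (∀ W', W' ≠ W → r W' = s.1 W') →
        r = s.1 ∨ r = t.1 := by
      intro r hr hrs
      by_cases h : r W = s.1 W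
      · left
        funext W'
        by_cases h' : W' = W
        · rw [h', h]
        · exact hrs W' h'
      · right
        funext W'
        by_cases h' : W' = W
        · rw [h', h𝒲.eq_compl W.2 (s.2.isOrientation W) (hr W) (Ne.symm h),
            h𝒲.eq_compl W.2 (s.2.isOrientation W) (t.2.isOrientation W) hW0]
        · rw [hrs W' h', hW W' h']
    refine ⟨s, {W}, Set.finite_singleton W, fun r hr hrs => ?_, ?_⟩
    · rcases key r hr hrs with rfl | rfl
      exacts [s.2, t.2]
    · ext r
      constructor
      · rintro (rfl | rfl)
        · exact fun _ _ => rfl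
        · exact fun W' hW' => (hW W' hW').symm
      · intro hr
        rcases key r.1 r.2.isOrientation hr with h | h
        · exact .inl (Subtype.ext h)
        · exact .inr (Subtype.ext h)

/-- Two different 0-cubes: the first one has a neighbour closer to the second one. -/
theorem exists_flip (h𝒲 : IsHalving 𝒲) [hX : Nonempty X] (s t : (dualComplex 𝒲).V) (hne : s ≠ t) :
    ∃ (r : (dualComplex 𝒲).V) (W : 𝒲), (dualComplex 𝒲).graph.Adj s r ∧ W ∈ diff s t ∧
      diff r t = diff s t \ {W} := by
  classical
  have hD : (diff s t).Nonempty := by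
    by_contra h
    rw [Set.not_nonempty_iff_eq_empty] at h
    refine hne (Subtype.ext (funext fun W => ?_))
    by_contra hW
    have : W ∈ diff s t := hW
    rw [h] at this
    exact this
  -- A minimal halfspace of `s` among the walls of difference can be reversed: if its complement
  -- missed another halfspace of `s` on such a wall, that one would be contained in it.
  obtain ⟨W, hW, hmin⟩ := (h𝒲.diff_finite s t).exists_minimalFor s.1 _ hD
  have hWc := h𝒲.eq_compl W.2 (s.2.isOrientation W) (t.2.isOrientation W) hW
  have hmeet : ∀ W', W' ≠ W → (t.1 W ∩ s.1 W').Nonempty := by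
    intro W' hW'
    by_cases h : W' ∈ diff s t
    · by_contra hem
      rw [Set.not_nonempty_iff_eq_empty, hWc, ← Set.disjoint_iff_inter_eq_empty,
        Set.disjoint_compl_left_iff_subset] at hem
      have := (hmin h hem).antisymm hem
      exact hW' (h𝒲.wall_eq (s.2.isOrientation W') (this ▸ s.2.isOrientation W))
    · have h' : s.1 W' = t.1 W' := not_not.1 h
      rw [h']
      exact t.2.inter_nonempty W W'
  have hz : IsZeroCube 𝒲 (Function.update s.1 W (t.1 W)) := by
    refine ⟨fun W' => ?_, fun W₁ W₂ => ?_, fun x => ?_⟩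
    · by_cases h : W' = W
      · subst h
        rw [Function.update_self]
        exact t.2.isOrientation _
      · rw [Function.update_of_ne h]
        exact s.2.isOrientation _
    · by_cases h1 : W₁ = W
      · subst h1
        by_cases h2 : W₂ = W₁
        · subst h2
          rw [Function.update_self]
          exact t.2.inter_nonempty _ _
        · rw [Function.update_self, Function.update_of_ne h2]
          exact hmeet W₂ h2
      · by_cases h2 : W₂ = W
        · subst h2
          rw [Function.update_self, Function.update_of_ne h1, Set.inter_comm]
          exact hmeet W₁ h1
        · rw [Function.update_of_ne h1, Function.update_of_ne h2]
          exact s.2.inter_nonempty _ _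
    · refine ((s.2.finite x).insert W).subset fun W' hW' => ?_
      by_cases h : W' = W
      · exact .inl h
      · right
        simpa [Function.update_of_ne h] using hW'
  refine ⟨⟨_, hz⟩, W, (h𝒲.adj_iff _ _).2 ⟨fun h => ?_, W, fun W' hW' => ?_⟩, hW, ?_⟩
  · have := congrFun (congrArg Subtype.val h) W
    simp only [Function.update_self] at this
    exact hW this
  · simp only [Function.update_of_ne hW']
  · ext W'
    by_cases h : W' = W
    · subst h
      simp [diff]
    · simp [diff, h]

end IsHalving

namespace CubeData.CubeIso

variable {X : Type u} {𝒲 : Set (Set (Set X))} {Z : CubeData.{u}} (φ : CubeIso Z (dualComplex 𝒲))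

theorem adj_iff {K L : CubeData.{u}} (φ : CubeIso K L) {x y : K.V} :
    L.graph.Adj (φ.toEquiv x) (φ.toEquiv y) ↔ K.graph.Adj x y := by
  change (φ.toEquiv x ≠ φ.toEquiv y ∧ _) ↔ (x ≠ y ∧ _)
  rw [← Set.image_pair, φ.mem_cubes_iff, φ.toEquiv.injective.ne_iff]

/-- Each edge changes only one wall, and by `exists_flip` the walls of difference can be removed one
at a time. -/
theorem dist_eq_ncard [Nonempty X] (h𝒲 : IsHalving 𝒲) (hZ : Z.graph.Connected) (u v : Z.V) :
    Z.graph.dist u v = (IsHalving.diff (φ.toEquiv u) (φ.toEquiv v)).ncard := by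
  apply le_antisymm
  · induction hn : (IsHalving.diff (φ.toEquiv u) (φ.toEquiv v)).ncard generalizing u with
    | zero =>
      by_cases huv : u = v
      · simp [huv]
      · obtain ⟨r, W, -, hW, -⟩ := h𝒲.exists_flip _ _ (φ.toEquiv.injective.ne huv)
        rw [Set.ncard_eq_zero (h𝒲.diff_finite _ _)] at hn
        rw [hn] at hW
        exact absurd hW (Set.notMem_empty _)
    | succ n ih =>
      have huv : u ≠ v := by
        rintro rfl
        simp [IsHalving.diff] at hn
      obtain ⟨r, W, hr, hW, hd⟩ := h𝒲.exists_flip _ _ (φ.toEquiv.injective.ne huv)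
      obtain ⟨u', rfl⟩ := φ.toEquiv.surjective r
      rw [φ.adj_iff] at hr
      have h1 := ih u' (by rw [hd, Set.ncard_sdiff_singleton_of_mem hW, hn]; rfl)
      have h2 := CubeData.dist_adj_le hZ v hr.symm
      rw [SimpleGraph.dist_comm, SimpleGraph.dist_comm (u := v)] at h2
      omega
  · obtain ⟨p, hp⟩ := hZ.exists_walk_length_eq_dist u v
    rw [← hp]
    clear hp
    induction p with
    | nil => simp [IsHalving.diff]
    | @cons a b c hab p ih =>
      rw [SimpleGraph.Walk.length_cons]
      obtain ⟨-, W, hW⟩ := (h𝒲.adj_iff _ _).1 (φ.adj_iff.2 hab)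
      refine (Set.ncard_le_ncard (t := insert W (IsHalving.diff (φ.toEquiv b) (φ.toEquiv c)))
        (fun W' hW' => ?_) ((h𝒲.diff_finite _ _).insert W)).trans
        ((Set.ncard_insert_le _ _).trans (by omega))
      by_cases h : W' = W
      · exact .inl h
      · right
        change _ ≠ _
        rw [← hW W' h]
        exact hW'

theorem mem_half_iff [Nonempty X] (h𝒲 : IsHalving 𝒲) (hZ : Z.graph.Connected) {v w : Z.V}
    {W : 𝒲} (hvw : Z.graph.Adj v w) (hW : (φ.toEquiv v).1 W ≠ (φ.toEquiv w).1 W) (u : Z.V) :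
    u ∈ Z.half v w ↔ (φ.toEquiv u).1 W = (φ.toEquiv v).1 W := by
  have hWc := h𝒲.eq_compl W.2 ((φ.toEquiv v).2.isOrientation W)
    ((φ.toEquiv w).2.isOrientation W) hW
  obtain ⟨-, W₀, hW₀⟩ := (h𝒲.adj_iff _ _).1 (φ.adj_iff.2 hvw)
  obtain rfl : W = W₀ := by
    by_contra h
    exact hW (hW₀ W h)
  have aux : ∀ {v w : Z.V}, (φ.toEquiv v).1 W ≠ (φ.toEquiv w).1 W →
      (∀ W', W' ≠ W → (φ.toEquiv v).1 W' = (φ.toEquiv w).1 W') →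
      (φ.toEquiv u).1 W = (φ.toEquiv v).1 W → Z.graph.dist u w = Z.graph.dist u v + 1 := by
    intro v w h1 h2 h3
    rw [φ.dist_eq_ncard h𝒲 hZ, φ.dist_eq_ncard h𝒲 hZ,
      ← Set.ncard_insert_of_notMem (a := W)
        (s := IsHalving.diff (φ.toEquiv u) (φ.toEquiv v)) (fun h => h h3) (h𝒲.diff_finite _ _)]
    congr 1
    ext W'
    by_cases h : W' = W
    · subst h
      simp only [IsHalving.diff, Set.mem_ofPred_eq, Set.mem_insert_iff, true_or, iff_true]
      rwa [h3]
    · simp [IsHalving.diff, h, h2 W' h]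
  rw [CubeData.mem_half]
  constructor
  · intro h
    by_contra hne
    have h1 := h𝒲.eq_compl W.2 ((φ.toEquiv v).2.isOrientation W)
      ((φ.toEquiv u).2.isOrientation W) (Ne.symm hne)
    have := aux hW.symm (fun W' h => (hW₀ W' h).symm) (h1.trans hWc.symm)
    omega
  · intro h
    have := aux hW hW₀ h
    omega

end CubeData.CubeIso

theorem CubeData.IsCAT0.wall_eq_pair {K : CubeData.{u}} (hK : K.IsCAT0) {a b : K.V}
    (h : K.graph.Adj a b) : K.wall a b = {K.half a b, (K.half a b)ᶜ} := by
  rw [hK.isModular.half_compl h]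
  rfl

theorem CubeData.IsCAT0.isHalving {K : CubeData.{u}} (hK : K.IsCAT0) {𝒲 : Set (Set (Set K.V))}
    (h : 𝒲 ⊆ K.walls) : IsHalving 𝒲 := by
  intro W hW
  have := h hW
  rw [hK.walls_eq] at this
  obtain ⟨a, b, hab, rfl⟩ := this
  exact ⟨_, hK.wall_eq_pair hab⟩

/-! ### Restriction quotients pull halfspaces back to halfspaces. -/

namespace CubicalMap

variable {Y Z : CCC.{u}}

/-- The map is surjective and preimages of halfspaces are halfspaces. -/
structure PullsBackWalls (q : CubicalMap Y Z) : Prop where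
  surjective : Function.Surjective q.toFun
  exists_half : ∀ {v w : Z.toCubeData.V}, Z.toCubeData.graph.Adj v w →
    ∃ a b, Y.toCubeData.graph.Adj a b ∧
      q.toFun ⁻¹' Z.toCubeData.half v w = Y.toCubeData.half a b

/-- The halfspaces chosen by a 0-cube have a common vertex by the Helly property, which gives
surjectivity. An edge of `Z` flips a single wall of 𝒦, and the preimage of its halfspace is the
halfspace chosen there. -/
theorem IsRestrictionQuotient.pullsBackWalls {q : CubicalMap Y Z} (hq : q.IsRestrictionQuotient) :
    q.PullsBackWalls := by
  obtain ⟨𝒦, h𝒦, φ, hφ⟩ := hq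
  have hH := Y.isCAT0.isHalving h𝒦
  have hYc := Y.isCAT0.isSimplyConnected.connected
  have hZc := Z.isCAT0.isSimplyConnected.connected
  have := hYc.nonempty
  have hhalf : ∀ W : 𝒦, ∀ U ∈ W.1, ∃ a b, Y.toCubeData.graph.Adj a b ∧
      U = Y.toCubeData.half a b := by
    intro W U hU
    have hW := h𝒦 W.2
    rw [Y.isCAT0.walls_eq] at hW
    obtain ⟨a, b, hab, hW⟩ := hW
    rw [hW] at hU
    rcases hU with rfl | rfl
    · exact ⟨a, b, hab, rfl⟩
    · exact ⟨b, a, hab.symm, rfl⟩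
  refine ⟨fun z => ?_, fun {v w} hvw => ?_⟩
  · obtain ⟨x⟩ := hYc.nonempty
    obtain ⟨y, hy⟩ := CubeData.IsCAT0.helly Y.isCAT0.isModular (φ.toEquiv z).1 (fun W => by
      obtain ⟨a, b, hab, h⟩ := hhalf W _ ((φ.toEquiv z).2.isOrientation W)
      rw [h]
      exact Y.isCAT0.half_convex hab) (φ.toEquiv z).2.inter_nonempty x ((φ.toEquiv z).2.finite x)
    refine ⟨y, φ.toEquiv.injective (Subtype.ext (funext fun W => ?_))⟩
    exact hH.eq_of_mem W.2 ((φ.toEquiv _).2.isOrientation W) ((φ.toEquiv z).2.isOrientation W)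
      (hφ y W) (hy W)
  · obtain ⟨W, hW⟩ : ∃ W, (φ.toEquiv v).1 W ≠ (φ.toEquiv w).1 W := by
      by_contra! h
      exact hvw.ne (φ.toEquiv.injective (Subtype.ext (funext h)))
    obtain ⟨a, b, hab, h⟩ := hhalf W _ ((φ.toEquiv v).2.isOrientation W)
    refine ⟨a, b, hab, ?_⟩
    rw [← h]
    ext y
    rw [Set.mem_preimage, φ.mem_half_iff hH hZc hvw hW]
    constructor
    · intro h'
      exact h' ▸ hφ y W
    · intro hy
      exact hH.eq_of_mem W.2 ((φ.toEquiv _).2.isOrientation W) ((φ.toEquiv v).2.isOrientation W)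
        (hφ y W) hy

end CubicalMap

/-! ### Maps that pull back halfspaces are restriction quotients. -/

namespace CubicalMap

variable {Y Z : CCC.{u}} (q : CubicalMap Y Z)

/-- The preimage of the wall of an edge of the target. -/
def pullWall (v w : Z.toCubeData.V) : Set (Set Y.toCubeData.V) :=
  {q.toFun ⁻¹' Z.toCubeData.half v w, q.toFun ⁻¹' Z.toCubeData.half w v}

/-- The preimages of the walls of the target. -/
def pullWalls : Set (Set (Set Y.toCubeData.V)) :=
  {W | ∃ v w, Z.toCubeData.graph.Adj v w ∧ W = q.pullWall v w}

theorem pullWall_comm (v w : Z.toCubeData.V) : q.pullWall v w = q.pullWall w v :=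
  Set.pair_comm _ _

theorem exists_side (z : Z.toCubeData.V) (W : q.pullWalls) : ∃ v w, Z.toCubeData.graph.Adj v w ∧
    W.1 = q.pullWall v w ∧ z ∈ Z.toCubeData.half v w := by
  obtain ⟨v, w, h, hW⟩ := W.2
  by_cases hz : z ∈ Z.toCubeData.half v w
  · exact ⟨v, w, h, hW, hz⟩
  · exact ⟨w, v, h.symm, hW.trans (q.pullWall_comm v w),
      (Z.isCAT0.isModular.notMem_half_iff h).1 hz⟩

/-- The side of a pulled back wall that lies over `z`. -/
noncomputable def side (z : Z.toCubeData.V) (W : q.pullWalls) : Set Y.toCubeData.V :=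
  q.toFun ⁻¹' Z.toCubeData.half (q.exists_side z W).choose (q.exists_side z W).choose_spec.choose

theorem side_spec (z : Z.toCubeData.V) (W : q.pullWalls) : ∃ v w, Z.toCubeData.graph.Adj v w ∧
    W.1 = q.pullWall v w ∧ z ∈ Z.toCubeData.half v w ∧
    q.side z W = q.toFun ⁻¹' Z.toCubeData.half v w :=
  have h := (q.exists_side z W).choose_spec.choose_spec
  ⟨_, _, h.1, h.2.1, h.2.2, rfl⟩

theorem isHalving_pullWalls : IsHalving q.pullWalls := by
  rintro _ ⟨v, w, h, rfl⟩
  refine ⟨q.toFun ⁻¹' Z.toCubeData.half v w, ?_⟩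
  rw [← Set.preimage_compl, Z.isCAT0.isModular.half_compl h]
  rfl

theorem side_mem (z : Z.toCubeData.V) (W : q.pullWalls) : q.side z W ∈ W.1 := by
  obtain ⟨v, w, -, hW, -, h⟩ := q.side_spec z W
  rw [hW, h]
  exact .inl rfl

theorem mem_side (y : Y.toCubeData.V) (W : q.pullWalls) : y ∈ q.side (q.toFun y) W := by
  obtain ⟨v, w, -, -, hz, h⟩ := q.side_spec (q.toFun y) W
  rw [h]
  exact hz

theorem side_eq {y : Y.toCubeData.V} {W : q.pullWalls} {U : Set Y.toCubeData.V} (hU : U ∈ W.1)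
    (hy : y ∈ U) : q.side (q.toFun y) W = U :=
  q.isHalving_pullWalls.eq_of_mem W.2 (q.side_mem _ _) hU (q.mem_side y W) hy

theorem eq_pullWall_of_side_ne {v w : Z.toCubeData.V} (hvw : Z.toCubeData.graph.Adj v w)
    (hs : Function.Surjective q.toFun) {W : q.pullWalls} (h : q.side v W ≠ q.side w W) :
    W.1 = q.pullWall v w := by
  obtain ⟨a, b, hab, hW, hv, hside⟩ := q.side_spec v W
  have hw : w ∉ Z.toCubeData.half a b := by
    intro hw
    obtain ⟨y, rfl⟩ := hs w
    exact h (hside.trans (q.side_eq (by rw [hW]; exact .inl rfl) hw).symm)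
  have h1 := Z.isCAT0.half_eq_of_cross hab hvw hv hw
  have h2 : Z.toCubeData.half w v = Z.toCubeData.half b a := by
    rw [← Z.isCAT0.isModular.half_compl hvw, ← Z.isCAT0.isModular.half_compl hab, h1]
  rw [hW, pullWall, pullWall, h1, h2]

theorem side_finite (hs : Function.Surjective q.toFun) (z z' : Z.toCubeData.V) :
    {W | q.side z W ≠ q.side z' W}.Finite := by
  obtain ⟨p⟩ := Z.isCAT0.isSimplyConnected.connected.preconnected z z'
  induction p with
  | nil => simp
  | @cons a b c hab p ih =>
    have hf : {W : q.pullWalls | W.1 = q.pullWall a b}.Finite :=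
      Set.Subsingleton.finite fun W hW W' hW' => Subtype.ext (hW.trans hW'.symm)
    refine (hf.union ih).subset fun W hW => ?_
    by_cases h : q.side a W = q.side b W
    · right
      change _ ≠ _
      rw [← h]
      exact hW
    · exact .inl (q.eq_pullWall_of_side_ne hab hs h)

theorem isZeroCube_side (hs : Function.Surjective q.toFun) (z : Z.toCubeData.V) :
    IsZeroCube q.pullWalls (q.side z) := by
  obtain ⟨y, rfl⟩ := hs z
  refine ⟨q.side_mem _, fun W W' => ⟨y, q.mem_side y W, q.mem_side y W'⟩, fun x => ?_⟩
  refine (q.side_finite hs (q.toFun x) (q.toFun y)).subset fun W hW h => hW ?_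
  rw [← h]
  exact q.mem_side x W

variable {q}

theorem mem_side_iff (hs : Function.Surjective q.toFun) {v w z : Z.toCubeData.V}
    {W : q.pullWalls} (hW : W.1 = q.pullWall v w) :
    q.side z W = q.toFun ⁻¹' Z.toCubeData.half v w ↔ z ∈ Z.toCubeData.half v w := by
  obtain ⟨y, rfl⟩ := hs z
  constructor
  · intro h
    have := q.mem_side y W
    rwa [h] at this
  · intro h
    exact q.side_eq (by rw [hW]; exact .inl rfl) h

theorem side_injective (hs : Function.Surjective q.toFun) {z z' : Z.toCubeData.V}
    (h : q.side z = q.side z') : z = z' := by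
  by_contra hne
  obtain ⟨t, ht, hd⟩ := CubeData.exists_closer Z.isCAT0.isSimplyConnected.connected hne
  have h1 := mem_side_iff hs (z := z) (W := ⟨_, t, z', ht, rfl⟩) rfl
  have h2 := mem_side_iff hs (z := z') (W := ⟨_, t, z', ht, rfl⟩) rfl
  rw [h] at h1
  have h3 := h2.1 (h1.2 ((Z.isCAT0.isModular.mem_half_iff ht).2 hd))
  exact (Z.isCAT0.isModular.notMem_half_iff ht).2 (CubeData.left_mem_half ht.symm) h3

/-- The images in `Z` of the chosen sides are halfspaces that pairwise meet, so the Helly property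
of `Z` gives the vertex. -/
theorem exists_side_eq (hs : Function.Surjective q.toFun) {s : q.pullWalls → Set Y.toCubeData.V}
    (h : IsZeroCube q.pullWalls s) : ∃ z, q.side z = s := by
  obtain ⟨x⟩ := Y.isCAT0.isSimplyConnected.connected.nonempty
  have hhalf : ∀ W, ∃ v w, Z.toCubeData.graph.Adj v w ∧
      s W = q.toFun ⁻¹' Z.toCubeData.half v w := by
    intro W
    obtain ⟨v, w, hvw, hW⟩ := W.2
    have := h.isOrientation W
    rw [hW] at this
    rcases this with h | h
    · exact ⟨v, w, hvw, h⟩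
    · exact ⟨w, v, hvw.symm, h⟩
  obtain ⟨z, hz⟩ := CubeData.IsCAT0.helly Z.isCAT0.isModular (fun W => q.toFun '' s W)
    (fun W => by
      obtain ⟨v, w, hvw, hW⟩ := hhalf W
      simp only [hW, Set.image_preimage_eq _ hs]
      exact Z.isCAT0.half_convex hvw)
    (fun W W' => by
      obtain ⟨y, hy, hy'⟩ := h.inter_nonempty W W'
      exact ⟨q.toFun y, ⟨y, hy, rfl⟩, ⟨y, hy', rfl⟩⟩)
    (q.toFun x) ((h.finite x).subset fun W hW hx => hW ⟨x, hx, rfl⟩)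
  refine ⟨z, funext fun W => ?_⟩
  obtain ⟨y, hy, rfl⟩ := hz W
  exact q.side_eq (h.isOrientation W) hy

/-- The bijection from the vertices of the target to the 0-cubes of the pulled back walls. -/
noncomputable def sideEquiv (hs : Function.Surjective q.toFun) :
    Z.toCubeData.V ≃ (dualComplex q.pullWalls).V :=
  Equiv.ofBijective (fun z => ⟨q.side z, q.isZeroCube_side hs z⟩)
    ⟨fun _ _ h => side_injective hs (congrArg Subtype.val h), fun s => by
      obtain ⟨z, hz⟩ := exists_side_eq hs s.2
      exact ⟨z, Subtype.ext hz⟩⟩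

/-- The walls to be re-oriented freely are those dual to the edges at one corner. Every edge of the
cube is dual to one of them, and a choice of sides on them is the choice of a corner. -/
theorem sideEquiv_image_mem_cubes (hs : Function.Surjective q.toFun) {S : Set Z.toCubeData.V}
    (hS : S ∈ Z.toCubeData.cubes) : sideEquiv hs '' S ∈ (dualComplex q.pullWalls).cubes := by
  classical
  obtain ⟨n, e, he⟩ := Z.isCAT0.isCubeComplex.exists_chart S hS
  let o : Fin n → Bool := fun _ => false
  let Wi : Fin n → q.pullWalls := fun i =>
    ⟨q.pullWall (e o) (e (flipAt i o)), _, _, he.adj_flipAt o i, rfl⟩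
  have hout : ∀ (x : Fin n → Bool) (W : q.pullWalls), W ∉ Set.range Wi →
      q.side (e x) W = q.side (e o) W := by
    intro x W hW
    refine bool_cube_step (fun x => q.side (e x) W = q.side (e o) W) o rfl ?_ x
    intro x i hx
    rw [← hx]
    by_contra hne
    have h1 := q.eq_pullWall_of_side_ne (he.adj_flipAt x i) hs (Ne.symm hne)
    refine hW ⟨i, Subtype.ext ?_⟩
    rw [h1]
    change q.pullWall _ _ = _
    have a1 := Z.isCAT0.half_chart he o x i
    have c1 := Z.isCAT0.isModular.half_compl (he.adj_flipAt o i)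
    have c2 := Z.isCAT0.isModular.half_compl (he.adj_flipAt x i)
    have c3 := Z.isCAT0.isModular.half_compl (he.adj_flipAt x i).symm
    by_cases hxi : x i = o i
    · rw [pullWall, pullWall, ← c1, ← c2, a1.1 hxi]
    · rw [q.pullWall_comm (e x), pullWall, pullWall, ← c1, ← c3, a1.2 hxi]
  have key : ∀ t : q.pullWalls → Set Y.toCubeData.V, IsOrientation q.pullWalls t →
      (∀ W, W ∉ Set.range Wi → t W = q.side (e o) W) → ∃ x, t = q.side (e x) := by
    intro t ht hto
    refine ⟨fun i => if t (Wi i) = q.side (e o) (Wi i) then o i else !o i, funext fun W => ?_⟩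
    by_cases hW : W ∈ Set.range Wi
    · obtain ⟨i, rfl⟩ := hW
      have h0 : q.side (e o) (Wi i) = q.toFun ⁻¹' Z.toCubeData.half (e o) (e (flipAt i o)) :=
        (mem_side_iff hs rfl).2 (CubeData.left_mem_half (he.adj_flipAt o i))
      by_cases hi : t (Wi i) = q.side (e o) (Wi i)
      · rw [hi, h0]
        symm
        rw [mem_side_iff hs rfl, Z.isCAT0.mem_half_chart he]
        simp [hi]
      · rw [q.isHalving_pullWalls.eq_compl (Wi i).2 (q.side_mem _ _) (ht (Wi i)) (Ne.symm hi)]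
        symm
        refine q.isHalving_pullWalls.eq_compl (Wi i).2 (q.side_mem _ _) (q.side_mem _ _) fun h => ?_
        rw [h0] at h
        have h2 := (mem_side_iff hs rfl).1 h.symm
        rw [Z.isCAT0.mem_half_chart he] at h2
        simp [hi] at h2
    · rw [hout _ W hW, hto W hW]
  refine ⟨sideEquiv hs (e o), Set.range Wi, Set.finite_range _, fun t ht hto => ?_, ?_⟩
  · obtain ⟨x, rfl⟩ := key t ht hto
    exact q.isZeroCube_side hs _
  · ext t
    constructor
    · rintro ⟨z, hz, rfl⟩ W hW
      obtain ⟨x, rfl⟩ := he.exists_eq hz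
      exact hout x W hW
    · intro ht
      obtain ⟨x, hx⟩ := key t.1 t.2.isOrientation ht
      exact ⟨e x, he.mem x, Subtype.ext hx.symm⟩

/-- The re-orientations of the free walls form an embedded cube graph in `Z`, which is filled by
`range_mem_cubes`. -/
theorem mem_cubes_of_sideEquiv_image (hs : Function.Surjective q.toFun) {S : Set Z.toCubeData.V}
    (hS : sideEquiv hs '' S ∈ (dualComplex q.pullWalls).cubes) : S ∈ Z.toCubeData.cubes := by
  classical
  obtain ⟨s, F, hF, hor, hSF⟩ := hS
  have hFf := hF.to_subtype
  obtain ⟨n, ⟨f⟩⟩ := Finite.exists_equiv_fin F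
  have hH := q.isHalving_pullWalls
  let t : (Fin n → Bool) → q.pullWalls → Set Y.toCubeData.V := fun x W =>
    if h : W ∈ F then (if x (f ⟨W, h⟩) then s.1 W else (s.1 W)ᶜ) else s.1 W
  have htor : ∀ x, IsOrientation q.pullWalls (t x) := by
    intro x W
    simp only [t]
    split_ifs
    · exact s.2.isOrientation W
    · exact hH.compl_mem W.2 (s.2.isOrientation W)
    · exact s.2.isOrientation W
  have htF : ∀ x W, W ∉ F → t x W = s.1 W := fun x W hW => dif_neg hW
  have htz : ∀ x, IsZeroCube q.pullWalls (t x) := fun x => hor _ (htor x) (htF x)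
  have hne : ∀ W : q.pullWalls, s.1 W ≠ (s.1 W)ᶜ := by
    intro W h
    obtain ⟨x, hx, -⟩ := s.2.inter_nonempty W W
    have hx' := hx
    rw [h] at hx'
    exact hx' hx
  have ht_iff : ∀ x i, t x (f.symm i).1 = s.1 (f.symm i).1 ↔ x i = true := by
    intro x i
    simp only [t, dif_pos (f.symm i).2, Subtype.coe_eta, Equiv.apply_symm_apply]
    by_cases hxi : x i = true
    · simp [hxi]
    · simp [hxi, (hne _).symm]
  let e : (Fin n → Bool) → Z.toCubeData.V := fun x => (sideEquiv hs).symm ⟨t x, htz x⟩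
  have he : ∀ x, (sideEquiv hs (e x)).1 = t x := fun x =>
    congrArg Subtype.val ((sideEquiv hs).apply_symm_apply ⟨t x, htz x⟩)
  have hinj : Function.Injective e := by
    intro x y hxy
    have h := (he x).symm.trans ((congrArg (fun z => (sideEquiv hs z).1) hxy).trans (he y))
    funext i
    rw [Bool.eq_iff_iff, ← ht_iff, ← ht_iff, h]
  have hadj : ∀ x i, Z.toCubeData.graph.Adj (e x) (e (flipAt i x)) := by
    intro x i
    have hneq : e x ≠ e (flipAt i x) := fun h => flipAt_ne i x (hinj h).symm
    -- Two vertices that differ on one wall are adjacent: the first step `a` from one towards the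
    -- other crosses a wall that separates them, necessarily the only one, so `a` has the same sides
    -- as the other vertex.
    obtain ⟨a, ha, hd⟩ := CubeData.exists_closer Z.isCAT0.isSimplyConnected.connected hneq
    have hagree : ∀ W, W ≠ (f.symm i).1 → q.side (e x) W = q.side (e (flipAt i x)) W := by
      intro W hW
      change (sideEquiv hs _).1 W = (sideEquiv hs _).1 W
      rw [he, he]
      simp only [t]
      by_cases hWF : W ∈ F
      · have : f ⟨W, hWF⟩ ≠ i := by
          rintro rfl
          exact hW (by simp)
        simp only [dif_pos hWF, flipAt_of_ne this]
      · simp only [dif_neg hWF]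
    have hside : ∀ {v w : Z.toCubeData.V} (hvw : Z.toCubeData.graph.Adj v w),
        e x ∈ Z.toCubeData.half v w → e (flipAt i x) ∉ Z.toCubeData.half v w →
        (f.symm i).1.1 = q.pullWall v w := by
      intro v w hvw h1 h2
      by_contra hW
      have := hagree ⟨_, v, w, hvw, rfl⟩ fun h => hW (congrArg Subtype.val h).symm
      rw [(mem_side_iff hs rfl).2 h1] at this
      exact h2 ((mem_side_iff hs rfl).1 this.symm)
    have hax : e x ∈ Z.toCubeData.half a (e (flipAt i x)) :=
      (Z.isCAT0.isModular.mem_half_iff ha).2 hd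
    have hay : e (flipAt i x) ∉ Z.toCubeData.half a (e (flipAt i x)) :=
      (Z.isCAT0.isModular.notMem_half_iff ha).2 (CubeData.left_mem_half ha.symm)
    have hWa := hside ha hax hay
    suffices h : e x = a from h ▸ ha
    apply side_injective hs
    funext W
    by_cases hW : W = (f.symm i).1
    · have hW' : W.1 = q.pullWall a (e (flipAt i x)) := hW ▸ hWa
      rw [(mem_side_iff hs hW').2 hax, (mem_side_iff hs hW').2 (CubeData.left_mem_half ha)]
    · rw [hagree W hW]
      by_contra h
      exact hW (Subtype.ext ((q.eq_pullWall_of_side_ne ha hs (Ne.symm h)).trans hWa.symm))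
  have hrange : S = Set.range e := by
    apply (sideEquiv hs).injective.image_injective
    rw [hSF, ← Set.range_comp]
    ext r
    constructor
    · intro hr
      obtain ⟨x, hx⟩ : ∃ x : Fin n → Bool, ∀ i, x i = true ↔
          r.1 (f.symm i).1 = s.1 (f.symm i).1 :=
        ⟨fun i => decide (r.1 (f.symm i).1 = s.1 (f.symm i).1), fun i => decide_eq_true_iff⟩
      refine ⟨x, Subtype.ext ((he x).trans (funext fun W => ?_))⟩
      by_cases hW : W ∈ F
      · have hxW := hx (f ⟨W, hW⟩)
        rw [Equiv.symm_apply_apply] at hxW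
        simp only [t, dif_pos hW]
        split_ifs with h
        · exact (hxW.1 h).symm
        · exact (hH.eq_compl W.2 (s.2.isOrientation W) (r.2.isOrientation W)
            fun h' => h (hxW.2 h'.symm)).symm
      · exact (htF x W hW).trans (hr W hW).symm
    · rintro ⟨x, rfl⟩ W hW
      exact (congrFun (he x) W).trans (htF x W hW)
  rw [hrange]
  exact Z.isCAT0.range_mem_cubes hinj hadj

theorem PullsBackWalls.isRestrictionQuotient (hq : q.PullsBackWalls) :
    q.IsRestrictionQuotient := by
  refine ⟨q.pullWalls, ?_, ⟨sideEquiv hq.surjective, fun S =>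
    ⟨mem_cubes_of_sideEquiv_image hq.surjective, sideEquiv_image_mem_cubes hq.surjective⟩⟩,
    fun y W => q.mem_side y W⟩
  rintro _ ⟨v, w, hvw, rfl⟩
  obtain ⟨a, b, hab, h⟩ := hq.exists_half hvw
  rw [Y.isCAT0.walls_eq]
  refine ⟨a, b, hab, ?_⟩
  rw [Y.isCAT0.wall_eq_pair hab, ← h, ← Set.preimage_compl, Z.isCAT0.isModular.half_compl hvw]
  rfl

end CubicalMap

/-! ### Fibers of restriction quotients. -/

theorem flipAt_comp_injective {n m : ℕ} {i : Fin m → Fin n} (hi : Function.Injective i) (j : Fin m)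
    (x : Fin n → Bool) : (fun k => flipAt (i j) x (i k)) = flipAt j fun k => x (i k) := by
  funext k
  by_cases h : k = j
  · subst h
    simp
  · rw [flipAt_of_ne h, flipAt_of_ne (hi.ne h)]

namespace CubicalMap

variable {Y Z : CCC.{u}} {q : CubicalMap Y Z}

theorem image_mem_cubes (q : CubicalMap Y Z) {D : Set Y.toCubeData.V}
    (hD : D ∈ Y.toCubeData.cubes) : q.toFun '' D ∈ Z.toCubeData.cubes := by
  obtain ⟨n, m, e, e', i, hi, he, he', hq⟩ := q.cubical D hD
  exact he'.mem_cubes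

theorem eq_or_adj (q : CubicalMap Y Z) {y y' : Y.toCubeData.V}
    (h : Y.toCubeData.graph.Adj y y') :
    q.toFun y = q.toFun y' ∨ Z.toCubeData.graph.Adj (q.toFun y) (q.toFun y') := by
  by_cases hne : q.toFun y = q.toFun y'
  · exact .inl hne
  · right
    refine ⟨hne, ?_⟩
    rw [← Set.image_pair]
    exact q.image_mem_cubes h.2

theorem exists_lift (q : CubicalMap Y Z) {D : Set Y.toCubeData.V} (hD : D ∈ Y.toCubeData.cubes)
    {y : Y.toCubeData.V} (hy : y ∈ D) {w : Z.toCubeData.V} (hw : w ∈ q.toFun '' D)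
    (hadj : Z.toCubeData.graph.Adj (q.toFun y) w) :
    ∃ y' ∈ D, Y.toCubeData.graph.Adj y y' ∧ q.toFun y' = w := by
  obtain ⟨n, m, e, e', i, hi, he, he', hq⟩ := q.cubical D hD
  obtain ⟨x, rfl⟩ := he.exists_eq hy
  obtain ⟨_, hy', rfl⟩ := hw
  obtain ⟨x', rfl⟩ := he.exists_eq hy'
  rw [hq, hq, he'.adj_iff] at hadj
  obtain ⟨j, hj⟩ := hadj
  refine ⟨e (flipAt (i j) x), he.mem _, he.adj_flipAt _ _, ?_⟩
  rw [hq, hq, flipAt_comp_injective hi, hj]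

/-- A coordinate forgotten by the projection would show up as a collapsed edge at `y`. -/
theorem injOn_of_nbrs (q : CubicalMap Y Z) {D : Set Y.toCubeData.V} (hD : D ∈ Y.toCubeData.cubes)
    {y : Y.toCubeData.V} (hy : y ∈ D)
    (h : ∀ y' ∈ Y.toCubeData.nbrs D y, q.toFun y' ≠ q.toFun y) : Set.InjOn q.toFun D := by
  obtain ⟨n, m, e, e', i, hi, he, he', hq⟩ := q.cubical D hD
  obtain ⟨x, rfl⟩ := he.exists_eq hy
  have hsurj : Function.Surjective i := by
    intro k
    by_contra hk
    refine h (e (flipAt k x)) ⟨he.mem _, he.adj_flipAt _ _⟩ ?_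
    rw [hq, hq]
    congr 1
    funext j
    exact flipAt_of_ne (fun hj => hk ⟨j, hj⟩) x
  intro a ha b hb hab
  obtain ⟨xa, rfl⟩ := he.exists_eq ha
  obtain ⟨xb, rfl⟩ := he.exists_eq hb
  rw [hq, hq] at hab
  have := he'.injective hab
  congr 1
  funext k
  obtain ⟨j, rfl⟩ := hsurj k
  exact congrFun this j

namespace PullsBackWalls

theorem preimage_half (hq : q.PullsBackWalls) {y y' : Y.toCubeData.V}
    (h : Y.toCubeData.graph.Adj y y') (h' : Z.toCubeData.graph.Adj (q.toFun y) (q.toFun y')) :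
    q.toFun ⁻¹' Z.toCubeData.half (q.toFun y) (q.toFun y') = Y.toCubeData.half y y' := by
  obtain ⟨a, b, hab, he⟩ := hq.exists_half h'
  rw [he]
  symm
  apply Y.isCAT0.half_eq_of_cross hab h
  · rw [← he]
    exact CubeData.left_mem_half h'
  · rw [← he, Set.mem_preimage, Z.isCAT0.isModular.notMem_half_iff h']
    exact CubeData.left_mem_half h'.symm

theorem preimage_half_convex (hq : q.PullsBackWalls) {v w : Z.toCubeData.V}
    (h : Z.toCubeData.graph.Adj v w) :
    Y.toCubeData.Convex (q.toFun ⁻¹' Z.toCubeData.half v w) := by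
  obtain ⟨a, b, hab, he⟩ := hq.exists_half h
  rw [he]
  exact Y.isCAT0.half_convex hab

/-- Both lifts lie across the wall of the edge from `y` to `y₁`, and a vertex has at most one
neighbour across a wall. -/
theorem lift_unique (hq : q.PullsBackWalls) {y y₁ y₂ : Y.toCubeData.V}
    (h1 : Y.toCubeData.graph.Adj y y₁) (h2 : Y.toCubeData.graph.Adj y y₂)
    (h : Z.toCubeData.graph.Adj (q.toFun y) (q.toFun y₁)) (h' : q.toFun y₁ = q.toFun y₂) :
    y₁ = y₂ := by
  have he := hq.preimage_half h1 h
  refine Y.isCAT0.eq_of_cross h1 h1 h2 (CubeData.left_mem_half h1) ?_ ?_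
  · rw [Y.isCAT0.isModular.notMem_half_iff h1]
    exact CubeData.left_mem_half h1.symm
  · rw [← he, Set.mem_preimage, ← h', Z.isCAT0.isModular.notMem_half_iff h]
    exact CubeData.left_mem_half h.symm

end PullsBackWalls

/-- The vertices over `v` that lie in a cube mapped isomorphically onto `C`. -/
def crossing (q : CubicalMap Y Z) (C : Set Z.toCubeData.V) (v : Z.toCubeData.V) :
    Set Y.toCubeData.V :=
  {y | q.toFun y = v ∧ ∀ w ∈ Z.toCubeData.nbrs C v,
    ∃ y', Y.toCubeData.graph.Adj y y' ∧ q.toFun y' = w}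

namespace PullsBackWalls

theorem exists_isSquare_of_mem_half {K : CubeData.{u}} (hK : K.IsModular) {y a b p : K.V}
    (ha : K.graph.Adj y a) (hb : K.graph.Adj y b) (hab : a ≠ b) (hpa : p ∈ K.half a y)
    (hpb : p ∈ K.half b y) : ∃ t, K.IsSquare y a t b := by
  obtain ⟨w, s, -⟩ := hK.quadrangle p ha.symm hb.symm hab ((hK.mem_half_iff ha.symm).1 hpa)
    ((hK.mem_half_iff hb.symm).1 hpb)
  exact ⟨w, s.rotate.rotate.symm⟩

/-- The edges of `T` at `y` and the lifts of the edges of `C` pairwise span squares, so flagness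
gives `D`. The witness `p` for a square is a vertex beyond both walls: for an edge of `T` to `a` and
a lift, the lift at `a` of the same edge of `C`; for two lifts, any vertex over the fourth corner of
the square in `C`. -/
theorem exists_cube_over (hq : q.PullsBackWalls) {C : Set Z.toCubeData.V}
    (hC : C ∈ Z.toCubeData.cubes) {v : Z.toCubeData.V} (hv : v ∈ C) {T : Set Y.toCubeData.V}
    (hT : T ∈ Y.toCubeData.cubes) (hTN : T ⊆ q.crossing C v) {y : Y.toCubeData.V} (hy : y ∈ T) :
    ∃ D ∈ Y.toCubeData.cubes, T ⊆ D ∧ q.toFun '' D = C ∧ Y.toCubeData.nbrs D y =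
      Y.toCubeData.nbrs T y ∪
        {y' | Y.toCubeData.graph.Adj y y' ∧ q.toFun y' ∈ Z.toCubeData.nbrs C v} := by
  have hYm := Y.isCAT0.isModular
  have hYc := Y.isCAT0.isCubeComplex
  have hZc := Z.isCAT0.isCubeComplex
  have hZm := Z.isCAT0.isModular
  obtain ⟨hyv, hyN⟩ := hTN hy
  set A := {y' | Y.toCubeData.graph.Adj y y' ∧ q.toFun y' ∈ Z.toCubeData.nbrs C v} with hA
  have hAadj : ∀ a ∈ A, Z.toCubeData.graph.Adj (q.toFun y) (q.toFun a) := by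
    intro a ha
    rw [hyv]
    exact ha.2.2
  have hAinj : Set.InjOn q.toFun A := fun a ha b hb hab =>
    hq.lift_unique ha.1 hb.1 (hAadj a ha) hab
  have hAfin : A.Finite := by
    refine Set.Finite.of_finite_image ((hZc.finite hC).subset ?_) hAinj
    rintro _ ⟨a, ha, rfl⟩
    exact ha.2.1
  have hTfin : (Y.toCubeData.nbrs T y).Finite := (hYc.finite hT).subset fun _ h => h.1
  have hpre : ∀ a ∈ A, ∀ p, q.toFun p ∈ Z.toCubeData.half (q.toFun a) v →
      p ∈ Y.toCubeData.half a y := by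
    intro a ha p hp
    rw [← hq.preimage_half ha.1.symm (hAadj a ha).symm, hyv]
    exact hp
  have hmix : ∀ a ∈ Y.toCubeData.nbrs T y, ∀ b ∈ A, a ≠ b → ∃ t, Y.toCubeData.IsSquare y a t b := by
    intro a ha b hb hab
    obtain ⟨hav, haN⟩ := hTN ha.1
    obtain ⟨p, hap, hpb⟩ := haN _ hb.2
    have hpy : p ≠ y := by
      rintro rfl
      exact (hAadj b hb).ne hpb
    refine exists_isSquare_of_mem_half hYm ha.2 hb.1 hab (p := p) ?_ (hpre b hb p ?_)
    · rw [CubeData.mem_half, hYm.dist_eq_two hap.symm ha.2.symm hpy,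
        SimpleGraph.dist_eq_one_iff_adj.2 hap.symm]
      exact one_lt_two
    · rw [hpb]
      exact CubeData.left_mem_half hb.2.2.symm
  obtain ⟨D, hD, hyD, hN⟩ := Y.isCAT0.exists_cube (v := y) (hTfin.union hAfin)
    (by rintro a (ha | ha); exacts [ha.2, ha.1]) (by
      rintro a (ha | ha) b (hb | hb) hab
      · obtain ⟨t, -, ht⟩ := hYc.exists_isSquare hT hy ha hb hab
        exact ⟨t, ht⟩
      · exact hmix a ha b hb hab
      · obtain ⟨t, ht⟩ := hmix b hb a ha hab.symm
        exact ⟨t, ht.symm⟩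
      · have hab' : q.toFun a ≠ q.toFun b := fun h => hab (hAinj ha hb h)
        obtain ⟨t, -, ht⟩ := hZc.exists_isSquare hC hv ha.2 hb.2 hab'
        obtain ⟨p, rfl⟩ := hq.surjective t
        have h2 : Z.toCubeData.graph.dist (q.toFun p) v = 2 :=
          hZm.dist_eq_two ht.bc.symm ht.ab.symm ht.ac_ne.symm
        refine exists_isSquare_of_mem_half hYm ha.1 hb.1 hab (p := p) (hpre a ha p ?_)
          (hpre b hb p ?_)
        · rw [CubeData.mem_half, h2, SimpleGraph.dist_eq_one_iff_adj.2 ht.bc.symm]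
          exact one_lt_two
        · rw [CubeData.mem_half, h2, SimpleGraph.dist_eq_one_iff_adj.2 ht.dc.symm]
          exact one_lt_two)
  refine ⟨D, hD, ?_, ?_, hN⟩
  · refine hYc.subset_of_nbrs_subset hT hD hy hyD fun a ha => ?_
    have : a ∈ Y.toCubeData.nbrs D y := hN ▸ Or.inl ha
    exact this.1
  · refine hZc.eq_of_nbrs_eq (q.image_mem_cubes hD) hC ⟨y, hyD, hyv⟩ hv ?_
    ext w
    constructor
    · rintro ⟨hw, hadj⟩
      obtain ⟨y', hy', hadj', rfl⟩ := q.exists_lift hD hyD hw (hyv.symm ▸ hadj)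
      have : y' ∈ Y.toCubeData.nbrs D y := ⟨hy', hadj'⟩
      rw [hN] at this
      rcases this with h | h
      · exact absurd (hTN h.1).1 hadj.ne'
      · exact h.2
    · intro hw
      obtain ⟨y', hadj', rfl⟩ := hyN w hw
      have : y' ∈ Y.toCubeData.nbrs D y := hN ▸ Or.inr ⟨hadj', hw⟩
      exact ⟨⟨y', this.1, rfl⟩, hw.2⟩

/-- No edge of `E` at `y` is collapsed; its image lifts inside `D`, and lifts at `y` are unique. -/
theorem subset_of_bijOn (hq : q.PullsBackWalls) {C : Set Z.toCubeData.V} {E D : Set Y.toCubeData.V}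
    (hE : E ∈ Y.toCubeData.cubes) (hD : D ∈ Y.toCubeData.cubes) (hEC : Set.BijOn q.toFun E C)
    (hDC : q.toFun '' D = C) {y : Y.toCubeData.V} (hyE : y ∈ E) (hyD : y ∈ D) : E ⊆ D := by
  refine Y.isCAT0.isCubeComplex.subset_of_nbrs_subset hE hD hyE hyD fun y' hy' => ?_
  have hadj : Z.toCubeData.graph.Adj (q.toFun y) (q.toFun y') :=
    (q.eq_or_adj hy'.2).resolve_left fun h => hy'.2.ne (hEC.injOn hyE hy'.1 h)
  obtain ⟨y'', h1, h2, h3⟩ := q.exists_lift hD hyD (hDC ▸ hEC.mapsTo hy'.1) hadj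
  rwa [hq.lift_unique hy'.2 h2 hadj h3.symm]

theorem mem_crossing_of_mem {C : Set Z.toCubeData.V} {D : Set Y.toCubeData.V}
    (hD : D ∈ Y.toCubeData.cubes) (hDC : q.toFun '' D = C) {y : Y.toCubeData.V} (hy : y ∈ D) :
    y ∈ q.crossing C (q.toFun y) := by
  refine ⟨rfl, fun w hw => ?_⟩
  obtain ⟨y', -, h⟩ := q.exists_lift hD hy (hDC ▸ hw.1) hw.2
  exact ⟨y', h⟩

/-- The vertices over `v` are cut out by preimages of halfspaces, which are convex; having a lift of
one edge at `v` means bordering the corresponding wall, which is convex by `boundary_convex`. -/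
theorem crossing_convex (hq : q.PullsBackWalls) (C : Set Z.toCubeData.V) (v : Z.toCubeData.V) :
    Y.toCubeData.Convex (q.crossing C v) := by
  have hZm := Z.isCAT0.isModular
  rintro y₁ ⟨hy₁, hN₁⟩ y₂ ⟨hy₂, hN₂⟩ z hz
  have hzv : q.toFun z = v := by
    by_contra hne
    obtain ⟨t, ht, hd⟩ := CubeData.exists_closer hZm.connected hne
    have h1 : q.toFun z ∈ Z.toCubeData.half v t := hq.preimage_half_convex ht.symm y₁
      (by rw [Set.mem_preimage, hy₁]; exact CubeData.left_mem_half ht.symm) y₂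
      (by rw [Set.mem_preimage, hy₂]; exact CubeData.left_mem_half ht.symm) z hz
    exact (hZm.notMem_half_iff ht.symm).2 ((hZm.mem_half_iff ht).2 hd) h1
  refine ⟨hzv, fun w hw => ?_⟩
  obtain ⟨a, b, hab, he⟩ := hq.exists_half hw.2
  have hwn : w ∉ Z.toCubeData.half v w :=
    (hZm.notMem_half_iff hw.2).2 (CubeData.left_mem_half hw.2.symm)
  have hmem : ∀ {y}, q.toFun y = v → (∃ y', Y.toCubeData.graph.Adj y y' ∧ q.toFun y' = w) →
      y ∈ Y.toCubeData.half a b ∧ ∃ y', Y.toCubeData.graph.Adj y y' ∧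
        y' ∉ Y.toCubeData.half a b := by
    rintro y hy ⟨y', hadj, hy'⟩
    rw [← he]
    refine ⟨?_, y', hadj, ?_⟩
    · rw [Set.mem_preimage, hy]
      exact CubeData.left_mem_half hw.2
    · rwa [Set.mem_preimage, hy']
  obtain ⟨-, z', hadj, hz'⟩ := Y.isCAT0.boundary_convex hab _ (hmem hy₁ (hN₁ w hw)) _
    (hmem hy₂ (hN₂ w hw)) z hz
  rw [← he, Set.mem_preimage] at hz'
  refine ⟨z', hadj, ?_⟩
  have hvz : Z.toCubeData.graph.Adj v (q.toFun z') := by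
    rcases q.eq_or_adj hadj with h | h
    · rw [← h, hzv] at hz'
      exact absurd (CubeData.left_mem_half hw.2) hz'
    · rwa [hzv] at h
  exact Z.isCAT0.eq_of_cross hw.2 hvz hw.2 (CubeData.left_mem_half hw.2) hz' hwn

/-- Let `v'` be the corner of `C` opposite to `v`, let `y'` lie over `v'` and let `y` be a vertex
over `v` closest to `y'`. For a neighbour `w` of `v` in `C`, the median of `y`, `y'` and a vertex
over `w` lies over `w`. By minimality the first step from `y` towards it leaves the fiber, and this
step is a lift of the edge to `w`. -/
theorem crossing_nonempty (hq : q.PullsBackWalls) {C : Set Z.toCubeData.V}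
    (hC : C ∈ Z.toCubeData.cubes) {v : Z.toCubeData.V} (hv : v ∈ C) :
    (q.crossing C v).Nonempty := by
  have hZm := Z.isCAT0.isModular
  have hYm := Y.isCAT0.isModular
  obtain ⟨v', hv'⟩ : ∃ v', ∀ w ∈ Z.toCubeData.nbrs C v, v' ∈ Z.toCubeData.half w v := by
    obtain ⟨n, e, x, he, rfl⟩ := Z.isCAT0.isCubeComplex.exists_chart_at hC hv
    refine ⟨e fun i => !x i, fun w hw => ?_⟩
    rw [he.nbrs_eq] at hw
    obtain ⟨i, rfl⟩ := hw
    have := (Z.isCAT0.mem_half_chart he (flipAt i x) (fun i => !x i) i).2 (by simp)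
    rwa [flipAt_flipAt] at this
  obtain ⟨y', rfl⟩ := hq.surjective v'
  obtain ⟨y, hy, hmin⟩ : ∃ y, q.toFun y = v ∧ ∀ z, q.toFun z = v →
      Y.toCubeData.graph.dist y' y ≤ Y.toCubeData.graph.dist y' z := by
    classical
    obtain ⟨y₀, hy₀⟩ := hq.surjective v
    have hex : ∃ k, ∃ y, q.toFun y = v ∧ Y.toCubeData.graph.dist y' y = k := ⟨_, y₀, hy₀, rfl⟩
    obtain ⟨y, hy, hk⟩ := Nat.find_spec hex
    exact ⟨y, hy, fun z hz => hk ▸ Nat.find_min' hex ⟨z, hz, rfl⟩⟩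
  refine ⟨y, hy, fun w hw => ?_⟩
  obtain ⟨p, rfl⟩ := hq.surjective w
  obtain ⟨m, m1, m2, m3⟩ := hYm.exists_median y y' p
  have hm : q.toFun m = q.toFun p := by
    by_contra hne
    obtain ⟨u, hu, hd⟩ := CubeData.exists_closer hZm.connected hne
    have hmu : q.toFun m ∉ Z.toCubeData.half (q.toFun p) u :=
      (hZm.notMem_half_iff hu.symm).2 ((hZm.mem_half_iff hu).2 hd)
    have hun : u ∉ Z.toCubeData.half (q.toFun p) u :=
      (hZm.notMem_half_iff hu.symm).2 (CubeData.left_mem_half hu)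
    have hconv := hq.preimage_half_convex hu.symm
    have hvn : v ∉ Z.toCubeData.half (q.toFun p) u := fun h =>
      hmu (hconv y (by rwa [Set.mem_preimage, hy]) p (CubeData.left_mem_half hu.symm) m m3)
    have hvn' : q.toFun y' ∉ Z.toCubeData.half (q.toFun p) u := fun h =>
      hmu (hconv y' h p (CubeData.left_mem_half hu.symm) m m1)
    have := Z.isCAT0.eq_of_cross hu.symm hw.2.symm hu.symm (CubeData.left_mem_half hu.symm) hvn hun
    subst this
    exact hvn' (hv' _ hw)
  have hmy : m ≠ y := by
    rintro rfl
    exact hw.2.ne (hy.symm.trans hm)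
  obtain ⟨t, ht, hd⟩ := CubeData.exists_closer hYm.connected hmy
  have hyt : Y.toCubeData.graph.dist y t = 1 := SimpleGraph.dist_eq_one_iff_adj.2 ht.symm
  have hvt : Z.toCubeData.graph.Adj v (q.toFun t) := by
    rcases q.eq_or_adj ht with h | h
    · have h1 := hmin t (h.trans hy)
      have h2 := hYm.connected.dist_triangle (u := y') (v := m) (w := t)
      rw [SimpleGraph.dist_comm (u := y) (v := m), SimpleGraph.dist_comm (u := m) (v := y'),
        SimpleGraph.dist_comm (u := y)] at m2
      omega
    · rw [hy] at h
      exact h.symm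
  refine ⟨t, ht.symm, ?_⟩
  have htn : q.toFun t ∉ Z.toCubeData.half v (q.toFun t) :=
    (hZm.notMem_half_iff hvt).2 (CubeData.left_mem_half hvt.symm)
  refine Z.isCAT0.eq_of_cross hvt hvt hw.2 (CubeData.left_mem_half hvt) htn fun hwv => htn ?_
  have hyh : y ∈ q.toFun ⁻¹' Z.toCubeData.half v (q.toFun t) := by
    rw [Set.mem_preimage, hy]
    exact CubeData.left_mem_half hvt
  refine hq.preimage_half_convex hvt y hyh m (by rwa [Set.mem_preimage, hm]) t ?_
  rw [hyt, SimpleGraph.dist_comm (u := t), SimpleGraph.dist_comm (u := y) (v := m), hd]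
  omega

end PullsBackWalls

/-- The vertex over `v` of the cube corresponding to a vertex of the fiber. -/
noncomputable def fiberVertex (q : CubicalMap Y Z) {C : Z.Face} {v : Z.toCubeData.V} (hv : v ∈ C.1)
    (D : (q.fiber C).V) : Y.toCubeData.V :=
  (D.2.surjOn hv).choose

theorem fiberVertex_mem (q : CubicalMap Y Z) {C : Z.Face} {v : Z.toCubeData.V} (hv : v ∈ C.1)
    (D : (q.fiber C).V) : q.fiberVertex hv D ∈ D.1.1 :=
  (D.2.surjOn hv).choose_spec.1

theorem map_fiberVertex (q : CubicalMap Y Z) {C : Z.Face} {v : Z.toCubeData.V} (hv : v ∈ C.1)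
    (D : (q.fiber C).V) : q.toFun (q.fiberVertex hv D) = v :=
  (D.2.surjOn hv).choose_spec.2

theorem fiberVertex_eq (q : CubicalMap Y Z) {C : Z.Face} {v : Z.toCubeData.V} (hv : v ∈ C.1)
    {D : (q.fiber C).V} {y : Y.toCubeData.V} (hy : y ∈ D.1.1) (hyv : q.toFun y = v) :
    q.fiberVertex hv D = y :=
  D.2.injOn (q.fiberVertex_mem hv D) hy ((q.map_fiberVertex hv D).trans hyv.symm)

theorem fiberVertex_fiberMap (q : CubicalMap Y Z) {C C' : Z.Face} (h : C ≤ C')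
    {v : Z.toCubeData.V} (hv : v ∈ C.1) (D : (q.fiber C').V) :
    q.fiberVertex hv (q.fiberMap h D) = q.fiberVertex (h hv) D :=
  (q.fiberVertex_eq (h hv) (q.fiberVertex_mem hv (q.fiberMap h D)).1 (q.map_fiberVertex _ _)).symm

namespace PullsBackWalls

theorem fiberVertex_injective (hq : q.PullsBackWalls) {C : Z.Face} {v : Z.toCubeData.V}
    (hv : v ∈ C.1) : Function.Injective (q.fiberVertex hv) := by
  intro D D' h
  have h1 := q.fiberVertex_mem hv D
  have h2 := q.fiberVertex_mem hv D'
  rw [← h] at h2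
  exact Subtype.ext (Subtype.ext ((hq.subset_of_bijOn D.1.2 D'.1.2 D.2 D'.2.image_eq h1 h2).antisymm
    (hq.subset_of_bijOn D'.1.2 D.1.2 D'.2 D.2.image_eq h2 h1)))

theorem range_fiberVertex (hq : q.PullsBackWalls) {C : Z.Face} {v : Z.toCubeData.V}
    (hv : v ∈ C.1) : Set.range (q.fiberVertex hv) = q.crossing C.1 v := by
  ext y
  constructor
  · rintro ⟨D, rfl⟩
    have := mem_crossing_of_mem D.1.2 D.2.image_eq (q.fiberVertex_mem hv D)
    rwa [q.map_fiberVertex] at this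
  · intro hy
    obtain ⟨D, hD, hTD, hDC, hN⟩ := hq.exists_cube_over C.2 hv
      (Y.isCAT0.isCubeComplex.singleton_mem y) (Set.singleton_subset_iff.2 hy) rfl
    have hyD := hTD rfl
    refine ⟨⟨⟨D, hD⟩, fun a ha => hDC ▸ ⟨a, ha, rfl⟩, q.injOn_of_nbrs hD hyD fun y' hy' => ?_,
      hDC.ge⟩, q.fiberVertex_eq hv hyD hy.1⟩
    rw [hN] at hy'
    rcases hy' with h | h
    · exact absurd h.1 h.2.ne'
    · rw [hy.1]
      exact h.2.2.ne'

/-- The cubes of the fiber correspond to slices over `v` of cubes over `C`. Such slices are faces,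
and by `exists_cube_over` every cube contained in the crossing set is one. -/
theorem isConvexEmbedding_fiberVertex (hq : q.PullsBackWalls) {C : Z.Face} {v : Z.toCubeData.V}
    (hv : v ∈ C.1) :
    CubeData.IsConvexEmbedding (q.fiber C) Y.toCubeData (q.fiberVertex hv) := by
  have hinj := hq.fiberVertex_injective hv
  have hrange := hq.range_fiberVertex hv
  refine ⟨hinj, fun S => ⟨fun hS => ?_, ?_⟩, fun x y z hz => ?_⟩
  · obtain ⟨y, hy⟩ := Y.isCAT0.isCubeComplex.nonempty hS
    have hsub : q.fiberVertex hv '' S ⊆ q.crossing C.1 v := hrange ▸ Set.image_subset_range _ _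
    obtain ⟨D, hD, hTD, hDC, hN⟩ := hq.exists_cube_over C.2 hv hS hsub hy
    refine ⟨⟨D, hD⟩, hDC, ?_⟩
    have hcut : D ∩ q.toFun ⁻¹' {v} = q.fiberVertex hv '' S := by
      have hyv := (hsub hy).1
      refine Y.isCAT0.isCubeComplex.eq_of_nbrs_eq
        (q.inter_preimage_mem (CCC.vertexFace_le hv) hD hDC) hS ⟨hTD hy, hyv⟩ hy ?_
      ext y'
      constructor
      · rintro ⟨⟨h1, h2⟩, h3⟩
        have : y' ∈ Y.toCubeData.nbrs D y := ⟨h1, h3⟩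
        rw [hN] at this
        rcases this with h | h
        · exact h
        · exact absurd h2 h.2.2.ne'
      · rintro ⟨h1, h2⟩
        exact ⟨⟨hTD h1, (hsub h1).1⟩, h2⟩
    ext E
    constructor
    · intro hE
      exact hq.subset_of_bijOn E.1.2 hD E.2 hDC (q.fiberVertex_mem hv E) (hTD ⟨E, hE, rfl⟩)
    · intro hE
      have : q.fiberVertex hv E ∈ q.fiberVertex hv '' S := by
        rw [← hcut]
        exact ⟨hE (q.fiberVertex_mem hv E), q.map_fiberVertex hv E⟩
      rwa [hinj.mem_set_image] at this
  · rintro ⟨D, hDC, rfl⟩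
    have : q.fiberVertex hv '' {E : (q.fiber C).V | E.1 ≤ D} = D.1 ∩ q.toFun ⁻¹' {v} := by
      ext y
      constructor
      · rintro ⟨E, hE, rfl⟩
        exact ⟨hE (q.fiberVertex_mem hv E), q.map_fiberVertex hv E⟩
      · rintro ⟨hy, hyv⟩
        have hyN := mem_crossing_of_mem D.2 hDC hy
        rw [Set.mem_singleton_iff.1 hyv, ← hrange] at hyN
        obtain ⟨E, rfl⟩ := hyN
        exact ⟨E, hq.subset_of_bijOn E.1.2 D.2 E.2 hDC (q.fiberVertex_mem hv E) hy, rfl⟩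
    exact this ▸ q.inter_preimage_mem (CCC.vertexFace_le hv) D.2 hDC
  · rw [hrange]
    exact hq.crossing_convex C.1 v _ (hrange ▸ ⟨x, rfl⟩) _ (hrange ▸ ⟨y, rfl⟩) z hz

/-- Choosing `v` in the smaller face, the fiber map followed by the embedding at `v` is the
embedding of the other fiber at `v`. -/
theorem fibersInCCC (hq : q.PullsBackWalls) : q.FibersInCCC := by
  have hcat : ∀ C : Z.Face, (q.fiber C).IsCAT0 := by
    intro C
    obtain ⟨v, hv⟩ := Z.isCAT0.isCubeComplex.nonempty C.2
    obtain ⟨y, hy⟩ := hq.crossing_nonempty C.2 hv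
    rw [← hq.range_fiberVertex hv] at hy
    obtain ⟨D, -⟩ := hy
    have : Nonempty (q.fiber C).V := ⟨D⟩
    exact (hq.isConvexEmbedding_fiberVertex hv).isCAT0 Y.isCAT0
  refine ⟨hcat, fun {C C'} h => ?_⟩
  obtain ⟨v, hv⟩ := Z.isCAT0.isCubeComplex.nonempty C.2
  refine CubeData.IsConvexEmbedding.of_comp (hq.isConvexEmbedding_fiberVertex hv) ?_
    (hcat C).isSimplyConnected.connected Y.isCAT0.isSimplyConnected.connected
  simp only [q.fiberVertex_fiberMap h hv]
  exact hq.isConvexEmbedding_fiberVertex (h hv)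

/-- The images in question are the crossing sets, and membership in `crossing C v` is one condition
for each edge of `C` at `v`. -/
theorem oneDetermined (hq : q.PullsBackWalls) (hF : q.FibersInCCC) :
    CCC.OneDetermined (q.fiberFunctor hF) := by
  have key : ∀ {v : Z.toCubeData.V} {C : Z.Face} (hv : v ∈ C.1) (E : (q.fiber (Z.vertexFace v)).V),
      E ∈ CCC.imageAt (q.fiberFunctor hF) hv ↔
        q.fiberVertex (C := Z.vertexFace v) rfl E ∈ q.crossing C.1 v := by
    intro v C hv E
    have hmap := q.fiberVertex_fiberMap (CCC.vertexFace_le hv) (v := v) rfl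
    constructor
    · rintro ⟨D, rfl⟩
      rw [← hq.range_fiberVertex hv]
      exact ⟨D, (hmap D).symm⟩
    · intro h
      rw [← hq.range_fiberVertex hv] at h
      obtain ⟨D, hD⟩ := h
      exact ⟨D, hq.fiberVertex_injective (C := Z.vertexFace v) rfl ((hmap D).trans hD)⟩
  intro C v hv
  ext E
  simp only [Set.mem_iInter]
  constructor
  · intro hE e he heC hve
    have hE' := (key hv E).1 hE
    exact (key hve E).2 ⟨hE'.1, fun w hw => hE'.2 w ⟨heC hw.1, hw.2⟩⟩
  · intro h
    refine (key hv E).2 ⟨q.map_fiberVertex _ E, fun w hw => ?_⟩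
    have he := (key (C := ⟨{v, w}, hw.2.2⟩) (.inl rfl) E).1 (h ⟨{v, w}, hw.2.2⟩
      (Set.ncard_pair hw.2.ne) (by rintro a (rfl | rfl); exacts [hv, hw.1]) (.inl rfl))
    exact he.2 w ⟨.inr rfl, hw.2⟩

end PullsBackWalls

end CubicalMap

/-! ### The total space of a functor on faces is a cube complex. -/

namespace CCC

variable {Z : CCC.{u}} (Ψ : Z.Faceᵒᵖ ⥤ CCC.{u})

/-- The cube complex over a face. -/
abbrev fib (C : Z.Face) : CubeData.{u} := (Ψ.obj (.op C)).toCubeData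

/-- The restriction map between the complexes over two faces. -/
def restr {C C' : Z.Face} (h : C ≤ C') : (fib Ψ C').V → (fib Ψ C).V :=
  Hom.toFun (Ψ.map (homOfLE h).op)

theorem restr_convex {C C' : Z.Face} (h : C ≤ C') :
    CubeData.IsConvexEmbedding (fib Ψ C') (fib Ψ C) (restr Ψ h) :=
  Hom.isConvexEmbedding (Ψ.map (homOfLE h).op)

theorem restr_self {C : Z.Face} (x : (fib Ψ C).V) : restr Ψ le_rfl x = x := by
  have : Ψ.map (homOfLE (le_refl C)).op = 𝟙 _ := Ψ.map_id _
  rw [restr, this]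
  rfl

theorem restr_restr {C C' C'' : Z.Face} (h : C ≤ C') (h' : C' ≤ C'') (x : (fib Ψ C'').V) :
    restr Ψ h (restr Ψ h' x) = restr Ψ (h.trans h') x := by
  have : Ψ.map (homOfLE (h.trans h')).op = Ψ.map (homOfLE h').op ≫ Ψ.map (homOfLE h).op := by
    rw [← Ψ.map_comp]
    rfl
  rw [restr, restr, restr, this]
  rfl

theorem fib_nonempty (C : Z.Face) : Nonempty (fib Ψ C).V :=
  (Ψ.obj (.op C)).isCAT0.isSimplyConnected.connected.nonempty

/-- The vertices of the total space. -/
abbrev TotalVertex : Type u := Σ v : Z.toCubeData.V, (fib Ψ (Z.vertexFace v)).V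

/-- The vertex over `v` determined by a vertex of the complex over a face containing `v`. -/
def pt (C : Z.Face) {v : Z.toCubeData.V} (hv : v ∈ C.1) (x : (fib Ψ C).V) : TotalVertex Ψ :=
  ⟨v, restr Ψ (vertexFace_le hv) x⟩

/-- The product of a face and a set of vertices over this face. -/
def prodSet (C : Z.Face) (D : Set (fib Ψ C).V) : Set (TotalVertex Ψ) :=
  {p | ∃ (v : Z.toCubeData.V) (hv : v ∈ C.1) (x : (fib Ψ C).V), x ∈ D ∧ p = pt Ψ C hv x}

/-- The total space. -/
abbrev total : CubeData.{u} where
  V := TotalVertex Ψ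
  cubes := {S | ∃ (C : Z.Face) (D : Set (fib Ψ C).V), D ∈ (fib Ψ C).cubes ∧ S = prodSet Ψ C D}

variable {Ψ}

theorem pt_inj {C : Z.Face} {v w : Z.toCubeData.V} {hv : v ∈ C.1} {hw : w ∈ C.1}
    {x y : (fib Ψ C).V} : pt Ψ C hv x = pt Ψ C hw y ↔ v = w ∧ x = y := by
  constructor
  · intro h
    obtain rfl : v = w := congrArg Sigma.fst h
    refine ⟨rfl, (restr_convex Ψ (vertexFace_le hv)).injective ?_⟩
    exact eq_of_heq (Sigma.mk.inj h).2
  · rintro ⟨rfl, rfl⟩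
    rfl

theorem pt_restr {C C' : Z.Face} (h : C ≤ C') {v : Z.toCubeData.V} (hv : v ∈ C.1)
    (x : (fib Ψ C').V) : pt Ψ C hv (restr Ψ h x) = pt Ψ C' (h hv) x := by
  rw [pt, restr_restr]
  rfl

theorem pt_vertexFace (p : TotalVertex Ψ) : pt Ψ (Z.vertexFace p.1) rfl p.2 = p :=
  congrArg (Sigma.mk p.1) (restr_self Ψ p.2)

theorem pt_vertexFace' {v : Z.toCubeData.V} (x : (fib Ψ (Z.vertexFace v)).V) :
    pt Ψ (Z.vertexFace v) (v := v) rfl x = ⟨v, x⟩ :=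
  pt_vertexFace (Ψ := Ψ) ⟨v, x⟩

theorem pt_mem_prodSet {C : Z.Face} {D : Set (fib Ψ C).V} {v : Z.toCubeData.V} {hv : v ∈ C.1}
    {x : (fib Ψ C).V} : pt Ψ C hv x ∈ prodSet Ψ C D ↔ x ∈ D := by
  constructor
  · rintro ⟨w, hw, y, hy, h⟩
    exact (pt_inj.1 h).2 ▸ hy
  · exact fun h => ⟨v, hv, x, h, rfl⟩

theorem prodSet_mem_cubes {C : Z.Face} {D : Set (fib Ψ C).V} (hD : D ∈ (fib Ψ C).cubes) :
    prodSet Ψ C D ∈ (total Ψ).cubes :=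
  ⟨C, D, hD, rfl⟩

theorem fst_image_prodSet {C : Z.Face} {D : Set (fib Ψ C).V} (hD : D.Nonempty) :
    Sigma.fst '' prodSet Ψ C D = C.1 := by
  obtain ⟨x, hx⟩ := hD
  ext v
  constructor
  · rintro ⟨_, ⟨v, hv, y, -, rfl⟩, rfl⟩
    exact hv
  · exact fun hv => ⟨pt Ψ C hv x, pt_mem_prodSet.2 hx, rfl⟩

theorem prodSet_inter_preimage {C C' : Z.Face} (h : C ≤ C') (D : Set (fib Ψ C').V) :
    prodSet Ψ C' D ∩ Sigma.fst ⁻¹' C.1 = prodSet Ψ C (restr Ψ h '' D) := by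
  ext p
  constructor
  · rintro ⟨⟨v, hv', x, hx, rfl⟩, hv⟩
    exact ⟨v, hv, _, ⟨x, hx, rfl⟩, (pt_restr h hv x).symm⟩
  · rintro ⟨v, hv, _, ⟨x, hx, rfl⟩, rfl⟩
    rw [pt_restr h hv x]
    exact ⟨pt_mem_prodSet.2 hx, hv⟩

theorem prodSet_inter (C : Z.Face) (D D' : Set (fib Ψ C).V) :
    prodSet Ψ C D ∩ prodSet Ψ C D' = prodSet Ψ C (D ∩ D') := by
  ext p
  constructor
  · rintro ⟨⟨v, hv, x, hx, rfl⟩, hp⟩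
    exact ⟨v, hv, x, ⟨hx, pt_mem_prodSet.1 hp⟩, rfl⟩
  · rintro ⟨v, hv, x, hx, rfl⟩
    exact ⟨pt_mem_prodSet.2 hx.1, pt_mem_prodSet.2 hx.2⟩

theorem prodSet_subset_iff {C : Z.Face} {D D' : Set (fib Ψ C).V} :
    prodSet Ψ C D ⊆ prodSet Ψ C D' ↔ D ⊆ D' := by
  constructor
  · intro h x hx
    obtain ⟨v, hv⟩ := Z.isCAT0.isCubeComplex.nonempty C.2
    exact pt_mem_prodSet.1 (h (pt_mem_prodSet (hv := hv).2 hx))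
  · rintro h _ ⟨v, hv, x, hx, rfl⟩
    exact pt_mem_prodSet.2 (h hx)

/-- Coordinates of the base and of the fiber are put side by side. A cube over `C'` inside this
product has `C' ⊆ C`, and its fiber part is the restriction of a cube inside `D` because restriction
maps reflect cubes; so it is a product of faces. -/
theorem isChart_prodSet {C : Z.Face} {D : Set (fib Ψ C).V} {n m : ℕ}
    {e : (Fin n → Bool) → Z.toCubeData.V} {e' : (Fin m → Bool) → (fib Ψ C).V}
    (he : Z.toCubeData.IsChart e C.1) (he' : (fib Ψ C).IsChart e' D) :
    (total Ψ).IsChart (fun x : Fin (n + m) → Bool => pt Ψ C (he.mem fun i => x (Fin.castAdd m i))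
      (e' fun i => x (Fin.natAdd n i))) (prodSet Ψ C D) := by
  have hsub : ∀ (p₁ : Fin n → Option Bool) (p₂ : Fin m → Option Bool) (x : Fin (n + m) → Bool),
      x ∈ subcube (Fin.addCases p₁ p₂) ↔ (fun i => x (Fin.castAdd m i)) ∈ subcube p₁ ∧
        (fun i => x (Fin.natAdd n i)) ∈ subcube p₂ := by
    intro p₁ p₂ x
    constructor
    · intro h
      exact ⟨fun i b hb => h (Fin.castAdd m i) b (by simpa using hb),
        fun i b hb => h (Fin.natAdd n i) b (by simpa using hb)⟩
    · rintro ⟨h1, h2⟩ k b hb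
      induction k using Fin.addCases with
      | left i => exact h1 i b (by simpa using hb)
      | right i => exact h2 i b (by simpa using hb)
  have hpair : ∀ (a : Fin n → Bool) (b : Fin m → Bool), ∃ x : Fin (n + m) → Bool,
      (fun i => x (Fin.castAdd m i)) = a ∧ (fun i => x (Fin.natAdd n i)) = b :=
    fun a b => ⟨Fin.addCases a b, by simp, by simp⟩
  refine ⟨fun x y hxy => ?_, ?_, fun S hS => ⟨?_, ?_⟩⟩
  · obtain ⟨h1, h2⟩ := pt_inj.1 hxy
    have h1 := he.injective h1
    have h2 := he'.injective h2
    funext k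
    induction k using Fin.addCases with
    | left i => exact congrFun h1 i
    | right i => exact congrFun h2 i
  · ext p
    constructor
    · rintro ⟨x, rfl⟩
      exact pt_mem_prodSet.2 (he'.mem _)
    · rintro ⟨v, hv, x, hx, rfl⟩
      obtain ⟨a, rfl⟩ := he.exists_eq hv
      obtain ⟨b, rfl⟩ := he'.exists_eq hx
      obtain ⟨x, rfl, rfl⟩ := hpair a b
      exact ⟨x, rfl⟩
  · rintro ⟨C', D', hD', rfl⟩
    have hne := (Ψ.obj (.op C')).isCAT0.isCubeComplex.nonempty hD'
    have hCC : C' ≤ C := by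
      intro v hv
      obtain ⟨x, hx⟩ := hne
      obtain ⟨w, hw, y, -, h⟩ := hS (pt_mem_prodSet (hv := hv).2 hx)
      obtain rfl : v = w := congrArg Sigma.fst h
      exact hw
    obtain ⟨p₁, hp₁⟩ := (he.mem_cubes_iff C'.1 hCC).1 C'.2
    have hD'r : D' ⊆ restr Ψ hCC '' D := by
      rw [← prodSet_subset_iff, ← prodSet_inter_preimage]
      rintro p hp
      refine ⟨hS hp, ?_⟩
      obtain ⟨v, hv, x, -, rfl⟩ := hp
      exact hv
    obtain ⟨D'', hD'', rfl⟩ := Set.subset_image_iff.1 hD'r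
    rw [(restr_convex Ψ hCC).mem_cubes_iff] at hD'
    obtain ⟨p₂, hp₂⟩ := (he'.mem_cubes_iff D'' hD'').1 hD'
    refine ⟨Fin.addCases p₁ p₂, ?_⟩
    rw [← prodSet_inter_preimage]
    ext p
    constructor
    · rintro ⟨⟨v, hv, x, hx, rfl⟩, hv'⟩
      change v ∈ C'.1 at hv'
      rw [hp₁] at hv'
      rw [hp₂] at hx
      obtain ⟨a, ha, rfl⟩ := hv'
      obtain ⟨b, hb, rfl⟩ := hx
      obtain ⟨x, rfl, rfl⟩ := hpair a b
      exact ⟨x, (hsub p₁ p₂ x).2 ⟨ha, hb⟩, rfl⟩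
    · rintro ⟨x, hx, rfl⟩
      obtain ⟨h1, h2⟩ := (hsub p₁ p₂ x).1 hx
      refine ⟨pt_mem_prodSet.2 (hp₂ ▸ ⟨_, h2, rfl⟩), ?_⟩
      change e _ ∈ C'.1
      rw [hp₁]
      exact ⟨_, h1, rfl⟩
  · rintro ⟨p, rfl⟩
    let p₁ : Fin n → Option Bool := fun i => p (Fin.castAdd m i)
    let p₂ : Fin m → Option Bool := fun i => p (Fin.natAdd n i)
    have hp : p = Fin.addCases p₁ p₂ := by
      funext k
      induction k using Fin.addCases with
      | left i => simp [p₁]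
      | right i => simp [p₂]
    have hC' : e '' subcube p₁ ∈ Z.toCubeData.cubes := (he.mem_cubes_iff _ (by
      rintro _ ⟨x, -, rfl⟩
      exact he.mem x)).2 ⟨p₁, rfl⟩
    have hD' : e' '' subcube p₂ ∈ (fib Ψ C).cubes := (he'.mem_cubes_iff _ (by
      rintro _ ⟨x, -, rfl⟩
      exact he'.mem x)).2 ⟨p₂, rfl⟩
    have hCC : (⟨_, hC'⟩ : Z.Face) ≤ C := by
      rintro _ ⟨x, -, rfl⟩
      exact he.mem x
    refine ⟨⟨_, hC'⟩, restr Ψ hCC '' (e' '' subcube p₂),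
      ((restr_convex Ψ hCC).mem_cubes_iff _).2 hD', ?_⟩
    rw [← prodSet_inter_preimage]
    ext r
    constructor
    · rintro ⟨x, hx, rfl⟩
      rw [hp] at hx
      obtain ⟨h1, h2⟩ := (hsub p₁ p₂ x).1 hx
      exact ⟨pt_mem_prodSet.2 ⟨_, h2, rfl⟩, ⟨_, h1, rfl⟩⟩
    · rintro ⟨⟨v, hv, _, ⟨b, hb, rfl⟩, rfl⟩, hv'⟩
      obtain ⟨a, ha, rfl⟩ : v ∈ e '' subcube p₁ := hv'
      obtain ⟨x, rfl, rfl⟩ := hpair a b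
      exact ⟨x, hp ▸ (hsub p₁ p₂ x).2 ⟨ha, hb⟩, rfl⟩

theorem singleton_eq_prodSet (p : TotalVertex Ψ) :
    ({p} : Set (TotalVertex Ψ)) = prodSet Ψ (Z.vertexFace p.1) {p.2} := by
  ext r
  constructor
  · rintro rfl
    exact ⟨_, rfl, _, rfl, (pt_vertexFace r).symm⟩
  · rintro ⟨v, hv, x, hx, rfl⟩
    obtain rfl : v = p.1 := hv
    obtain rfl : x = p.2 := hx
    exact pt_vertexFace p

variable (Ψ) in
theorem total_isCubeComplex : (total Ψ).IsCubeComplex where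
  singleton_mem p := by
    rw [singleton_eq_prodSet]
    exact prodSet_mem_cubes ((Ψ.obj (.op (Z.vertexFace p.1))).isCAT0.isCubeComplex.singleton_mem _)
  exists_chart := by
    rintro _ ⟨C, D, hD, rfl⟩
    obtain ⟨n, e, he⟩ := Z.isCAT0.isCubeComplex.exists_chart C.1 C.2
    obtain ⟨m, e', he'⟩ := (Ψ.obj (.op C)).isCAT0.isCubeComplex.exists_chart D hD
    exact ⟨_, _, isChart_prodSet he he'⟩
  inter_mem := by
    rintro _ ⟨C, D, hD, rfl⟩ _ ⟨C', D', hD', rfl⟩ hne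
    have hfst : ∀ {C : Z.Face} {D : Set (fib Ψ C).V} {p : TotalVertex Ψ}, p ∈ prodSet Ψ C D →
        p.1 ∈ C.1 := by
      rintro C D _ ⟨v, hv, x, -, rfl⟩
      exact hv
    have hCC : C.1 ∩ C'.1 ∈ Z.toCubeData.cubes := by
      obtain ⟨p, hp, hp'⟩ := hne
      exact Z.isCAT0.isCubeComplex.inter_mem _ C.2 _ C'.2 ⟨p.1, hfst hp, hfst hp'⟩
    have h1 : (⟨_, hCC⟩ : Z.Face) ≤ C := Set.inter_subset_left
    have h2 : (⟨_, hCC⟩ : Z.Face) ≤ C' := Set.inter_subset_right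
    -- Both products are cut down to the common face, where the intersection takes place in a single
    -- complex.
    have heq : prodSet Ψ C D ∩ prodSet Ψ C' D' =
        prodSet Ψ ⟨_, hCC⟩ (restr Ψ h1 '' D ∩ restr Ψ h2 '' D') := by
      rw [← prodSet_inter, ← prodSet_inter_preimage, ← prodSet_inter_preimage]
      ext p
      exact ⟨fun ⟨hp, hp'⟩ => ⟨⟨hp, hfst hp, hfst hp'⟩, hp', hfst hp, hfst hp'⟩,
        fun h => ⟨h.1.1, h.2.1⟩⟩
    rw [heq] at hne ⊢
    refine prodSet_mem_cubes ((Ψ.obj (.op _)).isCAT0.isCubeComplex.inter_mem _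
      (((restr_convex Ψ h1).mem_cubes_iff _).2 hD) _
      (((restr_convex Ψ h2).mem_cubes_iff _).2 hD') ?_)
    obtain ⟨_, v, hv, x, hx, -⟩ := hne
    exact ⟨x, hx⟩

/-- The edge joining two adjacent vertices, as a face. -/
def edgeFace {v w : Z.toCubeData.V} (h : Z.toCubeData.graph.Adj v w) : Z.Face := ⟨{v, w}, h.2⟩

theorem edgeFace_le {v w : Z.toCubeData.V} (h : Z.toCubeData.graph.Adj v w) {C : Z.Face}
    (hv : v ∈ C.1) (hw : w ∈ C.1) : edgeFace h ≤ C := by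
  rintro _ (rfl | rfl)
  exacts [hv, hw]

theorem adj_vertical {C : Z.Face} {v : Z.toCubeData.V} (hv : v ∈ C.1) {x y : (fib Ψ C).V} :
    (total Ψ).graph.Adj (pt Ψ C hv x) (pt Ψ C hv y) ↔ (fib Ψ C).graph.Adj x y := by
  have hpair : ∀ {C : Z.Face} {v : Z.toCubeData.V} (hv : v ∈ C.1) (x y : (fib Ψ C).V),
      ({pt Ψ C hv x, pt Ψ C hv y} : Set (TotalVertex Ψ)) = prodSet Ψ (Z.vertexFace v)
        {restr Ψ (vertexFace_le hv) x, restr Ψ (vertexFace_le hv) y} := by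
    intro C v hv x y
    ext p
    constructor
    · rintro (rfl | rfl)
      · exact ⟨v, rfl, _, .inl rfl, (pt_restr (vertexFace_le hv) rfl x).symm⟩
      · exact ⟨v, rfl, _, .inr rfl, (pt_restr (vertexFace_le hv) rfl y).symm⟩
    · rintro ⟨w, hw, _, rfl | rfl, rfl⟩ <;> obtain rfl : w = v := hw
      · exact .inl (pt_restr (vertexFace_le hv) rfl x)
      · exact .inr (pt_restr (vertexFace_le hv) rfl y)
  constructor
  · rintro ⟨hne, C', D, hD, h⟩
    have hne' : x ≠ y := fun h => hne (h ▸ rfl)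
    refine ⟨hne', ?_⟩
    rw [← (restr_convex Ψ (vertexFace_le hv)).mem_cubes_iff, Set.image_pair]
    have hfst := fst_image_prodSet ((Ψ.obj (.op C')).isCAT0.isCubeComplex.nonempty hD)
    rw [← h, Set.image_pair] at hfst
    obtain rfl : C' = Z.vertexFace v := by
      refine Subtype.ext (hfst.symm.trans ?_)
      exact Set.pair_eq_singleton v
    have h' := (hpair hv x y).symm.trans h
    have : {restr Ψ (vertexFace_le hv) x, restr Ψ (vertexFace_le hv) y} = D :=
      (prodSet_subset_iff.1 h'.le).antisymm (prodSet_subset_iff.1 h'.ge)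
    rw [this]
    exact hD
  · intro h
    refine ⟨fun h' => h.1 (pt_inj.1 h').2, ?_⟩
    rw [hpair]
    refine prodSet_mem_cubes ?_
    rw [← Set.image_pair, (restr_convex Ψ (vertexFace_le hv)).mem_cubes_iff]
    exact h.2

theorem adj_horizontal {C : Z.Face} {v w : Z.toCubeData.V} (hv : v ∈ C.1) (hw : w ∈ C.1)
    (h : Z.toCubeData.graph.Adj v w) (x : (fib Ψ C).V) :
    (total Ψ).graph.Adj (pt Ψ C hv x) (pt Ψ C hw x) := by
  refine ⟨fun h' => h.1 (pt_inj.1 h').1, ?_⟩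
  have hle := edgeFace_le h hv hw
  have : ({pt Ψ C hv x, pt Ψ C hw x} : Set (TotalVertex Ψ)) =
      prodSet Ψ (edgeFace h) {restr Ψ hle x} := by
    ext p
    constructor
    · rintro (rfl | rfl)
      · exact ⟨v, .inl rfl, _, rfl, (pt_restr hle (.inl rfl) x).symm⟩
      · exact ⟨w, .inr rfl, _, rfl, (pt_restr hle (.inr rfl) x).symm⟩
    · rintro ⟨w', rfl | rfl, _, rfl, rfl⟩
      · exact .inl (pt_restr hle (.inl rfl) x)
      · exact .inr (pt_restr hle (.inr rfl) x)
  rw [this]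
  exact prodSet_mem_cubes ((Ψ.obj (.op _)).isCAT0.isCubeComplex.singleton_mem _)

theorem exists_of_adj {p r : TotalVertex Ψ} (h : (total Ψ).graph.Adj p r) (hne : p.1 ≠ r.1) :
    ∃ (hadj : Z.toCubeData.graph.Adj p.1 r.1) (z : (fib Ψ (edgeFace hadj)).V),
      p = pt Ψ (edgeFace hadj) (.inl rfl) z ∧ r = pt Ψ (edgeFace hadj) (.inr rfl) z := by
  obtain ⟨-, C, D, hD, hpr⟩ := h
  have hDne := (Ψ.obj (.op C)).isCAT0.isCubeComplex.nonempty hD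
  have hfst := fst_image_prodSet hDne
  rw [← hpr, Set.image_pair] at hfst
  have hadj : Z.toCubeData.graph.Adj p.1 r.1 := ⟨hne, hfst ▸ C.2⟩
  obtain rfl : C = edgeFace hadj := Subtype.ext hfst.symm
  obtain ⟨z, hz⟩ := hDne
  refine ⟨hadj, z, ?_, ?_⟩
  · have : pt Ψ (edgeFace hadj) (v := p.1) (.inl rfl) z ∈ ({p, r} : Set (TotalVertex Ψ)) :=
      hpr ▸ pt_mem_prodSet.2 hz
    rcases this with h | h
    · exact h.symm
    · exact absurd (congrArg Sigma.fst h) hne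
  · have : pt Ψ (edgeFace hadj) (v := r.1) (.inr rfl) z ∈ ({p, r} : Set (TotalVertex Ψ)) :=
      hpr ▸ pt_mem_prodSet.2 hz
    rcases this with h | h
    · exact absurd (congrArg Sigma.fst h) hne.symm
    · exact h.symm

theorem isSquare_horizontal {C : Z.Face} {a b c d : Z.toCubeData.V}
    (s : Z.toCubeData.IsSquare a b c d)
    (ha : a ∈ C.1) (hb : b ∈ C.1) (hc : c ∈ C.1) (hd : d ∈ C.1) (x : (fib Ψ C).V) :
    (total Ψ).IsSquare (pt Ψ C ha x) (pt Ψ C hb x) (pt Ψ C hc x) (pt Ψ C hd x) where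
  mem := by
    have hle : (⟨_, s.mem⟩ : Z.Face) ≤ C := by
      rintro _ (rfl | rfl | rfl | rfl)
      exacts [ha, hb, hc, hd]
    have : ({pt Ψ C ha x, pt Ψ C hb x, pt Ψ C hc x, pt Ψ C hd x} : Set (TotalVertex Ψ)) =
        prodSet Ψ ⟨_, s.mem⟩ {restr Ψ hle x} := by
      ext p
      constructor
      · rintro (rfl | rfl | rfl | rfl)
        · exact ⟨a, by simp, _, rfl, (pt_restr hle (by simp) x).symm⟩
        · exact ⟨b, by simp, _, rfl, (pt_restr hle (by simp) x).symm⟩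
        · exact ⟨c, by simp, _, rfl, (pt_restr hle (by simp) x).symm⟩
        · exact ⟨d, by simp, _, rfl, (pt_restr hle (by simp) x).symm⟩
      · rintro ⟨w, hw, _, rfl, rfl⟩
        rw [pt_restr hle hw]
        rcases hw with rfl | rfl | rfl | rfl <;> simp
    rw [this]
    exact prodSet_mem_cubes ((Ψ.obj (.op _)).isCAT0.isCubeComplex.singleton_mem _)
  ab := adj_horizontal _ _ s.ab x
  bc := adj_horizontal _ _ s.bc x
  ad := adj_horizontal _ _ s.ad x
  dc := adj_horizontal _ _ s.dc x
  ac_ne := fun h => s.ac_ne (pt_inj.1 h).1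
  bd_ne := fun h => s.bd_ne (pt_inj.1 h).1

theorem isSquare_mixed {C : Z.Face} {v w : Z.toCubeData.V} (h : Z.toCubeData.graph.Adj v w)
    (hv : v ∈ C.1) (hw : w ∈ C.1) {x y : (fib Ψ C).V} (hxy : (fib Ψ C).graph.Adj x y) :
    (total Ψ).IsSquare (pt Ψ C hv x) (pt Ψ C hw x) (pt Ψ C hw y) (pt Ψ C hv y) where
  mem := by
    have hle := edgeFace_le h hv hw
    have : ({pt Ψ C hv x, pt Ψ C hw x, pt Ψ C hw y, pt Ψ C hv y} : Set (TotalVertex Ψ)) =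
        prodSet Ψ (edgeFace h) (restr Ψ hle '' {x, y}) := by
      ext p
      constructor
      · rintro (rfl | rfl | rfl | rfl)
        · exact ⟨v, .inl rfl, _, ⟨x, by simp, rfl⟩, (pt_restr hle (.inl rfl) x).symm⟩
        · exact ⟨w, .inr rfl, _, ⟨x, by simp, rfl⟩, (pt_restr hle (.inr rfl) x).symm⟩
        · exact ⟨w, .inr rfl, _, ⟨y, by simp, rfl⟩, (pt_restr hle (.inr rfl) y).symm⟩
        · exact ⟨v, .inl rfl, _, ⟨y, by simp, rfl⟩, (pt_restr hle (.inl rfl) y).symm⟩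
      · rintro ⟨u, hu, _, ⟨z, hz, rfl⟩, rfl⟩
        rw [pt_restr hle hu]
        rcases hu with rfl | rfl <;> rcases hz with rfl | rfl <;> simp
    rw [this]
    exact prodSet_mem_cubes (((restr_convex Ψ hle).mem_cubes_iff _).2 hxy.2)
  ab := adj_horizontal _ _ h x
  bc := (adj_vertical hw).2 hxy
  ad := (adj_vertical hv).2 hxy
  dc := adj_horizontal _ _ h y
  ac_ne := fun h' => h.ne (pt_inj.1 h').1
  bd_ne := fun h' => h.ne (pt_inj.1 h').1.symm

end CCC

/-! ### Simple connectedness and flag links of the total space. -/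

namespace CCC

variable {Z : CCC.{u}} {Ψ : Z.Faceᵒᵖ ⥤ CCC.{u}}

theorem image_pt {C : Z.Face} {v : Z.toCubeData.V} (hv : v ∈ C.1) (S : Set (fib Ψ C).V) :
    pt Ψ C hv '' S = prodSet Ψ (Z.vertexFace v) (restr Ψ (vertexFace_le hv) '' S) := by
  ext p
  constructor
  · rintro ⟨x, hx, rfl⟩
    exact ⟨v, rfl, _, ⟨x, hx, rfl⟩, (pt_restr (vertexFace_le hv) rfl x).symm⟩
  · rintro ⟨w, hw, _, ⟨x, hx, rfl⟩, rfl⟩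
    obtain rfl : w = v := hw
    exact ⟨x, hx, (pt_restr (vertexFace_le hv) rfl x).symm⟩

theorem isSquare_vertical {C : Z.Face} {v : Z.toCubeData.V} (hv : v ∈ C.1) {a b c d : (fib Ψ C).V}
    (s : (fib Ψ C).IsSquare a b c d) :
    (total Ψ).IsSquare (pt Ψ C hv a) (pt Ψ C hv b) (pt Ψ C hv c) (pt Ψ C hv d) := by
  refine s.map (fun x y h => (pt_inj.1 h).2) fun S hS => ?_
  rw [image_pt]
  exact prodSet_mem_cubes (((restr_convex Ψ _).mem_cubes_iff S).2 hS)

theorem fib_connected (Ψ : Z.Faceᵒᵖ ⥤ CCC.{u}) (C : Z.Face) : (fib Ψ C).graph.Connected :=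
  (Ψ.obj (.op C)).isCAT0.isSimplyConnected.connected

variable (Ψ) in
theorem total_connected : (total Ψ).graph.Connected := by
  have hvert : ∀ (v : Z.toCubeData.V) (x y : (fib Ψ (Z.vertexFace v)).V),
      (total Ψ).graph.Reachable ⟨v, x⟩ ⟨v, y⟩ := by
    intro v x y
    rw [← pt_vertexFace' x, ← pt_vertexFace' y]
    let F : (fib Ψ (Z.vertexFace v)).graph →g (total Ψ).graph :=
      ⟨pt Ψ (Z.vertexFace v) rfl, fun h => (adj_vertical (C := Z.vertexFace v) rfl).2 h⟩
    exact ((fib_connected Ψ _).preconnected x y).map F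
  have hhor : ∀ (v w : Z.toCubeData.V), Z.toCubeData.graph.Adj v w →
      ∀ p r : TotalVertex Ψ, p.1 = v → r.1 = w → (total Ψ).graph.Reachable p r := by
    rintro _ _ h ⟨v, x⟩ ⟨w, y⟩ rfl rfl
    obtain ⟨z⟩ := fib_nonempty Ψ (edgeFace h)
    exact ((hvert v x _).trans (adj_horizontal (C := edgeFace h) (.inl rfl) (.inr rfl) h
      z).reachable).trans (hvert w _ y)
  have hwalk : ∀ (v w : Z.toCubeData.V), Z.toCubeData.graph.Walk v w →
      ∀ p r : TotalVertex Ψ, p.1 = v → r.1 = w → (total Ψ).graph.Reachable p r := by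
    intro v w c
    induction c with
    | nil =>
      rintro ⟨v, x⟩ ⟨w, y⟩ rfl hw
      obtain rfl : w = v := hw
      exact hvert _ x y
    | @cons v u w h c ih =>
      intro p r hp hr
      obtain ⟨z⟩ := fib_nonempty Ψ (Z.vertexFace u)
      exact (hhor v u h p ⟨u, z⟩ hp rfl).trans (ih ⟨u, z⟩ r rfl hr)
  have hZ := Z.isCAT0.isSimplyConnected.connected
  obtain ⟨v⟩ := hZ.nonempty
  obtain ⟨x⟩ := fib_nonempty Ψ (Z.vertexFace v)
  have : Nonempty (total Ψ).V := ⟨⟨v, x⟩⟩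
  refine ⟨fun p r => ?_⟩
  obtain ⟨c⟩ := hZ.preconnected p.1 r.1
  exact hwalk _ _ c p r rfl rfl

theorem eq_of_adj {p r : TotalVertex Ψ} (h : (total Ψ).graph.Adj p r) (heq : p.1 = r.1) :
    ∃ (v : Z.toCubeData.V) (x y : (fib Ψ (Z.vertexFace v)).V),
      (fib Ψ (Z.vertexFace v)).graph.Adj x y ∧ p = ⟨v, x⟩ ∧ r = ⟨v, y⟩ := by
  obtain ⟨v, x⟩ := p
  obtain ⟨w, y⟩ := r
  obtain rfl : v = w := heq
  refine ⟨v, x, y, ?_, rfl, rfl⟩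
  rw [← pt_vertexFace' x, ← pt_vertexFace' y] at h
  exact (adj_vertical (C := Z.vertexFace v) rfl).1 h

section

variable {G : Type*} [Group G] {g : TotalVertex Ψ → TotalVertex Ψ → G}

/-- A cocycle that is trivial along the fibers is constant along the parallel edges of a product. -/
theorem cocycle_const (hg : (total Ψ).IsCocycle g)
    (hvert : ∀ {p r : TotalVertex Ψ}, (total Ψ).graph.Adj p r → p.1 = r.1 → g p r = 1)
    {C : Z.Face} {v w : Z.toCubeData.V} (h : Z.toCubeData.graph.Adj v w) (hv : v ∈ C.1)
    (hw : w ∈ C.1) (x y : (fib Ψ C).V) :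
    g (pt Ψ C hv x) (pt Ψ C hw x) = g (pt Ψ C hv y) (pt Ψ C hw y) := by
  obtain ⟨c⟩ := (fib_connected Ψ C).preconnected x y
  induction c with
  | nil => rfl
  | cons hadj c ih =>
    rw [← ih]
    have s := isSquare_mixed (Ψ := Ψ) h hv hw hadj
    have := hg.square s
    rwa [hvert s.bc rfl, hvert s.ad rfl, one_mul, mul_one] at this

/-- By `cocycle_const` the value on a horizontal edge depends only on the edge of `Z` below. This
gives a cocycle on `Z`, because every square of `Z` lifts to the total space. -/
theorem exists_potential_of_vertical (hg : (total Ψ).IsCocycle g)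
    (hvert : ∀ {p r : TotalVertex Ψ}, (total Ψ).graph.Adj p r → p.1 = r.1 → g p r = 1) :
    ∃ d : Z.toCubeData.V → G, ∀ {p r : TotalVertex Ψ}, (total Ψ).graph.Adj p r →
      g p r = d r.1 * (d p.1)⁻¹ := by
  classical
  let γ : Z.toCubeData.V → Z.toCubeData.V → G := fun v w =>
    if h : Z.toCubeData.graph.Adj v w then
      g (pt Ψ (edgeFace h) (v := v) (.inl rfl) (fib_nonempty Ψ (edgeFace h)).some)
        (pt Ψ (edgeFace h) (v := w) (.inr rfl) (fib_nonempty Ψ (edgeFace h)).some)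
    else 1
  have hγ : ∀ {C : Z.Face} {v w : Z.toCubeData.V} (h : Z.toCubeData.graph.Adj v w) (hv : v ∈ C.1)
      (hw : w ∈ C.1) (x : (fib Ψ C).V), g (pt Ψ C hv x) (pt Ψ C hw x) = γ v w := by
    intro C v w h hv hw x
    have hle := edgeFace_le h hv hw
    simp only [γ, dif_pos h]
    rw [← pt_restr hle (.inl rfl) x, ← pt_restr hle (.inr rfl) x]
    exact cocycle_const hg hvert h _ _ _ _
  have hcoc : Z.toCubeData.IsCocycle γ := by
    refine ⟨fun {a b} h => ?_, fun {a b c d} s => ?_⟩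
    · obtain ⟨z⟩ := fib_nonempty Ψ (edgeFace h)
      rw [← hγ (C := edgeFace h) h (.inl rfl) (.inr rfl) z,
        ← hγ (C := edgeFace h) h.symm (.inr rfl) (.inl rfl) z]
      exact hg.inv (adj_horizontal _ _ h z)
    · obtain ⟨z⟩ := fib_nonempty Ψ ⟨_, s.mem⟩
      have ha : a ∈ ({a, b, c, d} : Set Z.toCubeData.V) := by simp
      have hb : b ∈ ({a, b, c, d} : Set Z.toCubeData.V) := by simp
      have hc : c ∈ ({a, b, c, d} : Set Z.toCubeData.V) := by simp
      have hd : d ∈ ({a, b, c, d} : Set Z.toCubeData.V) := by simp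
      have := hg.square (isSquare_horizontal (C := ⟨_, s.mem⟩) s ha hb hc hd z)
      rwa [hγ s.ab, hγ s.bc, hγ s.ad, hγ s.dc] at this
  obtain ⟨d, hd⟩ := Z.isCAT0.isSimplyConnected.exists_potential hcoc
  refine ⟨d, fun {p r} h => ?_⟩
  by_cases heq : p.1 = r.1
  · rw [hvert h heq, heq, mul_inv_cancel]
  · obtain ⟨hadj, z, hp, hr⟩ := exists_of_adj h heq
    rw [← hd hadj, ← hγ (C := edgeFace hadj) hadj (.inl rfl) (.inr rfl) z, ← hp, ← hr]

/-- The fibers over vertices are simply connected, so `g` has a potential along each of them;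
twisting by these potentials makes the cocycle trivial on vertical edges. -/
theorem total_exists_potential (hg : (total Ψ).IsCocycle g) : ∃ c, (total Ψ).IsPotential g c := by
  have hfib : ∀ v : Z.toCubeData.V, ∃ c : (fib Ψ (Z.vertexFace v)).V → G,
      (fib Ψ (Z.vertexFace v)).IsPotential (fun x y => g ⟨v, x⟩ ⟨v, y⟩) c := by
    intro v
    refine (Ψ.obj (.op (Z.vertexFace v))).isCAT0.isSimplyConnected.exists_potential
      ⟨fun {a b} h => ?_, fun {a b c d} s => ?_⟩
    · simp only [← pt_vertexFace']
      exact hg.inv ((adj_vertical _).2 h)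
    · simp only [← pt_vertexFace']
      exact hg.square (isSquare_vertical _ s)
  choose c hc using hfib
  let c₀ : TotalVertex Ψ → G := fun p => c p.1 p.2
  let g' : TotalVertex Ψ → TotalVertex Ψ → G := fun p r => (c₀ r)⁻¹ * g p r * c₀ p
  have hg' : (total Ψ).IsCocycle g' := by
    refine ⟨fun {a b} h => ?_, fun {a b c d} s => ?_⟩
    · have : g' b a * g' a b = (c₀ a)⁻¹ * (g b a * g a b) * c₀ a := by
        simp only [g']
        group
      rw [this, hg.inv h]
      group
    · have h1 : g' b c * g' a b = (c₀ c)⁻¹ * (g b c * g a b) * c₀ a := by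
        simp only [g']
        group
      have h2 : g' d c * g' a d = (c₀ c)⁻¹ * (g d c * g a d) * c₀ a := by
        simp only [g']
        group
      rw [h1, h2, hg.square s]
  obtain ⟨d, hd⟩ := exists_potential_of_vertical hg' fun {p r} h heq => by
    obtain ⟨v, x, y, hxy, rfl, rfl⟩ := eq_of_adj h heq
    have : g ⟨v, x⟩ ⟨v, y⟩ = c v y * (c v x)⁻¹ := hc v hxy
    simp only [g', c₀]
    rw [this]
    group
  refine ⟨fun p => c₀ p * d p.1, fun {p r} h => ?_⟩
  have : g p r = c₀ r * g' p r * (c₀ p)⁻¹ := by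
    simp only [g']
    group
  rw [this, hd h]
  group

end

variable (Ψ) in
theorem total_isSimplyConnected : (total Ψ).IsSimplyConnected :=
  CubeData.isSimplyConnected_of_potential (total_connected Ψ) fun _ _ _ hg =>
    total_exists_potential hg

theorem eq_pt_of_adj {C : Z.Face} {v : Z.toCubeData.V} {hv : v ∈ C.1} {x : (fib Ψ C).V}
    {r : TotalVertex Ψ} (h : (total Ψ).graph.Adj (pt Ψ C hv x) r) (hne : v ≠ r.1)
    (hr : r.1 ∈ C.1) : r = pt Ψ C hr x := by
  obtain ⟨hadj, z, hp, hz⟩ := exists_of_adj h hne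
  have hle : edgeFace hadj ≤ C := edgeFace_le hadj hv hr
  have hx : restr Ψ hle x = z := (pt_inj.1 ((pt_restr hle (v := v) (.inl rfl) x).trans hp)).2
  rw [← pt_restr hle (.inr rfl) x, hx]
  exact hz

theorem nbrs_prodSet {C : Z.Face} {D : Set (fib Ψ C).V} {v : Z.toCubeData.V} (hv : v ∈ C.1)
    {x : (fib Ψ C).V} (hx : x ∈ D) {r : TotalVertex Ψ} :
    r ∈ (total Ψ).nbrs (prodSet Ψ C D) (pt Ψ C hv x) ↔
      (∃ w, ∃ hw : w ∈ Z.toCubeData.nbrs C.1 v, r = pt Ψ C hw.1 x) ∨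
      ∃ y ∈ (fib Ψ C).nbrs D x, r = pt Ψ C hv y := by
  constructor
  · rintro ⟨⟨w, hw, y, hy, rfl⟩, hadj⟩
    by_cases hvw : v = w
    · subst hvw
      exact .inr ⟨y, ⟨hy, (adj_vertical hv).1 hadj⟩, rfl⟩
    · obtain ⟨h, -⟩ := exists_of_adj hadj hvw
      exact .inl ⟨w, ⟨hw, h⟩, eq_pt_of_adj hadj hvw hw⟩
  · rintro (⟨w, hw, rfl⟩ | ⟨y, hy, rfl⟩)
    · exact ⟨pt_mem_prodSet.2 hx, adj_horizontal hv hw.1 hw.2 x⟩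
    · exact ⟨pt_mem_prodSet.2 hy.1, (adj_vertical hv).2 hy.2⟩

theorem OneDetermined.mem_imageAt (hΨ : OneDetermined Ψ) {C : Z.Face} {v : Z.toCubeData.V}
    (hv : v ∈ C.1) {x : (fib Ψ (Z.vertexFace v)).V}
    (h : ∀ (w : Z.toCubeData.V) (hw : w ∈ Z.toCubeData.nbrs C.1 v),
      ∃ z : (fib Ψ (edgeFace hw.2)).V, pt Ψ (edgeFace hw.2) (.inl rfl) z = ⟨v, x⟩) :
    ∃ y : (fib Ψ C).V, pt Ψ C hv y = ⟨v, x⟩ := by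
  suffices hx : x ∈ imageAt Ψ hv by
    obtain ⟨y, rfl⟩ := hx
    exact ⟨y, rfl⟩
  rw [hΨ C v hv]
  simp only [Set.mem_iInter]
  intro e he hle hve
  obtain ⟨a, b, hab, heq⟩ := Set.ncard_eq_two.1 he
  obtain ⟨w, hne, hew⟩ : ∃ w, v ≠ w ∧ e.1 = {v, w} := by
    rw [heq] at hve
    rcases hve with rfl | rfl
    · exact ⟨b, hab, heq⟩
    · exact ⟨a, hab.symm, heq.trans (Set.pair_comm _ _)⟩
  have hadj : Z.toCubeData.graph.Adj v w := ⟨hne, hew ▸ e.2⟩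
  obtain rfl : e = edgeFace hadj := Subtype.ext hew
  obtain ⟨z, hz⟩ := h w ⟨hle (.inr rfl), hadj⟩
  exact ⟨z, eq_of_heq (Sigma.mk.inj hz).2⟩

/-- The horizontal members of `A` project to pairwise adjacent vertices of a link in `Z` and so span
a cube `C`. Since the members of `A` pairwise lie in common cubes, the base point and the vertical
members extend over each edge of `C` at `v`. By 1-determination they come from the complex over `C`,
whose links are flag, and the resulting `D` gives the cube `C × D`. -/
theorem OneDetermined.total_flag (hΨ : OneDetermined Ψ) (p : TotalVertex Ψ)
    (A : Set (TotalVertex Ψ)) (hA : A.Finite)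
    (h : ∀ a ∈ A, ∀ b ∈ A, {a, b} ∈ (total Ψ).link p) : A ∈ (total Ψ).link p := by
  obtain ⟨v, x⟩ := p
  have hpair : ∀ a ∈ A, ∀ b ∈ A, ∃ (C : Z.Face) (D : Set (fib Ψ C).V) (hv : v ∈ C.1)
      (y : (fib Ψ C).V), D ∈ (fib Ψ C).cubes ∧ y ∈ D ∧ pt Ψ C hv y = ⟨v, x⟩ ∧
        a ∈ (total Ψ).nbrs (prodSet Ψ C D) (pt Ψ C hv y) ∧
        b ∈ (total Ψ).nbrs (prodSet Ψ C D) (pt Ψ C hv y) := by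
    intro a ha b hb
    obtain ⟨_, ⟨C, D, hD, rfl⟩, ⟨w, hw, y, hy, hp⟩, hab⟩ := h a ha b hb
    obtain rfl : v = w := congrArg Sigma.fst hp
    rw [hp] at hab
    exact ⟨C, D, hw, y, hD, hy, hp.symm, hab.le (.inl rfl), hab.le (.inr rfl)⟩
  have hadj : ∀ a ∈ A, (total Ψ).graph.Adj ⟨v, x⟩ a := by
    intro a ha
    obtain ⟨C, D, hv, y, -, -, hp, ha, -⟩ := hpair a ha a ha
    exact hp ▸ ha.2
  have hhor : ∀ {C : Z.Face} {D : Set (fib Ψ C).V} {hv : v ∈ C.1} {y : (fib Ψ C).V}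
      {a : TotalVertex Ψ}, y ∈ D → a ∈ (total Ψ).nbrs (prodSet Ψ C D) (pt Ψ C hv y) → v ≠ a.1 →
        a.1 ∈ Z.toCubeData.nbrs C.1 v := by
    intro C D hv y a hy ha hne
    rcases (nbrs_prodSet hv hy).1 ha with ⟨w, hw, rfl⟩ | ⟨z, -, rfl⟩
    · exact hw
    · exact absurd rfl hne
  have hver : ∀ {C : Z.Face} {D : Set (fib Ψ C).V} {hv : v ∈ C.1} {y : (fib Ψ C).V}
      {a : TotalVertex Ψ}, y ∈ D → a ∈ (total Ψ).nbrs (prodSet Ψ C D) (pt Ψ C hv y) → v = a.1 →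
        ∃ z ∈ (fib Ψ C).nbrs D y, a = pt Ψ C hv z := by
    intro C D hv y a hy ha heq
    rcases (nbrs_prodSet hv hy).1 ha with ⟨w, hw, rfl⟩ | ⟨z, hz, rfl⟩
    · exact absurd heq hw.2.ne
    · exact ⟨z, hz, rfl⟩
  obtain ⟨C, hC, hvC, hnC⟩ := Z.isCAT0.exists_cube (v := v)
    (A := Sigma.fst '' {a | a ∈ A ∧ v ≠ a.1}) ((hA.subset fun _ ha => ha.1).image _) (by
      rintro _ ⟨a, ⟨ha, hne⟩, rfl⟩
      obtain ⟨C, D, hv, y, -, hy, -, ha, -⟩ := hpair a ha a ha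
      exact (hhor hy ha hne).2) (by
      rintro _ ⟨a, ⟨ha, hne⟩, rfl⟩ _ ⟨b, ⟨hb, hne'⟩, rfl⟩ hab
      obtain ⟨C, D, hv, y, -, hy, -, ha, hb⟩ := hpair a ha b hb
      obtain ⟨t, -, s⟩ := Z.isCAT0.isCubeComplex.exists_isSquare C.2 hv (hhor hy ha hne)
        (hhor hy hb hne') hab
      exact ⟨t, s⟩)
  lift C to Z.Face using hC
  have hx : ∃ y, pt Ψ C hvC y = ⟨v, x⟩ := by
    refine hΨ.mem_imageAt hvC fun w hw => ?_
    have hw' := hw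
    rw [hnC] at hw'
    obtain ⟨a, ⟨ha, hne⟩, rfl⟩ := hw'
    obtain ⟨C', D, hv, y, -, hy, hp, ha, -⟩ := hpair a ha a ha
    have hle := edgeFace_le hw.2 hv (hhor hy ha hne).1
    exact ⟨restr Ψ hle y, (pt_restr hle (.inl rfl) y).trans hp⟩
  obtain ⟨y, hy⟩ := hx
  have hver' : ∀ b ∈ A, v = b.1 → ∃ z, pt Ψ C hvC z = b := by
    rintro ⟨w, z⟩ hb hvb
    obtain rfl : v = w := hvb
    refine hΨ.mem_imageAt hvC fun w hw => ?_
    have hw' := hw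
    rw [hnC] at hw'
    obtain ⟨a, ⟨ha, hne⟩, rfl⟩ := hw'
    obtain ⟨C', D, hv, y, -, hy, hp, ha, hb⟩ := hpair a ha _ hb
    obtain ⟨t, -, ht⟩ := hver hy hb rfl
    have hle := edgeFace_le hw.2 hv (hhor hy ha hne).1
    exact ⟨restr Ψ hle t, (pt_restr hle (.inl rfl) t).trans ht.symm⟩
  have hinj : Function.Injective (pt Ψ C hvC) := fun _ _ h => (pt_inj.1 h).2
  obtain ⟨D, hD, hyD, hnD⟩ := (Ψ.obj (.op C)).isCAT0.flag y (pt Ψ C hvC ⁻¹' A)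
    (hA.preimage hinj.injOn) (by
      intro a ha b hb
      obtain ⟨C', D, hv, y', hD, hy', hp, ha', hb'⟩ := hpair _ ha _ hb
      obtain ⟨a', ha', haa⟩ := hver hy' ha' rfl
      obtain ⟨b', hb', hbb⟩ := hver hy' hb' rfl
      have hval : ∀ {z : (fib Ψ C).V} {z' : (fib Ψ C').V}, pt Ψ C hvC z = pt Ψ C' hv z' →
          restr Ψ (vertexFace_le hvC) z = restr Ψ (vertexFace_le hv) z' :=
        fun h => eq_of_heq (Sigma.mk.inj h).2
      have hlink : {a', b'} ∈ (fib Ψ C').link y' := by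
        by_cases hab : a' = b'
        · rw [hab, Set.pair_eq_singleton]
          exact CubeData.singleton_mem_link hb'.2
        · obtain ⟨t, -, s⟩ := (Ψ.obj (.op C')).isCAT0.isCubeComplex.exists_isSquare hD hy' ha' hb'
            hab
          exact s.mem_link (Ψ.obj (.op C')).isCAT0.isCubeComplex
      -- The pair is known to span a cube over another face `C'`; the complexes over `C` and `C'`
      -- are compared inside the one over `v`, into which both embed convexly.
      have hcat := (Ψ.obj (.op (Z.vertexFace v))).isCAT0
      rw [← (restr_convex Ψ (vertexFace_le hv)).image_mem_link_iff hcat, Set.image_pair,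
        ← hval haa, ← hval hbb, ← hval (hy.trans hp.symm), ← Set.image_pair,
        (restr_convex Ψ (vertexFace_le hvC)).image_mem_link_iff hcat] at hlink
      exact hlink)
  refine ⟨prodSet Ψ C D, prodSet_mem_cubes hD, hy ▸ pt_mem_prodSet.2 hyD, ?_⟩
  have hD' : pt Ψ C hvC ⁻¹' A = (fib Ψ C).nbrs D y := hnD
  ext a
  change a ∈ A ↔ a ∈ (total Ψ).nbrs (prodSet Ψ C D) ⟨v, x⟩
  rw [← hy, nbrs_prodSet hvC hyD]
  rw [← hy] at hadj
  constructor
  · intro ha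
    by_cases hva : v = a.1
    · obtain ⟨z, rfl⟩ := hver' a ha hva
      exact .inr ⟨z, hD' ▸ ha, rfl⟩
    · have hw : a.1 ∈ Z.toCubeData.nbrs C.1 v := hnC ▸ ⟨a, ⟨ha, hva⟩, rfl⟩
      exact .inl ⟨a.1, hw, eq_pt_of_adj (hadj a ha) hva hw.1⟩
  · rintro (⟨w, hw, rfl⟩ | ⟨z, hz, rfl⟩)
    · have hw' := hw
      rw [hnC] at hw'
      obtain ⟨a, ⟨ha, hva⟩, rfl⟩ := hw'
      rw [← eq_pt_of_adj (hadj a ha) hva hw.1]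
      exact ha
    · exact hD'.symm.le hz

theorem OneDetermined.total_isCAT0 (hΨ : OneDetermined Ψ) : (total Ψ).IsCAT0 :=
  ⟨total_isCubeComplex Ψ, total_isSimplyConnected Ψ, hΨ.total_flag⟩

end CCC

/-! ### The projection of the total space and its fiber functor. -/

namespace CCC

/-- Bijections that preserve and reflect cubes are isomorphisms. -/
noncomputable def isoOfBijective {X Y : CCC.{u}} (f : X.toCubeData.V → Y.toCubeData.V)
    (hf : Function.Bijective f)
    (h : ∀ S : Set X.toCubeData.V, f '' S ∈ Y.toCubeData.cubes ↔ S ∈ X.toCubeData.cubes) :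
    X ≅ Y where
  hom := ⟨f, hf.1, h, fun _ _ z _ => hf.2 z⟩
  inv := ⟨(Equiv.ofBijective f hf).symm, (Equiv.ofBijective f hf).symm.injective, fun S => by
    rw [← h]
    have : f '' ((Equiv.ofBijective f hf).symm '' S) = S :=
      (Equiv.ofBijective f hf).image_symm_image S
    rw [this], fun _ _ z _ => (Equiv.ofBijective f hf).symm.surjective z⟩
  hom_inv_id := Hom.ext (funext fun x => (Equiv.ofBijective f hf).symm_apply_apply x)
  inv_hom_id := Hom.ext (funext fun x => (Equiv.ofBijective f hf).apply_symm_apply x)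

variable {Z : CCC.{u}} {Ψ : Z.Faceᵒᵖ ⥤ CCC.{u}}

/-- The total space as a CAT(0) cube complex. -/
def totalSpace (hΨ : OneDetermined Ψ) : CCC.{u} := ⟨total Ψ, hΨ.total_isCAT0⟩

/-- The projection of the total space to the base. -/
def projection (hΨ : OneDetermined Ψ) : CubicalMap (totalSpace hΨ) Z where
  toFun := Sigma.fst
  cubical := by
    rintro _ ⟨C, D, hD, rfl⟩
    obtain ⟨n, e, he⟩ := Z.isCAT0.isCubeComplex.exists_chart C.1 C.2
    obtain ⟨m, e', he'⟩ := (Ψ.obj (.op C)).isCAT0.isCubeComplex.exists_chart D hD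
    have hfst := fst_image_prodSet ((Ψ.obj (.op C)).isCAT0.isCubeComplex.nonempty hD)
    exact ⟨n + m, n, _, e, Fin.castAdd m, Fin.castAdd_injective n m, isChart_prodSet he he',
      hfst.symm ▸ he, fun _ => rfl⟩

theorem OneDetermined.half_pt_eq (hΨ : OneDetermined Ψ) {C : Z.Face}
    {v w : Z.toCubeData.V} (h : Z.toCubeData.graph.Adj v w) (hv : v ∈ C.1) (hw : w ∈ C.1)
    (x y : (fib Ψ C).V) : (total Ψ).half (pt Ψ C hv x) (pt Ψ C hw x) = (total Ψ).half (pt Ψ C hv y) (pt Ψ C hw y) := by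
  obtain ⟨c⟩ := (fib_connected Ψ C).preconnected x y
  induction c with
  | nil => rfl
  | cons hadj c ih =>
    rw [← ih]
    exact hΨ.total_isCAT0.half_eq_of_isSquare (isSquare_mixed h hv hw hadj)

/-- Edges over the same edge of `Z` correspond to vertices of the connected complex over that edge,
and adjacent vertices give opposite sides of a square. -/
theorem OneDetermined.wall_eq_of_fst_eq (hΨ : OneDetermined Ψ) {p r p' r' : TotalVertex Ψ}
    (h : (total Ψ).graph.Adj p r) (h' : (total Ψ).graph.Adj p' r') (hne : p.1 ≠ r.1)
    (heq : s(p.1, r.1) = s(p'.1, r'.1)) : (total Ψ).wall p r = (total Ψ).wall p' r' := by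
  have aux : ∀ {p r p' r' : TotalVertex Ψ}, (total Ψ).graph.Adj p r → (total Ψ).graph.Adj p' r' →
      p.1 ≠ r.1 → p.1 = p'.1 → r.1 = r'.1 → (total Ψ).wall p r = (total Ψ).wall p' r' := by
    rintro ⟨v, x⟩ ⟨w, y⟩ ⟨v', x'⟩ ⟨w', y'⟩ h h' hne hv hw
    obtain rfl : v = v' := hv
    obtain rfl : w = w' := hw
    obtain ⟨hadj, z, h1, h2⟩ := exists_of_adj h hne
    obtain ⟨_, z', h1', h2'⟩ := exists_of_adj h' hne
    have e1 := hΨ.half_pt_eq (C := edgeFace hadj) hadj (.inl rfl) (.inr rfl) z z'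
    have e2 := hΨ.half_pt_eq (C := edgeFace hadj) hadj.symm (.inr rfl) (.inl rfl) z z'
    exact (congrArg₂ (total Ψ).wall h1 h2).trans
      ((congrArg₂ (fun S T => ({S, T} : Set (Set (TotalVertex Ψ)))) e1 e2).trans
        (congrArg₂ (total Ψ).wall h1' h2').symm)
  rcases Sym2.eq_iff.1 heq with ⟨h1, h2⟩ | ⟨h1, h2⟩
  · exact aux h h' hne h1 h2
  · exact (aux h h'.symm hne h1 h2).trans (CubeData.wall_comm (K := total Ψ) r' p')

/-- A square of `Z` lifts, so opposite sides have lifts with the same wall. The first conjunct is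
there for transitivity: the intermediate pair must be known to be an edge before an edge over it can
be chosen. -/
theorem OneDetermined.wall_eq_of_parallel (hΨ : OneDetermined Ψ) {e e' : Sym2 Z.toCubeData.V}
    (hp : Relation.EqvGen Z.toCubeData.Opposite e e') :
    (e ∈ Z.toCubeData.graph.edgeSet ↔ e' ∈ Z.toCubeData.graph.edgeSet) ∧
      (e ∈ Z.toCubeData.graph.edgeSet → ∀ {p r p' r' : TotalVertex Ψ},
        (total Ψ).graph.Adj p r → (total Ψ).graph.Adj p' r' → s(p.1, r.1) = e →
          s(p'.1, r'.1) = e' → (total Ψ).wall p r = (total Ψ).wall p' r') := by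
  induction hp with
  | rel e e' h =>
    obtain ⟨a, b, c, d, s, rfl, rfl⟩ := h
    refine ⟨iff_of_true s.ab s.dc, fun _ p r p' r' h h' he he' => ?_⟩
    obtain ⟨z⟩ := fib_nonempty Ψ ⟨_, s.mem⟩
    have ha : a ∈ ({a, b, c, d} : Set Z.toCubeData.V) := by simp
    have hb : b ∈ ({a, b, c, d} : Set Z.toCubeData.V) := by simp
    have hc : c ∈ ({a, b, c, d} : Set Z.toCubeData.V) := by simp
    have hd : d ∈ ({a, b, c, d} : Set Z.toCubeData.V) := by simp
    have t := isSquare_horizontal (C := ⟨_, s.mem⟩) s ha hb hc hd z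
    have e1 := hΨ.total_isCAT0.half_eq_of_isSquare t
    have e2 := hΨ.total_isCAT0.half_eq_of_isSquare t.rotate.symm
    exact (hΨ.wall_eq_of_fst_eq t.ab h s.ab.ne he.symm).symm.trans
      ((congrArg₂ (fun S T => ({S, T} : Set (Set (TotalVertex Ψ)))) e1 e2).trans
        (hΨ.wall_eq_of_fst_eq t.dc h' s.dc.ne he'.symm))
  | refl e =>
    refine ⟨Iff.rfl, fun hE p r p' r' h h' he he' => ?_⟩
    subst he
    exact hΨ.wall_eq_of_fst_eq h h' hE.1 he'.symm
  | symm e e' _ ih =>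
    exact ⟨ih.1.symm, fun hE _ _ _ _ h h' he he' => (ih.2 (ih.1.2 hE) h' h he' he).symm⟩
  | trans e e₁ e' _ _ ih ih' =>
    refine ⟨ih.1.trans ih'.1, fun hE p r p' r' h h' he he' => ?_⟩
    have hE' := ih.1.1 hE
    induction e₁ using Sym2.ind with | _ v w =>
    obtain ⟨z⟩ := fib_nonempty Ψ (edgeFace (v := v) (w := w) hE')
    have hadj := adj_horizontal (C := edgeFace hE') (.inl rfl) (.inr rfl) hE' z
    exact (ih.2 hE h hadj he rfl).trans (ih'.2 hE' hadj h' rfl he')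

/-- A geodesic from `a` to a vertex outside the preimage leaves it along an edge over an edge
parallel to that from `v` to `w`. This edge has the wall of `a` and `b`, yet convexity keeps both
its ends in the halfspace. -/
theorem OneDetermined.half_subset (hΨ : OneDetermined Ψ) {v w : Z.toCubeData.V}
    (h : Z.toCubeData.graph.Adj v w) {a b : TotalVertex Ψ} (hab : (total Ψ).graph.Adj a b)
    (ha : a.1 = v) (hb : b.1 = w) :
    (total Ψ).half a b ⊆ Sigma.fst ⁻¹' Z.toCubeData.half v w := by
  intro x hx
  by_contra hxS
  have hK := hΨ.total_isCAT0
  have haS : a ∈ Sigma.fst ⁻¹' Z.toCubeData.half v w := by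
    change a.1 ∈ Z.toCubeData.half v w
    rw [ha]
    exact CubeData.left_mem_half h
  obtain ⟨t, t', htt, ht, ht', h1, h2⟩ :=
    CubeData.exists_boundary_edge (total_connected Ψ) haS hxS
  have ht'H : t' ∈ (total Ψ).half a b :=
    hK.half_convex hab a (CubeData.left_mem_half hab) x hx t' h2
  have htH : t ∈ (total Ψ).half a b := by
    refine hK.half_convex hab a (CubeData.left_mem_half hab) x hx t ?_
    have h3 := (total_connected Ψ).dist_triangle (u := t) (v := t') (w := x)
    have h4 := (total_connected Ψ).dist_triangle (u := a) (v := t) (w := x)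
    rw [SimpleGraph.dist_eq_one_iff_adj.2 htt] at h3
    omega
  have hne : t.1 ≠ t'.1 := by
    intro heq
    refine ht' ?_
    change t'.1 ∈ Z.toCubeData.half v w
    rw [← heq]
    exact ht
  obtain ⟨hadj, -⟩ := exists_of_adj htt hne
  have hpar := Z.isCAT0.parallel_of_cross h hadj ht ht'
  have hwall := (hΨ.wall_eq_of_parallel hpar).2 h hab htt (by rw [ha, hb]) rfl
  have hmem : (total Ψ).half a b ∈ (total Ψ).wall t t' := hwall ▸ Set.mem_insert _ _
  rcases hmem with hm | hm
  · rw [hm, ← hK.isModular.notMem_half_iff htt.symm] at ht'H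
    exact ht'H (CubeData.left_mem_half htt.symm)
  · rw [hm, ← hK.isModular.notMem_half_iff htt] at htH
    exact htH (CubeData.left_mem_half htt)

/-- Applying `half_subset` to both orientations of an edge turns the inclusions into equalities,
since halfspaces come in complementary pairs. -/
theorem OneDetermined.projection_pullsBackWalls (hΨ : OneDetermined Ψ) :
    (projection hΨ).PullsBackWalls where
  surjective v := by
    obtain ⟨x⟩ := fib_nonempty Ψ (Z.vertexFace v)
    exact ⟨(⟨v, x⟩ : TotalVertex Ψ), rfl⟩
  exists_half {v w} h := by
    obtain ⟨z⟩ := fib_nonempty Ψ (edgeFace h)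
    have hab := adj_horizontal (C := edgeFace h) (.inl rfl) (.inr rfl) h z
    refine ⟨_, _, hab, Set.Subset.antisymm (fun x hx => ?_) (hΨ.half_subset h hab rfl rfl)⟩
    by_contra hx'
    have hx2 := hΨ.half_subset h.symm hab.symm rfl rfl
      ((hΨ.total_isCAT0.isModular.notMem_half_iff hab).1 hx')
    exact (Z.isCAT0.isModular.notMem_half_iff h).2 hx2 hx

section fibers

variable (hΨ : OneDetermined Ψ)

/-- The vertex of the fiber of the projection given by a vertex of the complex over a face. -/
def toFiber (C : Z.Face) (x : (fib Ψ C).V) : ((projection hΨ).fiber C).V :=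
  ⟨⟨prodSet Ψ C {x}, prodSet_mem_cubes
    ((Ψ.obj (.op C)).isCAT0.isCubeComplex.singleton_mem x)⟩, by
    refine ⟨?_, ?_, ?_⟩
    · rintro _ ⟨v, hv, y, -, rfl⟩
      exact hv
    · rintro _ ⟨v, hv, _, rfl, rfl⟩ _ ⟨w, hw, _, rfl, rfl⟩ h
      obtain rfl : v = w := h
      rfl
    · intro v hv
      exact ⟨pt Ψ C hv x, pt_mem_prodSet.2 rfl, rfl⟩⟩

theorem eq_of_image_eq {C C' : Z.Face} {D : Set (fib Ψ C').V} (hD : D ∈ (fib Ψ C').cubes)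
    (h : (projection hΨ).toFun '' prodSet Ψ C' D = C.1) : C' = C :=
  Subtype.ext ((fst_image_prodSet
    ((Ψ.obj (.op C')).isCAT0.isCubeComplex.nonempty hD)).symm.trans h)

theorem toFiber_bijective (C : Z.Face) : Function.Bijective (toFiber hΨ C) := by
  constructor
  · intro x y h
    have h' : prodSet Ψ C {x} = prodSet Ψ C {y} := congrArg (fun E => E.1.1) h
    exact prodSet_subset_iff.1 h'.le rfl
  · rintro ⟨⟨_, C', D, hD, rfl⟩, hbij⟩
    obtain rfl := eq_of_image_eq hΨ hD hbij.image_eq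
    obtain ⟨x, hx⟩ := (Ψ.obj (.op C')).isCAT0.isCubeComplex.nonempty hD
    obtain ⟨v, hv⟩ := Z.isCAT0.isCubeComplex.nonempty C'.2
    refine ⟨x, Subtype.ext (Subtype.ext ?_)⟩
    change prodSet Ψ C' {x} = prodSet Ψ C' D
    congr 1
    refine (Set.singleton_subset_iff.2 hx).antisymm fun y hy => ?_
    have : pt Ψ C' hv y = pt Ψ C' hv x :=
      hbij.injOn (pt_mem_prodSet.2 hy) (pt_mem_prodSet.2 hx) rfl
    exact (pt_inj.1 this).2

theorem toFiber_image_mem_cubes_iff (C : Z.Face) (S : Set (fib Ψ C).V) :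
    toFiber hΨ C '' S ∈ ((projection hΨ).fiber C).cubes ↔ S ∈ (fib Ψ C).cubes := by
  have key : ∀ (D : Set (fib Ψ C).V) (hD : prodSet Ψ C D ∈ (total Ψ).cubes),
      {E : ((projection hΨ).fiber C).V | E.1 ≤ (⟨_, hD⟩ : (total Ψ).Face)} =
        toFiber hΨ C '' D := by
    intro D hD
    ext E
    obtain ⟨x, rfl⟩ := (toFiber_bijective hΨ C).2 E
    rw [(toFiber_bijective hΨ C).1.mem_set_image]
    exact prodSet_subset_iff.trans Set.singleton_subset_iff
  constructor
  · rintro ⟨⟨_, C', D, hD, rfl⟩, himg, hS⟩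
    obtain rfl := eq_of_image_eq hΨ hD himg
    have := hS.trans (key D ⟨C', D, hD, rfl⟩)
    rwa [(toFiber_bijective hΨ C').1.image_injective this]
  · intro hS
    exact ⟨⟨_, prodSet_mem_cubes hS⟩, fst_image_prodSet
      ((Ψ.obj (.op C)).isCAT0.isCubeComplex.nonempty hS), (key S _).symm⟩

/-- The fiber functor of the projection of the total space is the given functor. -/
noncomputable def fiberFunctorIso (hq : (projection hΨ).FibersInCCC) :
    (projection hΨ).fiberFunctor hq ≅ Ψ :=
  (NatIso.ofComponents (fun C => isoOfBijective (X := Ψ.obj C)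
    (Y := ((projection hΨ).fiberFunctor hq).obj C) (toFiber hΨ C.unop)
    (toFiber_bijective hΨ C.unop) (toFiber_image_mem_cubes_iff hΨ C.unop)) (by
    intro C C' f
    refine Hom.ext (funext fun x => Subtype.ext (Subtype.ext ?_))
    have h := prodSet_inter_preimage (leOfHom f.unop) ({x} : Set (fib Ψ C.unop).V)
    rw [Set.image_singleton] at h
    exact h.symm)).symm

end fibers

end CCC

theorem mainTheorem7 (Z : CCC.{u}) :
    (∀ Ψ : Z.Faceᵒᵖ ⥤ CCC.{u}, CCC.OneDetermined Ψ →
      ∃ (Y : CCC.{u}) (q : CubicalMap Y Z), q.IsRestrictionQuotient ∧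
        ∃ hq : q.FibersInCCC, Nonempty (q.fiberFunctor hq ≅ Ψ)) ∧
    (∀ (Y : CCC.{u}) (q : CubicalMap Y Z), q.IsRestrictionQuotient →
      ∃ hq : q.FibersInCCC, CCC.OneDetermined (q.fiberFunctor hq)) := by
  refine ⟨fun Ψ hΨ => ?_, fun Y q hq => ?_⟩
  · have hq := hΨ.projection_pullsBackWalls
    exact ⟨CCC.totalSpace hΨ, CCC.projection hΨ, hq.isRestrictionQuotient, hq.fibersInCCC,
      ⟨CCC.fiberFunctorIso hΨ hq.fibersInCCC⟩⟩
  · have hq' := hq.pullsBackWalls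
    exact ⟨hq'.fibersInCCC, hq'.oneDetermined hq'.fibersInCCC⟩
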